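/- **Notation.** Write $A=(1\pm\varepsilon)B$ for $(1-\varepsilon)B\le A\le(1+\varepsilon)B$. Fix integers $k,\ell$ with $\ell\ge 1$ and $\ell<k/2$, and put $z=\lceil (k-\ell)/\ell\rceil\ge 2$, $q=\ell z$ (so $k/2<k-\ell\le q<k$). **Regular $k$-graphs.** An $n$-vertex $k$-uniform hypergraph ($k$-graph) $H$ is $(\varepsilon,p)$-regular if for all $d\in\{1,\dots,\ell\}$, $s\in\{1,\dots,2z+2\}$ and all distinct $(k-d)$-sets of vertices $A_1,\dots,A_s$ with $|\bigcup_i A_i|\le k+2q$, there are $(1\pm\varepsilon)\frac{n^d}{d!}p^s$ sets $D$ of $d$ vertices such that all of $A_1\cup D,\dots,A_s\cup D$ are edges of $H$. **Regular digraphs.** A digraph with $\nu$ vertices is $(\varepsilon,p)$-regular if (i) every in-degree and every out-degree is $(1\pm\varepsilon)\nu p$; (ii) for all distinct vertices $a,b$, the number of common out-neighbours, the number of common in-neighbours, and the number of out-neighbours of $a$ that are in-neighbours of $b$ are each $(1\pm\varepsilon)\nu p^2$; (iii) for all vertices $a,b,c,d$, distinct except that $b=c$ is allowed, there are $(1\pm\varepsilon)\nu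 p^4$ vertices $x$ such that $ax,xb,cx,xd$ are all arcs. **The digraph $D_\sigma$.** Let $H$ be a $k$-graph on $[n]$ with $q\mid n$. For $q$-tuples $\mathbf v=(v_1,\dots,v_q)$, $\mathbf w=(v_{q+1},\dots,v_{2q})$ and $0\le i\le z-1$ put $e_i(\mathbf v,\mathbf w)=\{v_{i\ell+1},\dots,v_{i\ell+k}\}$. For a permutation $\sigma$ of $[n]$, the vertices of $D_\sigma$ are the $n/q$ consecutive blocks of length $q$ of the sequence $\sigma(1),\dots,\sigma(n)$, and there is an arc from $\mathbf v$ to $\mathbf w$ if $e_0(\mathbf v,\mathbf w),\dots,e_{z-1}(\mathbf v,\mathbf w)$ are all edges of $H$; the arc is then said to own these edges. **The procedure.** Put $\kappa=\frac{6(k+1)\log n}{\varepsilon^2}$ and let $r$ be the number $\frac{\ell q n^{k-2}}{k!\,p^{z-1}}\,\kappa$ rounded to an integer, up or down. (1) Choose independent uniformly random permutations $\sigma_1,\dots,\sigma_r$ of $[n]$. (2) Let $H_i$ be the $k$-graph of the edges of $H$ owned by arcs of $D_{\sigma_i}$. (3) For each edge $e$ of $H$ with $I_e=\{i:e\in H_i\}\neq\emptyset$,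 label $e$ with a uniformly random element of $I_e$, independently for different edges. (4) Let $D'_{\sigma_i}$ consist of the arcs of $D_{\sigma_i}$ all of whose $z$ owned edges are labelled $i$. (5) Let $H'_i$ be the $k$-graph of the edges owned by arcs of $D'_{\sigma_i}$. Put $H'=H\setminus\bigcup_{i=1}^r H'_i$. **Lemma.** For all integers $k,\ell$ with $1\le \ell<k/2$ there is $\varepsilon_0=\varepsilon_0(k,\ell)>0$ such that the following holds. Let $\varepsilon=\varepsilon(n)\in(0,\varepsilon_0]$ and $p=p(n)>0$ satisfy $$\frac{\varepsilon^{8z+2}\,n\,p^{8z}}{\log^{4z+1}n}\to\infty\qquad(n\to\infty).$$ Then there is a sequence $\delta(n)=o(1/n)$ such that for every $n$ divisible by $q$ and every $(\varepsilon,p)$-regular $k$-graph $H$ on $[n]$, the procedure run on $H$ has the following two properties simultaneously with probability at least $1-\delta(n)$: (a) every $D'_{\sigma_i}$, $1\le i\le r$, is $\bigl(12z^2\varepsilon,(p/\kappa)^z\bigr)$-regular; (b) $H'$ is $(\varepsilon',p')$-regular, where $\varepsilon'=\varepsilon\left(1+\frac{7z^3}{\kappa^{z-1}}\right)$ and $p'=p\left(1-\frac1{\kappa^{z-1}}\right)$.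 -/

import Mathlib

open Filter Asymptotics
open scoped Topology

namespace HamPacking

/-- `A = (1 ± ε) B`, that is, `(1 - ε) B ≤ A ≤ (1 + ε) B`. -/
def Within (ε A B : ℝ) : Prop :=
  (1 - ε) * B ≤ A ∧ A ≤ (1 + ε) * B

/-- `z = ⌈(k - ℓ) / ℓ⌉`. -/
def zz (k ℓ : ℕ) : ℕ := (k - ℓ) ⌈/⌉ ℓ

/-- `q = ℓ z`. -/
def qq (k ℓ : ℕ) : ℕ := ℓ * zz k ℓ

/-- A `k`-uniform hypergraph with vertex set `V`. -/
structure KGraph (V : Type) (k : ℕ) where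
  edges : Finset (Finset V)
  uniform : ∀ e ∈ edges, e.card = k

open Classical in
/-- `(ε, p)`-regularity of an `n`-vertex `k`-graph (for cycles of type `ℓ`): for all
`1 ≤ d ≤ ℓ` and `1 ≤ s ≤ 2z + 2`, and every family of `s` distinct `(k - d)`-sets whose union has
at most `k + 2q` elements, there are `(1 ± ε) (n ^ d / d!) p ^ s` sets `D` of `d` vertices such
that `a ∪ D` is an edge for all members `a` of the family. -/
def KGraph.IsRegular {V : Type} [Fintype V] {k : ℕ} (H : KGraph V k) (ℓ : ℕ) (ε p : ℝ) : Prop :=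
  ∀ d s : ℕ, 1 ≤ d → d ≤ ℓ → 1 ≤ s → s ≤ 2 * zz k ℓ + 2 →
    ∀ A : Finset (Finset V), A.card = s → (∀ a ∈ A, a.card = k - d) →
      (A.biUnion id).card ≤ k + 2 * qq k ℓ →
      Within ε
        ((Finset.univ.filter
          fun D : Finset V => D.card = d ∧ ∀ a ∈ A, a ∪ D ∈ H.edges).card : ℝ)
        ((Fintype.card V : ℝ) ^ d / (d.factorial : ℝ) * p ^ s)

open Classical in
/-- `(ε, p)`-regularity of a digraph with `Fintype.card V` vertices. -/
def DigraphRegular {V : Type} [Fintype V] (D : Digraph V) (ε p : ℝ) : Prop :=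
  (∀ a : V,
    Within ε ((Finset.univ.filter fun x => D.Adj a x).card : ℝ) (Fintype.card V * p) ∧
    Within ε ((Finset.univ.filter fun x => D.Adj x a).card : ℝ) (Fintype.card V * p)) ∧
  (∀ a b : V, a ≠ b →
    Within ε ((Finset.univ.filter fun x => D.Adj a x ∧ D.Adj b x).card : ℝ)
      (Fintype.card V * p ^ 2) ∧
    Within ε ((Finset.univ.filter fun x => D.Adj x a ∧ D.Adj x b).card : ℝ)
      (Fintype.card V * p ^ 2) ∧
    Within ε ((Finset.univ.filter fun x => D.Adj a x ∧ D.Adj x b).card : ℝ)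
      (Fintype.card V * p ^ 2)) ∧
  (∀ a b c d : V, a ≠ b → a ≠ c → a ≠ d → b ≠ d → c ≠ d →
    Within ε
      ((Finset.univ.filter
        fun x => D.Adj a x ∧ D.Adj x b ∧ D.Adj c x ∧ D.Adj x d).card : ℝ)
      (Fintype.card V * p ^ 4))

/-- The set `e_i(v, w) = {u_{iℓ+1}, …, u_{iℓ+k}}`, where `u = (u_1, …, u_{2q})` is the
concatenation of the `q`-tuples `v` and `w`. -/
def ownedEdge {V : Type} [DecidableEq V] (k ℓ : ℕ) {q : ℕ} (v w : Fin q → V) (i : ℕ) : Finset V :=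
  (Finset.univ.filter
    fun t : Fin (q + q) => i * ℓ ≤ (t : ℕ) ∧ (t : ℕ) < i * ℓ + k).image (Fin.append v w)

/-- `v` precedes `w` if all of `e_0(v, w), …, e_{z-1}(v, w)` are edges of `H`. -/
def Precedes {V : Type} [DecidableEq V] {k : ℕ} (H : KGraph V k) (ℓ : ℕ)
    (v w : Fin (qq k ℓ) → V) : Prop :=
  ∀ i < zz k ℓ, ownedEdge k ℓ v w i ∈ H.edges

/-- The `a`-th block of `q` consecutive entries of the sequence `σ(0), …, σ(n - 1)`. -/
def block {n : ℕ} (q : ℕ) (σ : Equiv.Perm (Fin n)) (a : Fin (n / q)) : Fin q → Fin n :=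
  fun j => σ ⟨(a : ℕ) * q + j, by
    have h1 : ((a : ℕ) + 1) * q ≤ n / q * q := Nat.mul_le_mul_right q a.2
    have h2 : n / q * q ≤ n := Nat.div_mul_le_self n q
    have h3 := j.2
    rw [Nat.add_mul] at h1
    omega⟩

/-- The digraph `D_σ`; its vertices are the `n / q` blocks of `σ`, named by their indices. -/
def permDigraph {n k : ℕ} (H : KGraph (Fin n) k) (ℓ : ℕ) (σ : Equiv.Perm (Fin n)) :
    Digraph (Fin (n / qq k ℓ)) where
  Adj a b := Precedes H ℓ (block (qq k ℓ) σ a) (block (qq k ℓ) σ b)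

open Classical in
/-- For a sub-digraph `D` of `D_σ`, the `k`-graph of the edges of `H` owned by the arcs of `D`. -/
noncomputable def ownedGraph {n k : ℕ} (H : KGraph (Fin n) k) (ℓ : ℕ) (σ : Equiv.Perm (Fin n))
    (D : Digraph (Fin (n / qq k ℓ))) : KGraph (Fin n) k where
  edges := H.edges.filter fun e => ∃ a b, D.Adj a b ∧ ∃ i < zz k ℓ,
    e = ownedEdge k ℓ (block (qq k ℓ) σ a) (block (qq k ℓ) σ b) i
  uniform e he := H.uniform e (Finset.mem_filter.1 he).1

open Classical in
/-- `I_e = {i : e ∈ H_i}`, where `H_i` consists of the edges of `H` owned by the arcs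
of `D_{σ_i}`. It is empty if `e` is not an edge of `H`. -/
noncomputable def indexSet {n k r : ℕ} (H : KGraph (Fin n) k) (ℓ : ℕ) (σ : Fin r → Equiv.Perm (Fin n))
    (e : Finset (Fin n)) : Finset (Fin r) :=
  Finset.univ.filter fun i => e ∈ (ownedGraph H ℓ (σ i) (permDigraph H ℓ (σ i))).edges

/-- The joint law of independent random variables with laws `μ i`. -/
noncomputable def indepPMF {ι α : Type} [Fintype ι] [DecidableEq ι] [Fintype α] [DecidableEq α]
    (μ : ι → PMF α) : PMF (ι → α) :=
  PMF.ofFintype (fun f => ∏ i, μ i (f i)) (by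
    have h := Finset.prod_univ_sum (fun _ : ι => (Finset.univ : Finset α)) (fun i a => μ i a)
    rw [Fintype.piFinset_univ] at h
    rw [← h]
    refine Finset.prod_eq_one fun i _ => ?_
    rw [← tsum_fintype (L := .unconditional _)]
    exact (μ i).tsum_coe)

open Classical in
/-- The law of the label of `e`: uniform on `I_e` if `I_e` is non-empty, no label otherwise. -/
noncomputable def labelPMF {n k r : ℕ} (H : KGraph (Fin n) k) (ℓ : ℕ)
    (σ : Fin r → Equiv.Perm (Fin n)) (e : Finset (Fin n)) : PMF (Option (Fin r)) :=
  if h : (indexSet H ℓ σ e).Nonempty then (PMF.uniformOfFinset (indexSet H ℓ σ e) h).map some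
  else PMF.pure none

/-- The permutations `σ_1, …, σ_r` and the labels of the edges. -/
abbrev Outcome (n r : ℕ) : Type :=
  (Fin r → Equiv.Perm (Fin n)) × (Finset (Fin n) → Option (Fin r))

/-- The random procedure: independent uniformly random permutations and then, given these,
independent labels. -/
noncomputable def procedure {n k : ℕ} (H : KGraph (Fin n) k) (ℓ r : ℕ) : PMF (Outcome n r) :=
  (indepPMF fun _ : Fin r => PMF.uniformOfFintype (Equiv.Perm (Fin n))).bind fun σ =>
    (indepPMF fun e : Finset (Fin n) => labelPMF H ℓ σ e).map fun lab => (σ, lab)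

/-- The digraph `D'_{σ_i}`: an arc of `D_{σ_i}` is kept if and only if all the edges that it owns
are labelled with `i`. -/
def prunedDigraph {n k r : ℕ} (H : KGraph (Fin n) k) (ℓ : ℕ) (ω : Outcome n r) (i : Fin r) :
    Digraph (Fin (n / qq k ℓ)) where
  Adj a b := (permDigraph H ℓ (ω.1 i)).Adj a b ∧ ∀ j < zz k ℓ,
    ω.2 (ownedEdge k ℓ (block (qq k ℓ) (ω.1 i) a) (block (qq k ℓ) (ω.1 i) b) j) = some i

open Classical in
/-- `H' = H ∖ ⋃ i, H'_i`, where `H'_i` consists of the edges owned by the arcs of `D'_{σ_i}`. -/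
noncomputable def leftover {n k r : ℕ} (H : KGraph (Fin n) k) (ℓ : ℕ) (ω : Outcome n r) : KGraph (Fin n) k where
  edges := H.edges.filter fun e =>
    ∀ i, e ∉ (ownedGraph H ℓ (ω.1 i) (prunedDigraph H ℓ ω i)).edges
  uniform e he := H.uniform e (Finset.mem_filter.1 he).1

/-- `κ = 6 (k + 1) log n / ε ^ 2`. -/
noncomputable def kap (n k : ℕ) (ε : ℝ) : ℝ := 6 * (k + 1) * Real.log n / ε ^ 2

/-- The (real) number `ℓ q n ^ (k - 2) κ / (k! p ^ (z - 1))` of permutations,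
before it is rounded to an integer. -/
noncomputable def numPerms (n k ℓ : ℕ) (ε p : ℝ) : ℝ :=
  (ℓ * qq k ℓ * (n : ℝ) ^ (k - 2)) / (k.factorial * p ^ (zz k ℓ - 1)) * kap n k ε

end HamPacking

namespace HamPacking

/-! The randomness has two layers: the permutations, and then, with the permutations fixed, the
labels, which are independent over the edges. Each layer is treated by a count of the mean, a
concentration inequality and a union bound.

Permutations. The probability that $D_\sigma$ owns a given edge $e$ is expressed exactly through the
number of injective $2q$-tuples all of whose $z$ windows are edges, one of them being $e$
(`Pr_owned_eq`). Regularity counts these tuples window by window (`card_owningTuples`), and $r$ is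
chosen so that the mean of $|I_e|$ is close to $\kappa$ (`Scale.mean_owned`). Since the permutations
are independent and $\varepsilon^2\kappa$ is a multiple of $\log n$, a Chernoff bound gives
$|I_e|=(1\pm 2z\varepsilon)\kappa$ for all edges at once. Two different edges owned by one arc fix
at least $k+1$ entries, so on average at most one permutation does this to a given pair, and with
high probability at most $\varepsilon^2\kappa$ do. Finally, for sets $P,Q$ of at most two blocks,
the number of blocks $x$ with arcs from all of $P$ and to all of $Q$ is $(1\pm2z\varepsilon)\frac nq
p^{z(|P|+|Q|)}$: `card_arcTuples` counts the possible tuples $x$, and `blocks_concentration`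
controls how many of them are blocks of a random permutation. All conditions in the definition of a
regular digraph have this form. The three properties together are `GoodPerms`.

Labels. An arc survives if its $z$ owned edges all receive its index, which has probability about
$\kappa^{-z}$. In one digraph different arcs own disjoint sets of edges, so the common neighbours of
$P,Q$ survive independently of each other, and a Chernoff bound gives (a)
(`commonNbrs_concentration`). An edge $e$ is removed if for some $i\in I_e$ all edges of its arc in
$D_{\sigma_i}$ are labelled $i$. There are about $\kappa$ choices of $i$, these events are disjoint,
and each has probability about $\kappa^{-z}$; so $e$ is removed with probability about
$\kappa^{-(z-1)}$ (`Pr_removed_bounds`). For a fixed family of $(k-d)$-sets, Bonferroni's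
inequalities give the mean number of completions in $H'$ (`leftover_mean`); pairs of removals are
nearly independent because few permutations co-own two given edges. One label influences few
completions, so the bounded differences inequality gives (b) (`leftover_concentration`).

The exponents in the growth hypothesis come from two places. The block counts have mean of order at
least $np^{4z}$ but bounded-difference fluctuations of order $\sqrt n$, which calls for $p^{8z}$.
The smallest neighbourhoods after pruning have size of order $n(p/\kappa)^{4z}$, which must exceed
$\varepsilon^{-2}\log n$; inserting $\kappa$ produces $\varepsilon^{8z+2}$ and $\log^{4z+1}n$. -/

open Classical in
/-- The probability of the event `A` under the weights `μ` on a finite type. -/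
noncomputable def Pr {Ω : Type*} [Fintype Ω] (μ : Ω → ℝ) (A : Ω → Prop) : ℝ :=
  ∑ ω, if A ω then μ ω else 0

/-- The expectation of `f` under the weights `μ` on a finite type. -/
noncomputable def Ex {Ω : Type*} [Fintype Ω] (μ : Ω → ℝ) (f : Ω → ℝ) : ℝ :=
  ∑ ω, μ ω * f ω

/-- The weights `μ` form a probability distribution. -/
structure IsProb {Ω : Type*} [Fintype Ω] (μ : Ω → ℝ) : Prop where
  nonneg : ∀ ω, 0 ≤ μ ω
  sum_one : ∑ ω, μ ω = 1

/-- The product of the weights `μ i`. -/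
noncomputable def prodWeight {ι α : Type*} [Fintype ι] (μ : ι → α → ℝ) : (ι → α) → ℝ :=
  fun ω => ∏ i, μ i (ω i)

/-! ### Finite probability spaces, Chernoff bounds and exponential moments. -/

section basics

variable {Ω : Type*} [Fintype Ω] {μ : Ω → ℝ}

theorem Pr_nonneg (h : IsProb μ) (A : Ω → Prop) : 0 ≤ Pr μ A := by
  classical
  exact Finset.sum_nonneg fun ω _ => by split_ifs <;> [exact h.nonneg ω; exact le_rfl]

theorem Pr_mono (h : IsProb μ) {A B : Ω → Prop} (hAB : ∀ ω, A ω → B ω) : Pr μ A ≤ Pr μ B := by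
  classical
  refine Finset.sum_le_sum fun ω _ => ?_
  by_cases hA : A ω
  · simp [hA, hAB ω hA]
  · simp only [hA, if_false]
    split_ifs <;> [exact h.nonneg ω; exact le_rfl]

theorem Pr_le_one (h : IsProb μ) (A : Ω → Prop) : Pr μ A ≤ 1 := by
  classical
  rw [← h.sum_one]
  exact Finset.sum_le_sum fun ω _ => by split_ifs <;> [exact le_rfl; exact h.nonneg ω]

theorem Pr_eq_zero {A : Ω → Prop} (hA : ∀ ω, ¬ A ω) : Pr μ A = 0 := by
  classical
  exact Finset.sum_eq_zero fun ω _ => by simp [hA ω]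

theorem Pr_congr {A B : Ω → Prop} (hAB : ∀ ω, A ω ↔ B ω) : Pr μ A = Pr μ B := by
  classical
  exact Finset.sum_congr rfl fun ω _ => by simp [hAB ω]

theorem Pr_exists_le (h : IsProb μ) {ι : Type*} (T : Finset ι) (A : ι → Ω → Prop) :
    Pr μ (fun ω => ∃ x ∈ T, A x ω) ≤ ∑ x ∈ T, Pr μ (A x) := by
  classical
  unfold Pr
  rw [Finset.sum_comm]
  refine Finset.sum_le_sum fun ω _ => ?_
  have h0 : ∀ x ∈ T, 0 ≤ (if A x ω then μ ω else 0) := fun x _ => by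
    split_ifs <;> [exact h.nonneg ω; exact le_rfl]
  split_ifs with hx
  · obtain ⟨x, hxT, hxA⟩ := hx
    refine le_trans ?_ (Finset.single_le_sum h0 hxT)
    simp [hxA]
  · exact Finset.sum_nonneg h0

theorem Pr_or_le (h : IsProb μ) (A B : Ω → Prop) :
    Pr μ (fun ω => A ω ∨ B ω) ≤ Pr μ A + Pr μ B := by
  classical
  unfold Pr
  rw [← Finset.sum_add_distrib]
  refine Finset.sum_le_sum fun ω _ => ?_
  have := h.nonneg ω
  by_cases hA : A ω <;> by_cases hB : B ω <;> simp [hA, hB, this]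

theorem Pr_exists_eq {ι : Type*} (T : Finset ι) (A : ι → Ω → Prop)
    (hd : ∀ ω, ∀ x ∈ T, ∀ y ∈ T, A x ω → A y ω → x = y) :
    Pr μ (fun ω => ∃ x ∈ T, A x ω) = ∑ x ∈ T, Pr μ (A x) := by
  classical
  unfold Pr
  rw [Finset.sum_comm]
  refine Finset.sum_congr rfl fun ω _ => ?_
  split_ifs with hx
  · obtain ⟨x, hxT, hxA⟩ := hx
    rw [Finset.sum_eq_single x]
    · simp [hxA]
    · intro y hy hyx
      rw [if_neg]
      exact fun h => hyx (hd ω y hy x hxT h hxA)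
    · exact fun h => absurd hxT h
  · symm
    refine Finset.sum_eq_zero fun x hxT => ?_
    rw [if_neg]
    exact fun h => hx ⟨x, hxT, h⟩

theorem Pr_not (h : IsProb μ) (A : Ω → Prop) : Pr μ (fun ω => ¬ A ω) = 1 - Pr μ A := by
  classical
  rw [eq_sub_iff_add_eq, ← h.sum_one]
  unfold Pr
  rw [← Finset.sum_add_distrib]
  exact Finset.sum_congr rfl fun ω _ => by by_cases hA : A ω <;> simp [hA]

theorem Ex_card_filter {ι : Type*} (T : Finset ι) (A : ι → Ω → Prop)
    [∀ ω, DecidablePred fun x => A x ω] :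
    Ex μ (fun ω => ((T.filter fun x => A x ω).card : ℝ)) = ∑ x ∈ T, Pr μ (A x) := by
  classical
  unfold Ex Pr
  rw [Finset.sum_comm]
  refine Finset.sum_congr rfl fun ω _ => ?_
  beta_reduce
  rw [Finset.card_filter, Nat.cast_sum, Finset.mul_sum]
  exact Finset.sum_congr rfl fun x _ => by by_cases hA : A x ω <;> simp [hA]

theorem Pr_le_exp_mul (h : IsProb μ) (f : Ω → ℝ) (t : ℝ) {l : ℝ} (hl : 0 ≤ l) :
    Pr μ (fun ω => t ≤ f ω) ≤ Real.exp (-(l * t)) * Ex μ (fun ω => Real.exp (l * f ω)) := by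
  classical
  unfold Pr Ex
  rw [Finset.mul_sum]
  refine Finset.sum_le_sum fun ω _ => ?_
  have h0 := h.nonneg ω
  split_ifs with ht
  · have : 1 ≤ Real.exp (-(l * t)) * Real.exp (l * f ω) := by
      rw [← Real.exp_add]
      exact Real.one_le_exp (by nlinarith)
    nlinarith
  · positivity

theorem Pr_le_exp_mul' (h : IsProb μ) (f : Ω → ℝ) (t : ℝ) {l : ℝ} (hl : l ≤ 0) :
    Pr μ (fun ω => f ω ≤ t) ≤ Real.exp (-(l * t)) * Ex μ (fun ω => Real.exp (l * f ω)) := by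
  have := Pr_le_exp_mul h (fun ω => - f ω) (-t) (l := -l) (by linarith)
  simpa using this

/-- The exponential expands into a sum over the subsets of `T`, so independence is needed only in
the form `hP`: the probability that all events of a subset occur is a product. The factors `1 + (exp
l - 1) * P x` are nonnegative for either sign of `l` because `P x ≤ 1`, which lets one bound serve
both tails. -/
theorem mgf_card_le (h : IsProb μ) {ι : Type*} (T : Finset ι) (A : ι → Ω → Prop)
    [∀ ω, DecidablePred fun x => A x ω]
    (P : ι → ℝ) (hP : ∀ S ⊆ T, Pr μ (fun ω => ∀ x ∈ S, A x ω) = ∏ x ∈ S, P x) (l : ℝ) :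
    Ex μ (fun ω => Real.exp (l * ((T.filter fun x => A x ω).card : ℝ))) ≤
      Real.exp ((Real.exp l - 1) * ∑ x ∈ T, P x) := by
  classical
  have hP1 : ∀ x ∈ T, 0 ≤ P x ∧ P x ≤ 1 := by
    intro x hx
    have := hP {x} (by simpa using hx)
    simp only [Finset.mem_singleton, forall_eq, Finset.prod_singleton] at this
    rw [← this]
    exact ⟨Pr_nonneg h _, Pr_le_one h _⟩
  have e1 : ∀ ω, Real.exp (l * ((T.filter fun x => A x ω).card : ℝ)) =
      ∑ S ∈ T.powerset, (Real.exp l - 1) ^ S.card * (if ∀ x ∈ S, A x ω then 1 else 0) := by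
    intro ω
    have : Real.exp (l * ((T.filter fun x => A x ω).card : ℝ)) =
        ∏ x ∈ T, (1 + (if A x ω then Real.exp l - 1 else 0)) := by
      rw [mul_comm, Real.exp_nat_mul, ← Finset.prod_const, Finset.prod_filter]
      exact Finset.prod_congr rfl fun x _ => by split_ifs <;> ring
    rw [this, Finset.prod_one_add]
    refine Finset.sum_congr rfl fun S _ => ?_
    split_ifs with hS
    · rw [mul_one, ← Finset.prod_const]
      exact Finset.prod_congr rfl fun x hx => by rw [if_pos (hS x hx)]
    · push Not at hS
      obtain ⟨x, hx, hxA⟩ := hS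
      rw [mul_zero]
      exact Finset.prod_eq_zero hx (by simp [hxA])
  have e2 : Ex μ (fun ω => Real.exp (l * ((T.filter fun x => A x ω).card : ℝ))) =
      ∏ x ∈ T, (1 + (Real.exp l - 1) * P x) := by
    rw [Finset.prod_one_add]
    unfold Ex
    simp_rw [e1, Finset.mul_sum]
    rw [Finset.sum_comm]
    refine Finset.sum_congr rfl fun S hS => ?_
    rw [Finset.prod_mul_distrib, Finset.prod_const, ← hP S (Finset.mem_powerset.1 hS)]
    unfold Pr
    rw [Finset.mul_sum]
    exact Finset.sum_congr rfl fun ω _ => by split_ifs <;> ring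
  rw [e2, Finset.mul_sum, Real.exp_sum]
  refine Finset.prod_le_prod (fun x hx => ?_) fun x _ => ?_
  · have := Real.exp_pos l
    nlinarith [hP1 x hx]
  · have := Real.add_one_le_exp ((Real.exp l - 1) * P x)
    linarith

/-- By `exp l ≤ 1 + l + l²` for `l ≤ 1` the exponent is at most `-l t + l² M`, which `l = t / (2M)`
minimises; `t ≤ 2M` is the condition `l ≤ 1`. A bound `M` in place of the exact mean suffices, and
later only bounds are available. -/
theorem chernoff_upper (h : IsProb μ) {ι : Type*} (T : Finset ι) (A : ι → Ω → Prop)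
    [∀ ω, DecidablePred fun x => A x ω]
    (P : ι → ℝ) (hP : ∀ S ⊆ T, Pr μ (fun ω => ∀ x ∈ S, A x ω) = ∏ x ∈ S, P x) {M t : ℝ}
    (hM : 0 < M) (hPM : ∑ x ∈ T, P x ≤ M) (ht : 0 ≤ t) (htM : t ≤ 2 * M) :
    Pr μ (fun ω => M + t ≤ ((T.filter fun x => A x ω).card : ℝ)) ≤
      Real.exp (-(t ^ 2 / (4 * M))) := by
  set l := t / (2 * M) with hl
  have hl0 : 0 ≤ l := by positivity
  have hl1 : l ≤ 1 := by rw [hl, div_le_one (by positivity)]; exact htM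
  refine (Pr_le_exp_mul h _ _ hl0).trans ?_
  refine (mul_le_mul_of_nonneg_left (mgf_card_le h T A P hP l) (Real.exp_pos _).le).trans ?_
  rw [← Real.exp_add]
  refine Real.exp_le_exp.2 ?_
  have h1 := (abs_le.1 (Real.abs_exp_sub_one_sub_id_le (x := l)
    (by rw [abs_of_nonneg hl0]; exact hl1))).2
  have h2 : 0 ≤ Real.exp l - 1 := by linarith [Real.add_one_le_exp l]
  have h3 : (Real.exp l - 1) * ∑ x ∈ T, P x ≤ (l + l ^ 2) * M := by
    refine (mul_le_mul_of_nonneg_left hPM h2).trans ?_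
    exact mul_le_mul_of_nonneg_right (by linarith) hM.le
  have h4 : t = 2 * M * l := by rw [hl]; field_simp
  have h5 : t ^ 2 / (4 * M) = M * l ^ 2 := by rw [h4]; field_simp; ring
  rw [h5, h4]
  nlinarith

theorem chernoff_lower (h : IsProb μ) {ι : Type*} (T : Finset ι) (A : ι → Ω → Prop)
    [∀ ω, DecidablePred fun x => A x ω]
    (P : ι → ℝ) (hP : ∀ S ⊆ T, Pr μ (fun ω => ∀ x ∈ S, A x ω) = ∏ x ∈ S, P x) {M t : ℝ}
    (hM : 0 < M) (hPM : M ≤ ∑ x ∈ T, P x) (ht : 0 ≤ t) (htM : t ≤ 2 * M) :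
    Pr μ (fun ω => ((T.filter fun x => A x ω).card : ℝ) ≤ M - t) ≤
      Real.exp (-(t ^ 2 / (4 * M))) := by
  set l := t / (2 * M) with hl
  have hl0 : 0 ≤ l := by positivity
  have hl1 : l ≤ 1 := by rw [hl, div_le_one (by positivity)]; exact htM
  refine (Pr_le_exp_mul' h _ _ (l := -l) (by linarith)).trans ?_
  refine (mul_le_mul_of_nonneg_left (mgf_card_le h T A P hP (-l)) (Real.exp_pos _).le).trans ?_
  rw [← Real.exp_add]
  refine Real.exp_le_exp.2 ?_
  have h1 := (abs_le.1 (Real.abs_exp_sub_one_sub_id_le (x := -l)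
    (by rw [abs_neg, abs_of_nonneg hl0]; exact hl1))).2
  have h2 : Real.exp (-l) - 1 ≤ 0 := by
    have := Real.exp_le_one_iff.2 (show -l ≤ 0 by linarith)
    linarith
  have h3 : (Real.exp (-l) - 1) * ∑ x ∈ T, P x ≤ (-l + l ^ 2) * M := by
    refine (mul_le_mul_of_nonpos_left hPM h2).trans ?_
    exact mul_le_mul_of_nonneg_right (by linarith [neg_sq l]) hM.le
  have h4 : t = 2 * M * l := by rw [hl]; field_simp
  have h5 : t ^ 2 / (4 * M) = M * l ^ 2 := by rw [h4]; field_simp; ring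
  rw [h5, h4]
  nlinarith

/-- A Chernoff bound far above a mean which is at most `1`. -/
theorem chernoff_far (h : IsProb μ) {ι : Type*} (T : Finset ι) (A : ι → Ω → Prop)
    [∀ ω, DecidablePred fun x => A x ω]
    (P : ι → ℝ) (hP : ∀ S ⊆ T, Pr μ (fun ω => ∀ x ∈ S, A x ω) = ∏ x ∈ S, P x) {t : ℝ}
    (hPM : ∑ x ∈ T, P x ≤ 1) :
    Pr μ (fun ω => t ≤ ((T.filter fun x => A x ω).card : ℝ)) ≤ Real.exp (2 - t) := by
  refine (Pr_le_exp_mul h _ t (l := 1) zero_le_one).trans ?_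
  refine (mul_le_mul_of_nonneg_left (mgf_card_le h T A P hP 1) (Real.exp_pos _).le).trans ?_
  rw [← Real.exp_add]
  refine Real.exp_le_exp.2 ?_
  -- At `l = 1` the factor `exp 1 - 1` is at most `2`, so a mean of at most `1` contributes at most
  -- `2` to the exponent.
  have h1 := (abs_le.1 (Real.abs_exp_sub_one_sub_id_le (x := 1) (by simp))).2
  have h2 : 0 ≤ Real.exp 1 - 1 := by linarith [Real.add_one_le_exp 1]
  have h3 := mul_le_mul_of_nonneg_left hPM h2
  linarith

/-- A random variable whose values differ by at most `c` has exponential moment at most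
`exp (E g + c² / 2)`. -/
theorem exp_moment_le (h : IsProb μ) (g : Ω → ℝ) (c : ℝ) (hc : ∀ a b, |g a - g b| ≤ c) :
    Ex μ (fun a => Real.exp (g a)) ≤ Real.exp (Ex μ g + c ^ 2 / 2) := by
  -- Symmetrisation with an independent copy `b` of `a`: by Jensen's inequality it is enough to
  -- bound the mean of `exp (g a - g b)`. Exchanging the copies turns it into the mean of `cosh (g a
  -- - g b)`, at most `exp (c² / 2)`.
  have jensen : Real.exp (-(Ex μ g)) ≤ Ex μ (fun b => Real.exp (-(g b))) := by
    have := convexOn_exp.map_sum_le (t := Finset.univ) (w := μ) (p := fun b => -(g b))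
      (fun i _ => h.nonneg i) h.sum_one (fun i _ => Set.mem_univ _)
    simpa [Ex, Finset.sum_neg_distrib] using this
  have key : Ex μ (fun a => Real.exp (g a)) * Ex μ (fun b => Real.exp (-(g b))) ≤
      Real.exp (c ^ 2 / 2) := by
    have e : Ex μ (fun a => Real.exp (g a)) * Ex μ (fun b => Real.exp (-(g b))) =
        ∑ a, ∑ b, μ a * μ b * Real.exp (g a - g b) := by
      unfold Ex
      rw [Finset.sum_mul_sum]
      refine Finset.sum_congr rfl fun a _ => Finset.sum_congr rfl fun b _ => ?_
      rw [sub_eq_add_neg, Real.exp_add]; ring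
    have e' : ∑ a, ∑ b, μ a * μ b * Real.exp (g a - g b) =
        ∑ a, ∑ b, μ a * μ b * Real.cosh (g a - g b) := by
      have s1 : ∑ a, ∑ b, μ a * μ b * Real.exp (g a - g b) =
          ∑ a, ∑ b, μ a * μ b * Real.exp (-(g a - g b)) := by
        rw [Finset.sum_comm]
        refine Finset.sum_congr rfl fun a _ => Finset.sum_congr rfl fun b _ => ?_
        rw [neg_sub]; ring
      have s2 : ∑ a, ∑ b, μ a * μ b * Real.cosh (g a - g b) =
          (∑ a, ∑ b, μ a * μ b * Real.exp (g a - g b) +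
            ∑ a, ∑ b, μ a * μ b * Real.exp (-(g a - g b))) / 2 := by
        rw [← Finset.sum_add_distrib, Finset.sum_div]
        refine Finset.sum_congr rfl fun a _ => ?_
        rw [← Finset.sum_add_distrib, Finset.sum_div]
        refine Finset.sum_congr rfl fun b _ => ?_
        rw [Real.cosh_eq]; ring
      rw [s2, ← s1]; ring
    rw [e, e']
    have : ∑ a, ∑ b, μ a * μ b * Real.exp (c ^ 2 / 2) = Real.exp (c ^ 2 / 2) := by
      simp_rw [← Finset.sum_mul, ← Finset.mul_sum, h.sum_one]
      simp [h.sum_one]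
    rw [← this]
    refine Finset.sum_le_sum fun a _ => Finset.sum_le_sum fun b _ => ?_
    refine mul_le_mul_of_nonneg_left ?_ (mul_nonneg (h.nonneg a) (h.nonneg b))
    refine (Real.cosh_le_exp_half_sq _).trans (Real.exp_le_exp.2 ?_)
    have := sq_le_sq' (abs_le.1 (hc a b)).1 (abs_le.1 (hc a b)).2
    linarith
  have hpos : 0 ≤ Ex μ (fun a => Real.exp (g a)) :=
    Finset.sum_nonneg fun a _ => mul_nonneg (h.nonneg a) (Real.exp_pos _).le
  have h1 := (mul_le_mul_of_nonneg_left jensen hpos).trans key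
  rw [Real.exp_add]
  rw [Real.exp_neg, ← div_eq_mul_inv, div_le_iff₀ (Real.exp_pos _)] at h1
  linarith

theorem tail_of_mgf (h : IsProb μ) (f : Ω → ℝ) {B : ℝ} (hB : 0 < B)
    (hf : ∀ l : ℝ, Ex μ (fun ω => Real.exp (l * f ω)) ≤ Real.exp (l * Ex μ f + l ^ 2 * B))
    {t : ℝ} (ht : 0 ≤ t) :
    Pr μ (fun ω => t ≤ |f ω - Ex μ f|) ≤ 2 * Real.exp (-(t ^ 2 / (4 * B))) := by
  have hl : 0 ≤ t / (2 * B) := by positivity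
  have e1 : Pr μ (fun ω => Ex μ f + t ≤ f ω) ≤ Real.exp (-(t ^ 2 / (4 * B))) := by
    refine (Pr_le_exp_mul h _ _ hl).trans ?_
    refine (mul_le_mul_of_nonneg_left (hf _) (Real.exp_pos _).le).trans ?_
    rw [← Real.exp_add]
    refine Real.exp_le_exp.2 (le_of_eq ?_)
    field_simp; ring
  have e2 : Pr μ (fun ω => f ω ≤ Ex μ f - t) ≤ Real.exp (-(t ^ 2 / (4 * B))) := by
    refine (Pr_le_exp_mul' h _ _ (l := -(t / (2 * B))) (by linarith)).trans ?_
    refine (mul_le_mul_of_nonneg_left (hf _) (Real.exp_pos _).le).trans ?_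
    rw [← Real.exp_add]
    refine Real.exp_le_exp.2 (le_of_eq ?_)
    field_simp; ring
  calc _ ≤ Pr μ (fun ω => Ex μ f + t ≤ f ω ∨ f ω ≤ Ex μ f - t) := Pr_mono h fun ω hω => by
        rcases le_abs.1 hω with h1 | h1
        · left; linarith
        · right; linarith
    _ ≤ _ := Pr_or_le h _ _
    _ ≤ _ := by linarith

end basics

/-! ### Product measures and the bounded differences inequality. -/

section product

variable {ι α : Type*} [Fintype ι] [DecidableEq ι] [Fintype α]
  {μ : ι → α → ℝ}

theorem prodWeight_isProb (h : ∀ i, IsProb (μ i)) : IsProb (prodWeight μ) where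
  nonneg ω := Finset.prod_nonneg fun i _ => (h i).nonneg _
  sum_one := by
    have := Finset.prod_univ_sum (fun _ : ι => (Finset.univ : Finset α)) (fun i a => μ i a)
    rw [Fintype.piFinset_univ] at this
    unfold prodWeight
    rw [← this]
    exact Finset.prod_eq_one fun i _ => (h i).sum_one

theorem Pr_prodWeight_forall (h : ∀ i, IsProb (μ i)) (S : Finset ι) (A : ι → α → Prop) :
    Pr (prodWeight μ) (fun ω => ∀ i ∈ S, A i (ω i)) = ∏ i ∈ S, Pr (μ i) (A i) := by
  classical
  have := Finset.prod_univ_sum (fun _ : ι => (Finset.univ : Finset α))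
    (fun i a => if i ∈ S → A i a then μ i a else 0)
  rw [Fintype.piFinset_univ] at this
  have e1 : ∏ i, ∑ a, (if i ∈ S → A i a then μ i a else 0) = ∏ i ∈ S, Pr (μ i) (A i) := by
    rw [← Finset.prod_subset (Finset.subset_univ S)]
    · exact Finset.prod_congr rfl fun i hi => by simp [hi, Pr]
    · intro i _ hi
      simp [hi, (h i).sum_one]
  rw [← e1, this]
  unfold Pr prodWeight
  refine Finset.sum_congr rfl fun ω _ => ?_
  split_ifs with hω
  · exact Finset.prod_congr rfl fun i _ => by rw [if_pos (hω i)]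
  · push Not at hω
    obtain ⟨i, hi, hiA⟩ := hω
    exact (Finset.prod_eq_zero (Finset.mem_univ i) (by simp [hi, hiA])).symm

/-- Exchanging the `i`-th coordinate with the fresh value is an involution of `(ι → α) × α` which
preserves the joint weight. -/
theorem Ex_resample (h : ∀ i, IsProb (μ i)) (i : ι) (g : (ι → α) → ℝ) :
    Ex (prodWeight μ) (fun ω => ∑ a, μ i a * g (Function.update ω i a)) = Ex (prodWeight μ) g := by
  have e1 : Ex (prodWeight μ) g = ∑ x : (ι → α) × α, prodWeight μ x.1 * (μ i x.2 * g x.1) := by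
    rw [Fintype.sum_prod_type]
    unfold Ex
    refine Finset.sum_congr rfl fun ω _ => ?_
    dsimp only
    rw [← Finset.mul_sum, ← Finset.sum_mul, (h i).sum_one, one_mul]
  have e2 : Ex (prodWeight μ) (fun ω => ∑ a, μ i a * g (Function.update ω i a)) =
      ∑ x : (ι → α) × α, prodWeight μ x.1 * (μ i x.2 * g (Function.update x.1 i x.2)) := by
    rw [Fintype.sum_prod_type]
    unfold Ex
    exact Finset.sum_congr rfl fun ω _ => by rw [Finset.mul_sum]
  rw [e1, e2]
  let φ : (ι → α) × α → (ι → α) × α := fun x => (Function.update x.1 i x.2, x.1 i)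
  have hφ : Function.Involutive φ := fun x => by simp [φ]
  refine Fintype.sum_equiv hφ.toPerm _ _ fun x => ?_
  change _ = prodWeight μ (Function.update x.1 i x.2) * (μ i (x.1 i) * _)
  rw [← mul_assoc, ← mul_assoc]
  congr 1
  unfold prodWeight
  rw [← Finset.mul_prod_erase _ _ (Finset.mem_univ i),
    ← Finset.mul_prod_erase Finset.univ (fun j => μ j (Function.update x.1 i x.2 j))
      (Finset.mem_univ i)]
  have : ∏ j ∈ Finset.univ.erase i, μ j (Function.update x.1 i x.2 j) =
      ∏ j ∈ Finset.univ.erase i, μ j (x.1 j) :=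
    Finset.prod_congr rfl fun j hj => by
      rw [Function.update_of_ne (Finset.ne_of_mem_erase hj)]
  rw [this, Function.update_self]
  ring

/-- The exponential moment form of the bounded differences inequality. -/
theorem mcdiarmid_mgf (h : ∀ i, IsProb (μ i)) (c : ι → ℝ) (S : Finset ι) (f : (ι → α) → ℝ)
    (hS : ∀ ω ω', (∀ i ∈ S, ω i = ω' i) → f ω = f ω')
    (hf : ∀ ω i a, |f (Function.update ω i a) - f ω| ≤ c i) :
    Ex (prodWeight μ) (fun ω => Real.exp (f ω)) ≤
      Real.exp (Ex (prodWeight μ) f + ∑ i ∈ S, c i ^ 2 / 2) := by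
  induction S using Finset.induction_on generalizing f with
  | empty =>
    have hp := prodWeight_isProb h
    have hconst : ∀ ω ω', f ω = f ω' := fun ω ω' => hS ω ω' (by simp)
    have : (Finset.univ : Finset (ι → α)).Nonempty := by
      by_contra hne
      rw [Finset.not_nonempty_iff_eq_empty] at hne
      have := hp.sum_one
      rw [hne, Finset.sum_empty] at this
      exact zero_ne_one this
    obtain ⟨ω₀, -⟩ := this
    have hf0 : f = fun _ => f ω₀ := funext fun ω => hconst ω ω₀
    rw [hf0]
    simp [Ex, ← Finset.sum_mul, hp.sum_one]
  | insert i S hi ih =>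
    have hp := prodWeight_isProb h
    -- Averaging over the coordinate `i` removes the dependence on it and keeps the mean and the
    -- bounded differences; the price, from `exp_moment_le`, is the factor `exp (c i ^ 2 / 2)`.
    set g : (ι → α) → ℝ := fun ω => ∑ a, μ i a * f (Function.update ω i a) with hg
    have hgE : Ex (prodWeight μ) g = Ex (prodWeight μ) f := Ex_resample h i f
    have step := ih g (fun ω ω' hω => by
        refine Finset.sum_congr rfl fun a _ => ?_
        rw [hS (Function.update ω i a) (Function.update ω' i a)]
        intro j hj
        rcases eq_or_ne j i with rfl | hji
        · simp
        · rw [Function.update_of_ne hji, Function.update_of_ne hji]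
          exact hω j (Finset.mem_of_mem_insert_of_ne hj hji))
      (fun ω j b => by
        rw [hg]
        simp only
        rw [← Finset.sum_sub_distrib]
        refine (Finset.abs_sum_le_sum_abs _ _).trans ?_
        have hc0 : c j = ∑ a, μ i a * c j := by
          rw [← Finset.sum_mul, (h i).sum_one, one_mul]
        rw [hc0]
        refine Finset.sum_le_sum fun a _ => ?_
        rw [← mul_sub, abs_mul, abs_of_nonneg ((h i).nonneg a)]
        refine mul_le_mul_of_nonneg_left ?_ ((h i).nonneg a)
        rcases eq_or_ne j i with rfl | hji
        · simp only [Function.update_idem, sub_self, abs_zero]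
          exact (abs_nonneg _).trans (hf ω j b)
        · rw [Function.update_comm hji]
          exact hf _ j b)
    rw [Finset.sum_insert hi]
    calc Ex (prodWeight μ) (fun ω => Real.exp (f ω))
        = Ex (prodWeight μ) (fun ω => ∑ a, μ i a * Real.exp (f (Function.update ω i a))) :=
          (Ex_resample h i fun ω => Real.exp (f ω)).symm
      _ ≤ Ex (prodWeight μ) (fun ω => Real.exp (c i ^ 2 / 2) * Real.exp (g ω)) := by
          refine Finset.sum_le_sum fun ω _ => mul_le_mul_of_nonneg_left ?_ (hp.nonneg ω)
          have := exp_moment_le (h i) (fun a => f (Function.update ω i a)) (c i) (fun a b => by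
            have := hf (Function.update ω i b) i a
            simpa using this)
          beta_reduce
          rw [← Real.exp_add, add_comm]
          exact this
      _ = Real.exp (c i ^ 2 / 2) * Ex (prodWeight μ) (fun ω => Real.exp (g ω)) := by
          unfold Ex
          rw [Finset.mul_sum]
          exact Finset.sum_congr rfl fun ω _ => by ring
      _ ≤ Real.exp (c i ^ 2 / 2) * Real.exp (Ex (prodWeight μ) g + ∑ i ∈ S, c i ^ 2 / 2) :=
          mul_le_mul_of_nonneg_left step (Real.exp_pos _).le
      _ = _ := by
          rw [← Real.exp_add, hgE]; congr 1; ring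

theorem mcdiarmid (h : ∀ i, IsProb (μ i)) (c : ι → ℝ) (f : (ι → α) → ℝ)
    (hf : ∀ ω i a, |f (Function.update ω i a) - f ω| ≤ c i) {B : ℝ} (hB : 0 < B)
    (hcB : ∑ i, c i ^ 2 ≤ B) {t : ℝ} (ht : 0 ≤ t) :
    Pr (prodWeight μ) (fun ω => t ≤ |f ω - Ex (prodWeight μ) f|) ≤
      2 * Real.exp (-(t ^ 2 / (2 * B))) := by
  have := tail_of_mgf (prodWeight_isProb h) f (B := B / 2) (by positivity) (fun l => by
    refine (mcdiarmid_mgf h (fun i => |l| * c i) Finset.univ (fun ω => l * f ω)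
      (fun ω ω' hω => by rw [funext fun i => hω i (Finset.mem_univ i)]) (fun ω i a => by
        rw [← mul_sub, abs_mul]
        exact mul_le_mul_of_nonneg_left (hf ω i a) (abs_nonneg l))).trans ?_
    refine Real.exp_le_exp.2 ?_
    have e1 : Ex (prodWeight μ) (fun ω => l * f ω) = l * Ex (prodWeight μ) f := by
      unfold Ex
      rw [Finset.mul_sum]
      exact Finset.sum_congr rfl fun ω _ => by ring
    have e2 : ∑ i, (|l| * c i) ^ 2 / 2 = l ^ 2 * ((∑ i, c i ^ 2) / 2) := by
      rw [Finset.sum_div, Finset.mul_sum]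
      exact Finset.sum_congr rfl fun i _ => by rw [mul_pow, sq_abs]; ring
    rw [e1, e2]
    have := mul_le_mul_of_nonneg_left (div_le_div_of_nonneg_right hcB (zero_le_two (α := ℝ)))
      (sq_nonneg l)
    linarith) ht
  refine this.trans (le_of_eq ?_)
  congr 4
  ring

end product

/-! ### Concentration for functions of a uniformly random permutation. -/

section perm

/-- The uniform distribution on a finite type. -/
noncomputable def unif (Ω : Type*) [Fintype Ω] : Ω → ℝ := fun _ => (Fintype.card Ω : ℝ)⁻¹

theorem unif_isProb (Ω : Type*) [Fintype Ω] [Nonempty Ω] : IsProb (unif Ω) where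
  nonneg ω := by unfold unif; positivity
  sum_one := by
    have : (Fintype.card Ω : ℝ) ≠ 0 := by exact_mod_cast Fintype.card_ne_zero
    simp [unif, this]

theorem Ex_unif_perm_succ {n : ℕ} (g : Equiv.Perm (Fin (n + 1)) → ℝ) :
    Ex (unif (Equiv.Perm (Fin (n + 1)))) g =
      Ex (unif (Fin (n + 1))) fun j => Ex (unif (Equiv.Perm (Fin n)))
        fun e => g (Equiv.Perm.decomposeFin.symm (j, e)) := by
  unfold Ex unif
  simp_rw [← Finset.mul_sum]
  rw [← mul_assoc]
  congr 1
  · rw [Fintype.card_perm, Fintype.card_perm, Fintype.card_fin, Fintype.card_fin,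
      Nat.factorial_succ]
    push_cast
    rw [mul_inv]
  · rw [← Equiv.sum_comp Equiv.Perm.decomposeFin.symm, Fintype.sum_prod_type]

theorem swap_mul_decomposeFin {n : ℕ} (j : Fin (n + 1)) (e : Equiv.Perm (Fin n)) :
    Equiv.Perm.decomposeFin.symm (j, e) =
      Equiv.swap 0 j * Equiv.Perm.decomposeFin.symm (0, e) := by
  ext i
  refine Fin.cases ?_ (fun i => ?_) i
  · simp
  · simp [Equiv.Perm.decomposeFin_symm_apply_succ]

theorem decomposeFin_swap_mul {n : ℕ} (a b : Fin n) (e : Equiv.Perm (Fin n)) :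
    Equiv.Perm.decomposeFin.symm ((0 : Fin (n + 1)), Equiv.swap a b * e) =
      Equiv.swap a.succ b.succ * Equiv.Perm.decomposeFin.symm (0, e) := by
  ext i
  refine Fin.cases ?_ (fun i => ?_) i
  · simp [Equiv.swap_apply_of_ne_of_ne (Fin.succ_ne_zero a).symm (Fin.succ_ne_zero b).symm]
  · simp only [Equiv.Perm.decomposeFin_symm_apply_succ, Equiv.Perm.mul_apply, Equiv.swap_self,
      Equiv.refl_apply]
    rw [(Fin.succ_injective n).swap_apply]

/-- Induction, revealing the image `j` of `0`. Given `j`, a uniform permutation of one point fewer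
remains. The conditional means differ by at most `2 * c`, since the permutations with image `j` are
matched with those fixing `0` by the transposition `swap 0 j`; hence each step costs `(2 * c) ^ 2 /
2`. -/
theorem perm_mgf {n : ℕ} (f : Equiv.Perm (Fin n) → ℝ) {c : ℝ}
    (hf : ∀ a b σ, |f (Equiv.swap a b * σ) - f σ| ≤ c) :
    Ex (unif (Equiv.Perm (Fin n))) (fun σ => Real.exp (f σ)) ≤
      Real.exp (Ex (unif (Equiv.Perm (Fin n))) f + n * (2 * c ^ 2)) := by
  induction n with
  | zero => simp [Ex, unif]
  | succ n ih =>
    set g : Fin (n + 1) → ℝ := fun j => Ex (unif (Equiv.Perm (Fin n)))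
        fun e => f (Equiv.Perm.decomposeFin.symm (j, e)) with hg
    have hE : Ex (unif (Equiv.Perm (Fin (n + 1)))) f = Ex (unif (Fin (n + 1))) g :=
      Ex_unif_perm_succ f
    have h1 : ∀ j, Ex (unif (Equiv.Perm (Fin n)))
        (fun e => Real.exp (f (Equiv.Perm.decomposeFin.symm (j, e)))) ≤
        Real.exp (g j + n * (2 * c ^ 2)) := fun j => by
      refine ih (fun e => f (Equiv.Perm.decomposeFin.symm (j, e))) fun a b e => ?_
      -- A transposition of the remaining points is still a transposition of all points, after
      -- conjugation by `swap 0 j`; so `hf` applies to the restricted function.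
      have : Equiv.Perm.decomposeFin.symm (j, Equiv.swap a b * e) =
          Equiv.swap (Equiv.swap 0 j a.succ) (Equiv.swap 0 j b.succ) *
            Equiv.Perm.decomposeFin.symm (j, e) := by
        rw [swap_mul_decomposeFin j (Equiv.swap a b * e), swap_mul_decomposeFin j e,
          decomposeFin_swap_mul, ← mul_assoc, ← mul_assoc]
        congr 1
        rw [Equiv.mul_swap_eq_swap_mul]
      simp only [this]
      exact hf _ _ _
    have h2 : ∀ j j', |g j - g j'| ≤ 2 * c := fun j j' => by
      have hp := unif_isProb (Equiv.Perm (Fin n))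
      rw [hg]
      simp only [Ex]
      rw [← Finset.sum_sub_distrib]
      refine (Finset.abs_sum_le_sum_abs _ _).trans ?_
      have : 2 * c = ∑ e, unif (Equiv.Perm (Fin n)) e * (2 * c) := by
        rw [← Finset.sum_mul, hp.sum_one, one_mul]
      rw [this]
      refine Finset.sum_le_sum fun e _ => ?_
      rw [← mul_sub, abs_mul, abs_of_nonneg (hp.nonneg e)]
      refine mul_le_mul_of_nonneg_left ?_ (hp.nonneg e)
      rw [swap_mul_decomposeFin j e, swap_mul_decomposeFin j' e]
      have a1 := hf 0 j (Equiv.Perm.decomposeFin.symm (0, e))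
      have a2 := hf 0 j' (Equiv.Perm.decomposeFin.symm (0, e))
      rw [abs_le] at *
      constructor <;> linarith [a1.1, a1.2, a2.1, a2.2]
    have h3 := exp_moment_le (unif_isProb (Fin (n + 1))) g (2 * c) h2
    rw [Ex_unif_perm_succ (fun σ => Real.exp (f σ)), hE]
    calc _ ≤ Ex (unif (Fin (n + 1))) (fun j => Real.exp (n * (2 * c ^ 2)) * Real.exp (g j)) := by
          refine Finset.sum_le_sum fun j _ => mul_le_mul_of_nonneg_left ?_
            ((unif_isProb _).nonneg j)
          beta_reduce
          rw [← Real.exp_add, add_comm]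
          exact h1 j
      _ = Real.exp (n * (2 * c ^ 2)) * Ex (unif (Fin (n + 1))) (fun j => Real.exp (g j)) := by
          unfold Ex
          rw [Finset.mul_sum]
          exact Finset.sum_congr rfl fun ω _ => by ring
      _ ≤ _ := mul_le_mul_of_nonneg_left h3 (Real.exp_pos _).le
      _ = _ := by
          rw [← Real.exp_add]
          congr 1
          push_cast
          ring

theorem perm_concentration {n : ℕ} (hn : 0 < n) (f : Equiv.Perm (Fin n) → ℝ) {c : ℝ} (hc : 0 < c)
    (hf : ∀ a b σ, |f (Equiv.swap a b * σ) - f σ| ≤ c) {t : ℝ} (ht : 0 ≤ t) :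
    Pr (unif (Equiv.Perm (Fin n))) (fun σ => t ≤ |f σ - Ex (unif (Equiv.Perm (Fin n))) f|) ≤
      2 * Real.exp (-(t ^ 2 / (8 * n * c ^ 2))) := by
  have := tail_of_mgf (unif_isProb (Equiv.Perm (Fin n))) f (B := n * (2 * c ^ 2)) (by positivity)
    (fun l => by
      refine (perm_mgf (fun ω => l * f ω) (c := |l| * c) (fun a b σ => by
        rw [← mul_sub, abs_mul]
        exact mul_le_mul_of_nonneg_left (hf a b σ) (abs_nonneg l))).trans ?_
      refine Real.exp_le_exp.2 (le_of_eq ?_)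
      have e1 : Ex (unif (Equiv.Perm (Fin n))) (fun ω => l * f ω) =
          l * Ex (unif (Equiv.Perm (Fin n))) f := by
        unfold Ex
        rw [Finset.mul_sum]
        exact Finset.sum_congr rfl fun ω _ => by ring
      rw [e1, mul_pow, sq_abs]; ring) ht
  refine this.trans (le_of_eq ?_)
  congr 4
  ring

end perm

/-! ### Counting by resampling a set of coordinates. -/

section counting

variable {ι V : Type} [Fintype ι] [DecidableEq ι] [Fintype V] [DecidableEq V]

open Classical in
/-- The functions mapping `G` bijectively onto `D`. -/
theorem card_injOn_image_eq (G : Finset ι) (D : Finset V) (hD : D.card = G.card) :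
    (Finset.univ.filter fun h : ι → V => Set.InjOn h G ∧ G.image h = D).card =
      G.card.factorial * Fintype.card V ^ (Fintype.card ι - G.card) := by
  have hmem : ∀ h : ι → V, G.image h = D → ∀ i : G, h i ∈ D := fun h hh i => by
    rw [← hh]; exact Finset.mem_image_of_mem h i.2
  let φ : {h : ι → V // Set.InjOn h G ∧ G.image h = D} ≃ (G ≃ D) × ({i // i ∉ G} → V) :=
    { toFun := fun h => (Equiv.ofBijective (fun i : G => (⟨h.1 i, hmem h.1 h.2.2 i⟩ : D)) (by
          constructor
          · intro a b hab
            exact Subtype.ext (h.2.1 a.2 b.2 (Subtype.ext_iff.1 hab))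
          · intro d
            obtain ⟨i, hi, hid⟩ := Finset.mem_image.1 (h.2.2.symm ▸ d.2 : (d : V) ∈ G.image h.1)
            exact ⟨⟨i, hi⟩, Subtype.ext hid⟩), fun i => h.1 i)
      invFun := fun y => ⟨fun i => if hi : i ∈ G then (y.1 ⟨i, hi⟩ : V) else y.2 ⟨i, hi⟩, by
          constructor
          · intro a ha b hb hab
            have ha' : a ∈ G := ha
            have hb' : b ∈ G := hb
            simp only [ha', hb', dif_pos] at hab
            exact Subtype.ext_iff.1 (y.1.injective (Subtype.ext hab))
          · ext v
            simp only [Finset.mem_image]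
            constructor
            · rintro ⟨i, hi, rfl⟩
              simp [hi]
            · intro hv
              refine ⟨y.1.symm ⟨v, hv⟩, (y.1.symm ⟨v, hv⟩).2, ?_⟩
              simp⟩
      left_inv := fun h => by
        ext i
        by_cases hi : i ∈ G
        · simp only [hi, dif_pos]
          rfl
        · simp [hi]
      right_inv := fun y => by
        refine Prod.ext ?_ ?_
        · ext i
          simp
        · ext i
          simp [i.2] }
  have hGD : Fintype.card G = Fintype.card D := by simp [hD]
  have e : G ≃ D := Fintype.equivOfCardEq hGD
  rw [← Fintype.card_subtype, Fintype.card_congr φ, Fintype.card_prod, Fintype.card_equiv e,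
    Fintype.card_fun, Fintype.card_coe]
  congr 2
  rw [Fintype.card_subtype_compl, Fintype.card_coe]

open Classical in
/-- Resampling the coordinates in `G`. -/
theorem card_extension_eq [Nonempty V] (G : Finset ι) (X : Finset (ι → V))
    (𝒟 : (ι → V) → Finset (Finset V))
    (hX : ∀ x ∈ X, ∀ h : ι → V, G.piecewise h x ∈ X)
    (h𝒟 : ∀ x h : ι → V, 𝒟 (G.piecewise h x) = 𝒟 x)
    (hcard : ∀ x ∈ X, ∀ D ∈ 𝒟 x, D.card = G.card) :
    (X.filter fun x => Set.InjOn x G ∧ G.image x ∈ 𝒟 x).card * Fintype.card V ^ G.card =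
      ∑ x ∈ X, G.card.factorial * (𝒟 x).card := by
  set P : (ι → V) → (ι → V) → Prop := fun x h => Set.InjOn h G ∧ G.image h ∈ 𝒟 x with hP
  have e0 : ∀ x ∈ X, (Finset.univ.filter fun h => P x h).card =
      (𝒟 x).card * (G.card.factorial * Fintype.card V ^ (Fintype.card ι - G.card)) := by
    intro x hx
    have : (Finset.univ.filter fun h => P x h) =
        (𝒟 x).biUnion fun D => Finset.univ.filter fun h : ι → V => Set.InjOn h G ∧ G.image h = D := by
      ext h
      simp [hP, and_comm]
    rw [this, Finset.card_biUnion]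
    · rw [Finset.sum_congr rfl fun D hD => card_injOn_image_eq G D (hcard x hx D hD)]
      simp
    · intro D _ D' _ hDD'
      rw [Function.onFun, Finset.disjoint_left]
      intro h h1 h2
      simp only [Finset.mem_filter, Finset.mem_univ, true_and] at h1 h2
      exact hDD' (h1.2.symm.trans h2.2)
  have e1 : ((X ×ˢ Finset.univ).filter fun y : (ι → V) × (ι → V) => P y.1 y.2).card =
      ∑ x ∈ X, (Finset.univ.filter fun h => P x h).card := by
    rw [Finset.card_filter, Finset.sum_product]
    exact Finset.sum_congr rfl fun x _ => (Finset.card_filter _ _).symm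
  have e2 : ((X ×ˢ Finset.univ).filter fun y : (ι → V) × (ι → V) => P y.1 y.1).card =
      (X.filter fun x => P x x).card * Fintype.card (ι → V) := by
    rw [Finset.card_filter, Finset.sum_product, Finset.card_filter, Finset.sum_mul]
    refine Finset.sum_congr rfl fun x _ => ?_
    by_cases h : P x x <;> simp [h]
  have hpp : ∀ x h : ι → V, G.piecewise (G.piecewise x h) (G.piecewise h x) = x := by
    intro x h; ext i; by_cases hi : i ∈ G <;> simp [hi]
  have himg : ∀ x h : ι → V, G.image (G.piecewise h x) = G.image h := fun x h =>
    Finset.image_congr fun i hi => Finset.piecewise_eq_of_mem _ _ _ hi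
  have hinj : ∀ x h : ι → V, Set.InjOn (G.piecewise h x) G ↔ Set.InjOn h G := fun x h =>
    Set.EqOn.injOn_iff fun i hi => Finset.piecewise_eq_of_mem _ _ _ hi
  -- Exchanging the `G`-coordinates of `x` and `h` is an involution of `X ×ˢ univ`. It turns the
  -- condition on a fresh function `h`, which is counted separately for each `x`, into the condition
  -- on `x` itself.
  have e3 : ((X ×ˢ Finset.univ).filter fun y : (ι → V) × (ι → V) => P y.1 y.2).card =
      ((X ×ˢ Finset.univ).filter fun y : (ι → V) × (ι → V) => P y.1 y.1).card := by
    refine Finset.card_bij' (fun y _ => (G.piecewise y.2 y.1, G.piecewise y.1 y.2))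
      (fun y _ => (G.piecewise y.2 y.1, G.piecewise y.1 y.2)) ?_ ?_ ?_ ?_
    · rintro ⟨x, h⟩ hy
      simp only [Finset.mem_filter, Finset.mem_product, Finset.mem_univ, and_true, hP] at hy ⊢
      exact ⟨hX x hy.1 h, (hinj x h).2 hy.2.1, by rw [himg, h𝒟]; exact hy.2.2⟩
    · rintro ⟨x, h⟩ hy
      simp only [Finset.mem_filter, Finset.mem_product, Finset.mem_univ, and_true, hP] at hy ⊢
      exact ⟨hX x hy.1 h, (hinj h x).2 hy.2.1, by rw [himg, h𝒟]; exact hy.2.2⟩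
    · rintro ⟨x, h⟩ _
      simp [hpp]
    · rintro ⟨x, h⟩ _
      simp [hpp]
  have hGι : G.card ≤ Fintype.card ι := Finset.card_le_univ G
  have hV : 0 < Fintype.card V ^ (Fintype.card ι - G.card) := pow_pos Fintype.card_pos _
  have e4 : (X.filter fun x => P x x).card * Fintype.card (ι → V) =
      ∑ x ∈ X, (𝒟 x).card * (G.card.factorial * Fintype.card V ^ (Fintype.card ι - G.card)) := by
    rw [← e2, ← e3, e1]
    exact Finset.sum_congr rfl e0
  rw [Fintype.card_fun] at e4
  refine Nat.eq_of_mul_eq_mul_right hV ?_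
  rw [mul_assoc, ← pow_add, Nat.add_sub_cancel' hGι, e4, Finset.sum_mul]
  exact Finset.sum_congr rfl fun x _ => by ring

end counting

/-! ### One counting step in a regular hypergraph. -/

section regular

variable {V : Type} [Fintype V] [DecidableEq V] {k : ℕ}

/-- A regular `k`-graph on sufficiently many vertices; `θ` is a lower bound for the powers
of `p` which occur. -/
structure LargeRegular (H : KGraph V k) (ℓ : ℕ) (ε p θ : ℝ) : Prop where
  reg : H.IsRegular ℓ ε p
  l_pos : 1 ≤ ℓ
  eps_pos : 0 < ε
  eps_le : ε ≤ 1 / 2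
  p_pos : 0 < p
  theta_pos : 0 < θ
  theta_le_one : θ ≤ 1
  theta_le_pow : ∀ s ≤ 2 * zz k ℓ + 2, θ ≤ p ^ s
  large : 20 * (5 * (qq k ℓ : ℝ) + (ℓ : ℝ) ^ 2) * ℓ.factorial ≤ ε * Fintype.card V * θ

theorem card_meeting_le (S : Finset V) (d : ℕ) :
    (Finset.univ.filter fun D : Finset V => D.card = d + 1 ∧ ¬ Disjoint D S).card ≤
      S.card * Fintype.card V ^ d := by
  have hsub : (Finset.univ.filter fun D : Finset V => D.card = d + 1 ∧ ¬ Disjoint D S) ⊆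
      (S ×ˢ Finset.powersetCard d Finset.univ).image fun y => insert y.1 y.2 := by
    intro D hD
    simp only [Finset.mem_filter, Finset.mem_univ, true_and, Finset.not_disjoint_iff] at hD
    obtain ⟨hc, v, hvD, hvS⟩ := hD
    simp only [Finset.mem_image, Finset.mem_product, Finset.mem_powersetCard_univ, Prod.exists]
    exact ⟨v, D.erase v, ⟨hvS, by rw [Finset.card_erase_of_mem hvD, hc]; rfl⟩,
      Finset.insert_erase hvD⟩
  refine (Finset.card_le_card hsub).trans (Finset.card_image_le.trans ?_)
  rw [Finset.card_product, Finset.card_powersetCard, Finset.card_univ]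
  exact Nat.mul_le_mul_left _ (Nat.choose_le_pow _ _)

open Classical in
-- Tuples have to avoid vertices used before. For `d ≥ 1` at most `5 q n ^ (d - 1)` sets meet `S`,
-- which by `large` is at most `ε / 20` of the main term; the increase of `ε` by a tenth pays for
-- this.
theorem LargeRegular.card_extending {H : KGraph V k} {ℓ : ℕ} {ε p θ : ℝ}
    (h : LargeRegular H ℓ ε p θ) (S : Finset V) (hS : S.card ≤ 5 * qq k ℓ) {d s : ℕ} (hd : d ≤ ℓ)
    (hs : s ≤ 2 * zz k ℓ + 2) (hsd : s = 0 ∨ 1 ≤ d) (A : Finset (Finset V)) (hA : A.card = s)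
    (hAc : ∀ a ∈ A, a.card = k - d) (hAU : (A.biUnion id).card ≤ k + 2 * qq k ℓ) :
    Within (11 / 10 * ε)
      ((Finset.univ.filter fun D : Finset V =>
        D.card = d ∧ Disjoint D S ∧ ∀ a ∈ A, a ∪ D ∈ H.edges).card : ℝ)
      ((Fintype.card V : ℝ) ^ d / (d.factorial : ℝ) * p ^ s) := by
  set n : ℝ := (Fintype.card V : ℝ) with hn
  have heps := h.eps_pos
  have hth := h.theta_pos
  have hlarge := h.large
  have hn0 : 0 < n := by
    have hl : (0 : ℝ) < (ℓ : ℝ) ^ 2 := by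
      have := h.l_pos
      positivity
    have h1 : (0 : ℝ) < 20 * (5 * (qq k ℓ : ℝ) + (ℓ : ℝ) ^ 2) * ℓ.factorial := by positivity
    by_contra hcon
    have h2 : ε * n * θ ≤ 0 :=
      mul_nonpos_of_nonpos_of_nonneg (mul_nonpos_of_nonneg_of_nonpos heps.le (not_lt.1 hcon)) hth.le
    linarith
  have hθs := h.theta_le_pow s hs
  have hd1 : (1 : ℝ) ≤ d.factorial := by exact_mod_cast Nat.one_le_iff_ne_zero.2 d.factorial_ne_zero
  have hdℓ : (d.factorial : ℝ) ≤ ℓ.factorial := by exact_mod_cast Nat.factorial_le hd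
  set B : ℝ := n ^ d / (d.factorial : ℝ) * p ^ s with hB
  have hB0 : 0 < B := by have := h.p_pos; positivity
  have hnth : ε * n * θ ≤ ε * n * p ^ s := mul_le_mul_of_nonneg_left hθs (by positivity)
  set meet := Finset.univ.filter fun D : Finset V => D.card = d ∧ ¬ Disjoint D S with hmeet
  have hmeet_le : (meet.card : ℝ) ≤ ε / 20 * B := by
    rcases d with _ | d
    · have : meet = ∅ := by
        rw [hmeet, Finset.filter_eq_empty_iff]
        rintro D - ⟨h1, h2⟩
        rw [Finset.card_eq_zero.1 h1] at h2
        simp at h2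
      rw [this]
      simp only [Finset.card_empty, Nat.cast_zero]
      positivity
    · have h1 : (meet.card : ℝ) ≤ 5 * qq k ℓ * n ^ d := by
        have := (card_meeting_le S d).trans (Nat.mul_le_mul_right _ hS)
        rw [hn, hmeet]
        exact_mod_cast this
      refine h1.trans ?_
      have h2 : 5 * (qq k ℓ : ℝ) * (d + 1).factorial ≤ ε / 20 * (n * p ^ s) := by
        have h3 : 5 * (qq k ℓ : ℝ) * (d + 1).factorial ≤ 5 * (qq k ℓ : ℝ) * ℓ.factorial :=
          mul_le_mul_of_nonneg_left hdℓ (by positivity)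
        have h4 : (0 : ℝ) ≤ (ℓ : ℝ) ^ 2 * ℓ.factorial := by positivity
        nlinarith
      have h5 : 5 * (qq k ℓ : ℝ) * n ^ d * (d + 1).factorial ≤ ε / 20 * (n ^ (d + 1) * p ^ s) := by
        calc _ = 5 * (qq k ℓ : ℝ) * (d + 1).factorial * n ^ d := by ring
          _ ≤ ε / 20 * (n * p ^ s) * n ^ d := mul_le_mul_of_nonneg_right h2 (by positivity)
          _ = _ := by ring
      have h6 : ε / 20 * B = ε / 20 * (n ^ (d + 1) * p ^ s) / (d + 1).factorial := by
        rw [hB]; ring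
      rw [h6, le_div_iff₀ (by positivity)]
      exact h5
  set full := Finset.univ.filter fun D : Finset V => D.card = d ∧ ∀ a ∈ A, a ∪ D ∈ H.edges with hfull
  set good := Finset.univ.filter fun D : Finset V =>
        D.card = d ∧ Disjoint D S ∧ ∀ a ∈ A, a ∪ D ∈ H.edges with hgood
  have hle : good.card ≤ full.card := Finset.card_le_card fun D => by
    simp only [hgood, hfull, Finset.mem_filter, Finset.mem_univ, true_and]
    exact fun hD => ⟨hD.1, hD.2.2⟩
  have hge : full.card ≤ good.card + meet.card := by
    refine le_trans (Finset.card_le_card fun D => ?_) (Finset.card_union_le good meet)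
    simp only [hgood, hfull, hmeet, Finset.mem_filter, Finset.mem_univ, true_and, Finset.mem_union]
    intro hD
    by_cases hDS : Disjoint D S
    · exact Or.inl ⟨hD.1, hDS, hD.2⟩
    · exact Or.inr ⟨hD.1, hDS⟩
  have hle' : (good.card : ℝ) ≤ full.card := by exact_mod_cast hle
  have hge' : (full.card : ℝ) ≤ good.card + meet.card := by exact_mod_cast hge
  have hfullW : Within ε (full.card : ℝ) B := by
    -- Regularity is silent for `s = 0`. Then the count is a binomial coefficient, which `large`
    -- makes close enough to `n ^ d / d!`.
    rcases Nat.eq_zero_or_pos s with hs0 | hs0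
    · have hAe : A = ∅ := by rw [← Finset.card_eq_zero, hA, hs0]
      have hf : full.card = (Fintype.card V).choose d := by
        rw [← Finset.card_univ, ← Finset.card_powersetCard]
        congr 1
        ext D
        simp [hfull, hAe, Finset.mem_powersetCard]
      have hBs : B = n ^ d / (d.factorial : ℝ) := by rw [hB, hs0]; simp
      have hup : (full.card : ℝ) ≤ B := by
        rw [hf, hBs]
        exact Nat.choose_le_pow_div d _
      have h20 : 20 * (ℓ : ℝ) ^ 2 ≤ ε * n := by
        have h3 : (1 : ℝ) ≤ ℓ.factorial := hd1.trans hdℓ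
        have h4 : 20 * (ℓ : ℝ) ^ 2 ≤ 20 * (5 * (qq k ℓ : ℝ) + (ℓ : ℝ) ^ 2) * ℓ.factorial := by
          have : 0 ≤ (5 * (qq k ℓ : ℝ)) := by positivity
          have : 0 ≤ (ℓ : ℝ) ^ 2 := by positivity
          nlinarith
        have h5 : ε * n * θ ≤ ε * n := mul_le_of_le_one_right (by positivity) h.theta_le_one
        linarith
      have hdℓ' : (d : ℝ) ≤ ℓ := by exact_mod_cast hd
      have hd2 : 20 * (d : ℝ) ^ 2 ≤ ε * n := by
        have : (d : ℝ) ^ 2 ≤ (ℓ : ℝ) ^ 2 := by gcongr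
        linarith
      have hdn : d ≤ Fintype.card V := by
        have h1 : (d : ℝ) ≤ (d : ℝ) ^ 2 := by exact_mod_cast Nat.le_self_pow two_ne_zero d
        have h2 : ε * n ≤ 1 / 2 * n := mul_le_mul_of_nonneg_right h.eps_le hn0.le
        have : (d : ℝ) ≤ n := by nlinarith
        rw [hn] at this
        exact_mod_cast this
      have hlow : (1 - ε) * B ≤ full.card := by
        rw [hf, hBs, ← mul_div_assoc, div_le_iff₀ (by positivity)]
        have h1 : (Fintype.card V + 1 - d) ^ d ≤ (Fintype.card V).descFactorial d :=
          Nat.pow_sub_le_descFactorial _ _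
        have h2 : ((Fintype.card V).choose d : ℝ) * d.factorial =
            ((Fintype.card V).descFactorial d : ℝ) := by
          rw [Nat.descFactorial_eq_factorial_mul_choose]
          push_cast
          ring
        rw [h2]
        have h3 : (n - d) ^ d ≤ ((Fintype.card V).descFactorial d : ℝ) := by
          have h4 : (Fintype.card V - d) ^ d ≤ (Fintype.card V).descFactorial d :=
            (Nat.pow_le_pow_left (by omega) d).trans h1
          rw [hn, ← Nat.cast_sub hdn]
          exact_mod_cast h4
        refine le_trans ?_ h3
        have h5 : (1 + (d : ℝ) * (-(d / n))) ≤ (1 + (-(d / n))) ^ d := by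
          refine one_add_mul_le_pow ?_ d
          have : (d : ℝ) / n ≤ 1 := by
            rw [div_le_one hn0, hn]
            exact_mod_cast hdn
          linarith
        have h6 : (n - d) ^ d = (1 + (-(d / n))) ^ d * n ^ d := by
          rw [← mul_pow]
          congr 1
          field_simp
          ring
        rw [h6]
        refine mul_le_mul_of_nonneg_right (le_trans ?_ h5) (by positivity)
        have h7 : (d : ℝ) * (d / n) ≤ ε := by
          rw [← mul_div_assoc, div_le_iff₀ hn0]
          nlinarith
        linarith
      exact ⟨hlow, by nlinarith⟩
    · have := h.reg d s (by omega) hd hs0 hs A hA hAc (by convert hAU)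
      rw [hB, hn, hfull]
      convert this
  obtain ⟨h1, h2⟩ := hfullW
  constructor
  · nlinarith
  · nlinarith

/-- The effect of prescribing the values on a set `G` of coordinates: they have to complete
`s` given sets to edges of a regular graph. -/
theorem LargeRegular.card_step {H : KGraph V k} {ℓ : ℕ} {ε p θ : ℝ}
    (h : LargeRegular H ℓ ε p θ) {ι : Type} [Fintype ι] [DecidableEq ι] (G : Finset ι)
    (X Y : Finset (ι → V)) (S : (ι → V) → Finset V) (𝒜 : (ι → V) → Finset (Finset V)) {s : ℕ}
    (hX : ∀ x ∈ X, ∀ h : ι → V, G.piecewise h x ∈ X)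
    (hS : ∀ x h : ι → V, S (G.piecewise h x) = S x)
    (h𝒜 : ∀ x h : ι → V, 𝒜 (G.piecewise h x) = 𝒜 x)
    (hSc : ∀ x ∈ X, (S x).card ≤ 5 * qq k ℓ)
    (hG : G.card ≤ ℓ) (hs : s ≤ 2 * zz k ℓ + 2) (hsd : s = 0 ∨ 1 ≤ G.card)
    (hAs : ∀ x ∈ X, (𝒜 x).card = s) (hAc : ∀ x ∈ X, ∀ a ∈ 𝒜 x, a.card = k - G.card)
    (hAU : ∀ x ∈ X, ((𝒜 x).biUnion id).card ≤ k + 2 * qq k ℓ)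
    (hY : ∀ x, x ∈ Y ↔ x ∈ X ∧ Set.InjOn x G ∧ Disjoint (G.image x) (S x) ∧
      ∀ a ∈ 𝒜 x, a ∪ G.image x ∈ H.edges) :
    Within (11 / 10 * ε) (Y.card : ℝ) (p ^ s * X.card) := by
  classical
  rcases isEmpty_or_nonempty V with hV | hV
  · have hlarge := h.large
    rw [Fintype.card_eq_zero] at hlarge
    have hl : (0 : ℝ) < (ℓ : ℝ) ^ 2 := by
      have := h.l_pos
      positivity
    have h1 : (0 : ℝ) < 20 * (5 * (qq k ℓ : ℝ) + (ℓ : ℝ) ^ 2) * ℓ.factorial := by positivity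
    simp at hlarge
    linarith
  set 𝒟 : (ι → V) → Finset (Finset V) := fun x => Finset.univ.filter fun D : Finset V =>
        D.card = G.card ∧ Disjoint D (S x) ∧ ∀ a ∈ 𝒜 x, a ∪ D ∈ H.edges with h𝒟
  have key := card_extension_eq G X 𝒟 hX (fun x h => by simp only [h𝒟, hS, h𝒜]) (fun x _ D hD => by
    simp only [h𝒟, Finset.mem_filter] at hD
    exact hD.2.1)
  have hYeq : (X.filter fun x => Set.InjOn x G ∧ G.image x ∈ 𝒟 x) = Y := by
    ext x
    rw [Finset.mem_filter, hY]
    simp only [h𝒟, Finset.mem_filter, Finset.mem_univ, true_and]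
    constructor
    · rintro ⟨h1, h2, -, h3, h4⟩
      exact ⟨h1, h2, h3, h4⟩
    · rintro ⟨h1, h2, h3, h4⟩
      exact ⟨h1, h2, Finset.card_image_of_injOn h2, h3, h4⟩
  rw [hYeq] at key
  have hn0 : (0 : ℝ) < Fintype.card V := by exact_mod_cast Fintype.card_pos
  set B : ℝ := (Fintype.card V : ℝ) ^ G.card / (G.card.factorial : ℝ) * p ^ s with hB
  have hfac : (0 : ℝ) < G.card.factorial := by positivity
  have hw : ∀ x ∈ X, Within (11 / 10 * ε) ((𝒟 x).card : ℝ) B := fun x hx =>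
    h.card_extending (S x) (hSc x hx) hG hs hsd (𝒜 x) (hAs x hx) (hAc x hx) (hAU x hx)
  have key' : (Y.card : ℝ) * (Fintype.card V : ℝ) ^ G.card =
      ∑ x ∈ X, (G.card.factorial : ℝ) * ((𝒟 x).card : ℝ) := by exact_mod_cast key
  have hc : ∀ c : ℝ, c * (p ^ s * X.card) * (Fintype.card V : ℝ) ^ G.card =
      ∑ x ∈ X, (G.card.factorial : ℝ) * (c * B) := by
    intro c
    rw [Finset.sum_const, nsmul_eq_mul, hB]
    field_simp
  have hpos : (0 : ℝ) < (Fintype.card V : ℝ) ^ G.card := by positivity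
  constructor
  · refine le_of_mul_le_mul_right ?_ hpos
    rw [key', hc]
    exact Finset.sum_le_sum fun x hx => mul_le_mul_of_nonneg_left (hw x hx).1 hfac.le
  · refine le_of_mul_le_mul_right ?_ hpos
    rw [key', hc]
    exact Finset.sum_le_sum fun x hx => mul_le_mul_of_nonneg_left (hw x hx).2 hfac.le

end regular

/-! ### Arithmetic of the parameters. -/

section params

/-- The form is chosen for `omega`, which treats the products as atoms. The overhang `k - q` lies
between `1` and `ℓ`; the extreme value `ℓ` does occur, namely if `ℓ` divides `k`, and needs separate
treatment in `card_arcTuples`. -/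
theorem params_facts {k ℓ : ℕ} (hℓ : 1 ≤ ℓ) (hk : 2 * ℓ < k) :
    2 ≤ zz k ℓ ∧ k ≤ qq k ℓ + ℓ ∧ qq k ℓ < k ∧ k < 2 * qq k ℓ ∧ 2 * ℓ ≤ qq k ℓ ∧
      (zz k ℓ - 1) * ℓ + ℓ = qq k ℓ := by
  have h1 : k - ℓ ≤ ℓ * zz k ℓ := by
    have := le_smul_ceilDiv (α := ℕ) (β := ℕ) (a := ℓ) (b := k - ℓ) (by omega)
    simpa [zz] using this
  have h2 : ℓ * zz k ℓ < k := by
    have : zz k ℓ = (k - ℓ + ℓ - 1) / ℓ := by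
      rw [zz, Nat.ceilDiv_eq_add_pred_div]
    rw [this]
    have := Nat.mul_div_le (k - ℓ + ℓ - 1) ℓ
    omega
  have h3 : 2 ≤ zz k ℓ := by
    by_contra hcon
    have : zz k ℓ ≤ 1 := by omega
    have : ℓ * zz k ℓ ≤ ℓ * 1 := Nat.mul_le_mul_left _ this
    omega
  have h4 : ℓ * 2 ≤ ℓ * zz k ℓ := Nat.mul_le_mul_left _ h3
  have h5 : (zz k ℓ - 1) * ℓ + ℓ = ℓ * zz k ℓ := by
    obtain ⟨z, hz⟩ : ∃ z, zz k ℓ = z + 1 := ⟨zz k ℓ - 1, by omega⟩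
    rw [hz]
    simp only [Nat.add_sub_cancel]
    ring
  unfold qq
  refine ⟨h3, by omega, h2, by omega, by omega, h5⟩

end params

/-! ### Segments of positions, and windows as unions of segments. -/

section segments

/-- The set of `s` with `a ≤ s < b`. -/
def seg (m a b : ℕ) : Finset (Fin m) := Finset.univ.filter fun s => a ≤ (s : ℕ) ∧ (s : ℕ) < b

@[simp] theorem mem_seg {m a b : ℕ} {s : Fin m} : s ∈ seg m a b ↔ a ≤ (s : ℕ) ∧ (s : ℕ) < b := by
  simp [seg]

theorem card_seg {m a b : ℕ} (hb : b ≤ m) : (seg m a b).card = b - a := by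
  rw [← Nat.card_Ico, ← Finset.card_image_of_injective _ (Fin.val_injective (n := m))]
  congr 1
  ext s
  simp only [Finset.mem_image, mem_seg, Finset.mem_Ico]
  constructor
  · rintro ⟨t, ht, rfl⟩
    exact ht
  · intro hs
    exact ⟨⟨s, by omega⟩, hs, rfl⟩

theorem seg_union {m a b c : ℕ} (h1 : a ≤ b) (h2 : b ≤ c) : seg m a b ∪ seg m b c = seg m a c := by
  ext s
  simp only [Finset.mem_union, mem_seg]
  omega

theorem seg_disjoint {m a b c d : ℕ} (h : b ≤ c) : Disjoint (seg m a b) (seg m c d) := by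
  rw [Finset.disjoint_left]
  intro s hs
  simp only [mem_seg] at hs ⊢
  omega

theorem seg_subset {m a b c d : ℕ} (h1 : c ≤ a) (h2 : b ≤ d) : seg m a b ⊆ seg m c d := by
  intro s
  simp only [mem_seg]
  omega

variable {ι V : Type} [DecidableEq ι] [DecidableEq V]

theorem image_piecewise_of_disjoint {G T : Finset ι} (h : Disjoint T G) (x y : ι → V) :
    T.image (G.piecewise y x) = T.image x :=
  Finset.image_congr fun _ hi =>
    Finset.piecewise_eq_of_notMem _ _ _ (Finset.disjoint_left.1 h hi)

theorem injOn_piecewise_of_disjoint {G T : Finset ι} (h : Disjoint T G) (x y : ι → V) :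
    Set.InjOn (G.piecewise y x) T ↔ Set.InjOn x T :=
  Set.EqOn.injOn_iff fun _ hi =>
    Finset.piecewise_eq_of_notMem _ _ _ (Finset.disjoint_left.1 h hi)

theorem injOn_union_iff {T G : Finset ι} (h : Disjoint T G) (x : ι → V) :
    Set.InjOn x (T ∪ G : Finset ι) ↔
      Set.InjOn x T ∧ Set.InjOn x G ∧ Disjoint (G.image x) (T.image x) := by
  rw [Finset.coe_union, Set.injOn_union (Finset.disjoint_coe.2 h), and_congr_right_iff]
  intro _
  rw [and_congr_right_iff]
  intro _
  rw [Finset.disjoint_left]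
  constructor
  · intro h v hv hv'
    obtain ⟨a, ha, rfl⟩ := Finset.mem_image.1 hv
    obtain ⟨b, hb, hab⟩ := Finset.mem_image.1 hv'
    exact h b hb a ha hab
  · intro h a ha b hb hab
    exact h (Finset.mem_image_of_mem x hb) (hab ▸ Finset.mem_image_of_mem x ha)

theorem ownedEdge_eq {k ℓ i : ℕ} (hℓ : 1 ≤ ℓ) (hk : 2 * ℓ < k) (hi : i < zz k ℓ)
    (v w : Fin (qq k ℓ) → V) :
    ownedEdge k ℓ v w i = (seg (qq k ℓ) (i * ℓ) (qq k ℓ)).image v ∪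
      (seg (qq k ℓ) 0 (i * ℓ + (k - qq k ℓ))).image w := by
  obtain ⟨hz, h1, h2, h3, h4, h5⟩ := params_facts hℓ hk
  have h6 : i * ℓ ≤ (zz k ℓ - 1) * ℓ := Nat.mul_le_mul_right _ (by omega)
  unfold ownedEdge
  ext u
  simp only [Finset.mem_image, Finset.mem_union, Finset.mem_filter, Finset.mem_univ, true_and,
    mem_seg]
  constructor
  · rintro ⟨t, ht, rfl⟩
    induction t using Fin.addCases with
    | left t =>
      left
      refine ⟨t, ?_, by simp⟩
      simp only [Fin.val_castAdd] at ht
      exact ⟨ht.1, t.2⟩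
    | right t =>
      right
      refine ⟨t, ?_, (Fin.append_right v w t).symm⟩
      simp only [Fin.val_natAdd] at ht
      omega
  · rintro (⟨t, ht, rfl⟩ | ⟨t, ht, rfl⟩)
    · refine ⟨Fin.castAdd _ t, ?_, by simp⟩
      simp only [Fin.val_castAdd]
      omega
    · refine ⟨Fin.natAdd _ t, ?_, Fin.append_right v w t⟩
      simp only [Fin.val_natAdd]
      omega

end segments

/-! ### Relative errors accumulated over several counting steps. -/

section within

/-- Accumulated relative error after `m` steps. -/
def WithinPow (e : ℝ) (m : ℕ) (A B : ℝ) : Prop := (1 - e) ^ m * B ≤ A ∧ A ≤ (1 + e) ^ m * B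

theorem WithinPow.zero (e B : ℝ) : WithinPow e 0 B B := by simp [WithinPow]

theorem WithinPow.step {e : ℝ} (he : 0 ≤ e) (he1 : e ≤ 1) {m : ℕ} {A B C c : ℝ} (hc : 0 ≤ c)
    (h : WithinPow e m A B) (h' : Within e C (c * A)) : WithinPow e (m + 1) C (c * B) := by
  constructor
  · refine le_trans ?_ h'.1
    rw [pow_succ]
    calc _ = (1 - e) * c * ((1 - e) ^ m * B) := by ring
      _ ≤ (1 - e) * c * A := mul_le_mul_of_nonneg_left h.1 (mul_nonneg (by linarith) hc)
      _ = _ := by ring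
  · refine h'.2.trans ?_
    rw [pow_succ]
    calc _ = (1 + e) * c * A := by ring
      _ ≤ (1 + e) * c * ((1 + e) ^ m * B) :=
        mul_le_mul_of_nonneg_left h.2 (mul_nonneg (by linarith) hc)
      _ = _ := by ring

theorem WithinPow.mono {e : ℝ} (he : 0 ≤ e) (he1 : e ≤ 1) {m m' : ℕ} (hm : m ≤ m') {A B : ℝ}
    (hB : 0 ≤ B) (h : WithinPow e m A B) : WithinPow e m' A B :=
  ⟨(mul_le_mul_of_nonneg_right (pow_le_pow_of_le_one (by linarith) (by linarith) hm) hB).trans h.1,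
    h.2.trans (mul_le_mul_of_nonneg_right (pow_le_pow_right₀ (by linarith) hm) hB)⟩

end within

/-! ### Counting tuples with prescribed in-neighbours and out-neighbours. -/

section arcs

variable {V : Type} [Fintype V] [DecidableEq V] {k : ℕ}

open Classical in
/-- The `q`-tuples which are preceded by all members of `P` and precede all members of `Q`, and
are disjoint from all of these. -/
noncomputable def arcTuples (H : KGraph V k) (ℓ : ℕ) (P Q : Finset (Fin (qq k ℓ) → V)) :
    Finset (Fin (qq k ℓ) → V) :=
  Finset.univ.filter fun x => Function.Injective x ∧ (∀ v ∈ P ∪ Q, ∀ s t, x s ≠ v t) ∧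
    (∀ v ∈ P, Precedes H ℓ v x) ∧ ∀ w ∈ Q, Precedes H ℓ x w

/-- The set of vertices of the tuples in `R`. -/
def support {m : ℕ} (R : Finset (Fin m → V)) : Finset V := R.biUnion fun v => Finset.univ.image v

theorem mem_support {m : ℕ} {R : Finset (Fin m → V)} {u : V} :
    u ∈ support R ↔ ∃ v ∈ R, ∃ t, v t = u := by
  simp [support]

theorem card_support_le {m c : ℕ} {R : Finset (Fin m → V)} (hR : R.card ≤ c) :
    (support R).card ≤ c * m := by
  refine Finset.card_biUnion_le.trans ?_
  refine (Finset.sum_le_card_nsmul R _ m fun v _ => ?_).trans ?_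
  · exact Finset.card_image_le.trans (by simp)
  · rw [smul_eq_mul]
    exact Nat.mul_le_mul_right _ hR

/-- The length of the prefix covered by the first `j` edges owned by an arc into a tuple. -/
def preLen (k ℓ j : ℕ) : ℕ := if j = 0 then 0 else (j - 1) * ℓ + (k - qq k ℓ)

open Classical in
/-- The tuples for which the first `j` edges owned by the arcs from members of `P` are present. -/
noncomputable def prefixTuples (H : KGraph V k) (ℓ : ℕ) (P : Finset (Fin (qq k ℓ) → V))
    (S : Finset V) (j : ℕ) : Finset (Fin (qq k ℓ) → V) :=
  Finset.univ.filter fun x => Set.InjOn x (seg (qq k ℓ) 0 (preLen k ℓ j)) ∧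
    Disjoint ((seg (qq k ℓ) 0 (preLen k ℓ j)).image x) S ∧
    ∀ v ∈ P, ∀ i < j, ownedEdge k ℓ v x i ∈ H.edges

/-- The members of `R` are injective tuples with disjoint supports. -/
structure DisjointTuples {m : ℕ} (R : Finset (Fin m → V)) : Prop where
  inj : ∀ v ∈ R, Function.Injective v
  disj : ∀ v ∈ R, ∀ w ∈ R, v ≠ w → ∀ s t, v s ≠ w t

variable {H : KGraph V k} {ℓ : ℕ} {ε p θ : ℝ}

/-- Membership depends only on the entries before position `preLen k ℓ j`; closure under resampling
later entries is what `card_step` demands. -/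
theorem prefixTuples_piecewise (hk : 2 * ℓ < k) (h : LargeRegular H ℓ ε p θ)
    {P : Finset (Fin (qq k ℓ) → V)} {S : Finset V} {j b : ℕ} (hj : j ≤ zz k ℓ)
    {x : Fin (qq k ℓ) → V} (hx : x ∈ prefixTuples H ℓ P S j) (y : Fin (qq k ℓ) → V) :
    (seg (qq k ℓ) (preLen k ℓ j) b).piecewise y x ∈ prefixTuples H ℓ P S j := by
  have hd : Disjoint (seg (qq k ℓ) 0 (preLen k ℓ j)) (seg (qq k ℓ) (preLen k ℓ j) b) :=
    seg_disjoint le_rfl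
  simp only [prefixTuples, Finset.mem_filter, Finset.mem_univ, true_and] at hx ⊢
  rw [injOn_piecewise_of_disjoint hd, image_piecewise_of_disjoint hd]
  refine ⟨hx.1, hx.2.1, fun v hv i hi => ?_⟩
  have := hx.2.2 v hv i hi
  rw [ownedEdge_eq h.l_pos hk (by omega)] at this ⊢
  rw [image_piecewise_of_disjoint]
  · exact this
  · refine seg_disjoint ?_
    have : i * ℓ ≤ (j - 1) * ℓ := Nat.mul_le_mul_right _ (by omega)
    rw [preLen, if_neg (by omega)]
    omega

theorem preLen_succ (k ℓ j : ℕ) : preLen k ℓ (j + 1) = j * ℓ + (k - qq k ℓ) := by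
  simp [preLen]

theorem preLen_mono (k ℓ j : ℕ) : preLen k ℓ j ≤ preLen k ℓ (j + 1) := by
  rw [preLen_succ, preLen]
  split_ifs
  · omega
  · have : (j - 1) * ℓ ≤ j * ℓ := Nat.mul_le_mul_right _ (by omega)
    omega

/-- The `j`-th windows from the members of `P` end at the same position of `x`, so a single
regularity step with `s = P.card` completes all of them. The first step prescribes `k - q` entries,
each later one `ℓ` more. -/
theorem card_prefixTuples (hk : 2 * ℓ < k) (h : LargeRegular H ℓ ε p θ)
    {P : Finset (Fin (qq k ℓ) → V)} {S : Finset V} (hP : P.card ≤ 2) (hS : S.card ≤ 4 * qq k ℓ)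
    (hPS : support P ⊆ S) (hPd : DisjointTuples P) {j : ℕ} (hj : j ≤ zz k ℓ) :
    WithinPow (11 / 10 * ε) j ((prefixTuples H ℓ P S j).card : ℝ)
      ((Fintype.card V : ℝ) ^ qq k ℓ * p ^ (P.card * j)) := by
  obtain ⟨hz, h1, h2, h3, h4, h5⟩ := params_facts h.l_pos hk
  have hl := h.l_pos
  have he0 := h.eps_pos
  have he1 := h.eps_le
  induction j with
  | zero =>
    have : prefixTuples H ℓ P S 0 = Finset.univ := by
      ext x
      have : seg (qq k ℓ) 0 (preLen k ℓ 0) = ∅ := by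
        ext s; simp [preLen]
      simp [prefixTuples, this]
    rw [this]
    simp [WithinPow]
  | succ j ih =>
    specialize ih (by omega)
    set ρ := preLen k ℓ j with hρ
    have hρ' : preLen k ℓ (j + 1) = j * ℓ + (k - (qq k ℓ)) := preLen_succ k ℓ j
    have hjl : j * ℓ ≤ (zz k ℓ - 1) * ℓ := Nat.mul_le_mul_right _ (by omega)
    have hρle : ρ ≤ j * ℓ + (k - (qq k ℓ)) := by rw [← hρ']; exact preLen_mono k ℓ j
    set G := seg (qq k ℓ) ρ (j * ℓ + (k - (qq k ℓ))) with hG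
    have hsum : j * ℓ + (k - (qq k ℓ)) - ρ + ((qq k ℓ) - j * ℓ + ρ) = k := by omega
    have hGc : G.card = j * ℓ + (k - (qq k ℓ)) - ρ := card_seg (by omega)
    have hG1 : 1 ≤ G.card ∧ G.card ≤ ℓ := by
      rw [hGc, hρ, preLen]
      split_ifs with hj0
      · subst hj0; omega
      · obtain ⟨i, rfl⟩ : ∃ i, j = i + 1 := ⟨j - 1, by omega⟩
        simp only [Nat.add_sub_cancel, Nat.succ_mul]
        omega
    have hun : seg (qq k ℓ) 0 ρ ∪ G = seg (qq k ℓ) 0 (j * ℓ + (k - (qq k ℓ))) := seg_union (Nat.zero_le _) hρle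
    have hdisj : Disjoint (seg (qq k ℓ) 0 ρ) G := seg_disjoint le_rfl
    have hxS : ∀ x ∈ prefixTuples H ℓ P S j, ∀ s ∈ seg (qq k ℓ) 0 ρ, ∀ v ∈ P, ∀ t, v t ≠ x s := by
      intro x hx s hs v hv t hvt
      simp only [prefixTuples, Finset.mem_filter, Finset.mem_univ, true_and] at hx
      exact Finset.disjoint_left.1 hx.2.1 (Finset.mem_image_of_mem x hs)
        (hPS (mem_support.2 ⟨v, hv, t, hvt⟩))
    -- The last entry of `v` lies in every window leaving `v`; it distinguishes the sets belonging
    -- to different members of `P`.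
    have hlast : (⟨(qq k ℓ) - 1, by omega⟩ : Fin (qq k ℓ)) ∈ seg (qq k ℓ) (j * ℓ) (qq k ℓ) := by
      simp only [mem_seg]; omega
    have step := h.card_step G (prefixTuples H ℓ P S j) (prefixTuples H ℓ P S (j + 1))
      (fun x => S ∪ (seg (qq k ℓ) 0 ρ).image x)
      (fun x => P.image fun v => (seg (qq k ℓ) (j * ℓ) (qq k ℓ)).image v ∪ (seg (qq k ℓ) 0 ρ).image x)
      (s := P.card)
      (fun x hx y => prefixTuples_piecewise hk h (by omega) hx y)
      (fun x y => by rw [image_piecewise_of_disjoint hdisj])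
      (fun x y => by rw [image_piecewise_of_disjoint hdisj])
      (fun x hx => by
        refine (Finset.card_union_le _ _).trans ?_
        have : ((seg (qq k ℓ) 0 ρ).image x).card ≤ (qq k ℓ) := Finset.card_image_le.trans
          ((Finset.card_le_univ _).trans (by simp))
        omega) hG1.2 (by omega) (Or.inr hG1.1)
      (fun x hx => by
        refine Finset.card_image_of_injOn fun v hv w hw hvw => ?_
        by_contra hne
        have : v ⟨(qq k ℓ) - 1, by omega⟩ ∈ (seg (qq k ℓ) (j * ℓ) (qq k ℓ)).image w ∪ (seg (qq k ℓ) 0 ρ).image x := by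
          beta_reduce at hvw
          rw [← hvw]
          exact Finset.mem_union_left _ (Finset.mem_image_of_mem v hlast)
        rcases Finset.mem_union.1 this with h6 | h6
        · obtain ⟨t, -, ht⟩ := Finset.mem_image.1 h6
          exact hPd.disj v hv w hw hne _ _ ht.symm
        · obtain ⟨s, hs, hs'⟩ := Finset.mem_image.1 h6
          exact hxS x hx s hs v hv _ hs'.symm)
      (fun x hx a ha => by
        obtain ⟨v, hv, rfl⟩ := Finset.mem_image.1 ha
        have hxi : Set.InjOn x (seg (qq k ℓ) 0 ρ) := by
          simp only [prefixTuples, Finset.mem_filter, Finset.mem_univ, true_and] at hx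
          exact hx.1
        rw [Finset.card_union_of_disjoint, Finset.card_image_of_injective _ (hPd.inj v hv),
          Finset.card_image_of_injOn hxi, card_seg le_rfl, card_seg (by omega), hGc]
        · omega
        · rw [Finset.disjoint_left]
          intro u hu hu'
          obtain ⟨t, -, rfl⟩ := Finset.mem_image.1 hu
          obtain ⟨s, hs, hs'⟩ := Finset.mem_image.1 hu'
          exact hxS x hx s hs v hv _ hs'.symm)
      (fun x hx => by
        have hsub : (P.image fun v => (seg (qq k ℓ) (j * ℓ) (qq k ℓ)).image v ∪ (seg (qq k ℓ) 0 ρ).image x).biUnion id ⊆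
            support P ∪ (seg (qq k ℓ) 0 ρ).image x := by
          intro u hu
          simp only [Finset.mem_biUnion, Finset.mem_image, id] at hu
          obtain ⟨a, ⟨v, hv, rfl⟩, hu⟩ := hu
          rcases Finset.mem_union.1 hu with h6 | h6
          · obtain ⟨t, -, rfl⟩ := Finset.mem_image.1 h6
            exact Finset.mem_union_left _ (mem_support.2 ⟨v, hv, t, rfl⟩)
          · exact Finset.mem_union_right _ h6
        refine (Finset.card_le_card hsub).trans ((Finset.card_union_le _ _).trans ?_)
        have e1 : ((seg (qq k ℓ) 0 ρ).image x).card ≤ (qq k ℓ) := Finset.card_image_le.trans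
          ((Finset.card_le_univ _).trans (by simp))
        have e2 := card_support_le hP
        omega)
      (fun x => by
        simp only [prefixTuples, Finset.mem_filter, Finset.mem_univ, true_and]
        rw [hρ', ← hun, injOn_union_iff hdisj, Finset.image_union, Finset.disjoint_union_left,
          Finset.disjoint_union_right]
        have hj1 : ∀ v, ownedEdge k ℓ v x j =
            ((seg (qq k ℓ) (j * ℓ) (qq k ℓ)).image v ∪ (seg (qq k ℓ) 0 ρ).image x) ∪ G.image x := fun v => by
          rw [ownedEdge_eq h.l_pos hk (by omega), ← hun, Finset.image_union,
            Finset.union_assoc]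
        have hj2 : (∀ v ∈ P, ∀ i < j + 1, ownedEdge k ℓ v x i ∈ H.edges) ↔
            (∀ v ∈ P, ∀ i < j, ownedEdge k ℓ v x i ∈ H.edges) ∧
            ∀ a ∈ P.image fun v => (seg (qq k ℓ) (j * ℓ) (qq k ℓ)).image v ∪ (seg (qq k ℓ) 0 ρ).image x,
              a ∪ G.image x ∈ H.edges := by
          constructor
          · intro h6
            refine ⟨fun v hv i hi => h6 v hv i (by omega), fun a ha => ?_⟩
            obtain ⟨v, hv, rfl⟩ := Finset.mem_image.1 ha
            rw [← hj1]
            exact h6 v hv j (by omega)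
          · rintro ⟨h6, h7⟩ v hv i hi
            rcases Nat.lt_succ_iff_lt_or_eq.1 hi with h8 | rfl
            · exact h6 v hv i h8
            · rw [hj1]
              exact h7 _ (Finset.mem_image_of_mem _ hv)
        rw [hj2]
        tauto)
    have := ih.step (by linarith) (by linarith) (pow_nonneg h.p_pos.le P.card) step
    convert this using 1
    rw [Nat.mul_succ, pow_add]
    ring

set_option maxHeartbeats 1000000 in
-- All windows from `x` into members of `Q` contain the last entry of `x`, so the final entries
-- complete them in one step. If `k = q + ℓ`, the last windows from members of `P` end exactly at
-- the end of `x` and belong to the same step (`P' = P`); otherwise they are finished before. This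
-- step involves up to `2 * z + 2` sets, whose union can have exactly `k + 2 * q` elements when `k =
-- q + ℓ`: these are the two bounds in the definition of regularity.
theorem card_final (hk : 2 * ℓ < k) (h : LargeRegular H ℓ ε p θ)
    {P Q P' : Finset (Fin (qq k ℓ) → V)} (hP : P.card ≤ 2) (hQ : Q.card ≤ 2)
    (hd : DisjointTuples (P ∪ Q)) {j : ℕ} (hj : 1 ≤ j)
    (hcase : (j = zz k ℓ ∧ P' = ∅ ∧ k < qq k ℓ + ℓ) ∨
      (j + 1 = zz k ℓ ∧ P' = P ∧ k = qq k ℓ + ℓ)) :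
    Within (11 / 10 * ε) ((arcTuples H ℓ P Q).card : ℝ)
      (p ^ (Q.card * zz k ℓ + P'.card) * (prefixTuples H ℓ P (support (P ∪ Q)) j).card) := by
  obtain ⟨hz, h1, h2, h3, h4, h5⟩ := params_facts h.l_pos hk
  have hl := h.l_pos
  set z := zz k ℓ with hz'
  set S := support (P ∪ Q) with hS
  have hPQc : (P ∪ Q).card ≤ 4 := (Finset.card_union_le _ _).trans (by omega)
  have hSc : S.card ≤ 4 * (qq k ℓ) := card_support_le hPQc
  set ρ := preLen k ℓ j with hρ
  have hρ' : ρ = (j - 1) * ℓ + (k - (qq k ℓ)) := by rw [hρ, preLen, if_neg (by omega)]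
  have hP'P : P' ⊆ P := by rcases hcase with h6 | h6 <;> simp [h6.2.1]
  have hzρ : (z - 1) * ℓ ≤ ρ ∧ ρ + 1 ≤ (qq k ℓ) ∧ (qq k ℓ) ≤ ρ + ℓ ∧ 1 ≤ ρ := by
    rcases hcase with ⟨h6, -, h7⟩ | ⟨h6, -, h7⟩
    · rw [hρ', h6]; omega
    · obtain ⟨i, rfl⟩ : ∃ i, j = i + 1 := ⟨j - 1, by omega⟩
      have h8 : z - 1 = i + 1 := by omega
      rw [h8, Nat.succ_mul] at h5
      rw [hρ', h8, Nat.succ_mul]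
      simp only [Nat.add_sub_cancel]
      omega
  have hiz : ∀ i < z, i * ℓ ≤ (z - 1) * ℓ := fun i hi => Nat.mul_le_mul_right _ (by omega)
  have hiz' : ∀ i < z, i + 1 < z → (i + 1) * ℓ ≤ (z - 1) * ℓ := fun i hi hi' =>
    Nat.mul_le_mul_right _ (by omega)
  set G := seg (qq k ℓ) ρ (qq k ℓ) with hG
  have hGc : G.card = (qq k ℓ) - ρ := card_seg le_rfl
  have hun : ∀ i < z, seg (qq k ℓ) (i * ℓ) ρ ∪ G = seg (qq k ℓ) (i * ℓ) (qq k ℓ) := fun i hi =>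
    seg_union (by have := hiz i hi; omega) (by omega)
  have hun0 : seg (qq k ℓ) 0 ρ ∪ G = seg (qq k ℓ) 0 (qq k ℓ) := seg_union (by omega) (by omega)
  have hdisj : Disjoint (seg (qq k ℓ) 0 ρ) G := seg_disjoint le_rfl
  have hdisji : ∀ i, Disjoint (seg (qq k ℓ) i ρ) G := fun i => seg_disjoint le_rfl
  have huniv : seg (qq k ℓ) 0 (qq k ℓ) = Finset.univ := by ext s; simp
  have hX : ∀ x ∈ prefixTuples H ℓ P S j, Set.InjOn x (seg (qq k ℓ) 0 ρ) ∧
      ∀ s ∈ seg (qq k ℓ) 0 ρ, ∀ v ∈ P ∪ Q, ∀ t, v t ≠ x s := by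
    intro x hx
    simp only [prefixTuples, Finset.mem_filter, Finset.mem_univ, true_and] at hx
    exact ⟨hx.1, fun s hs v hv t hvt => Finset.disjoint_left.1 hx.2.1
      (Finset.mem_image_of_mem x hs) (mem_support.2 ⟨v, hv, t, hvt⟩)⟩
  have hsub0 : ∀ i, seg (qq k ℓ) i ρ ⊆ seg (qq k ℓ) 0 ρ := fun i => seg_subset (Nat.zero_le _) le_rfl
  set fQ : (Fin (qq k ℓ) → V) → (Fin (qq k ℓ) → V) × ℕ → Finset V := fun x y =>
    (seg (qq k ℓ) (y.2 * ℓ) ρ).image x ∪ (seg (qq k ℓ) 0 (y.2 * ℓ + (k - (qq k ℓ)))).image y.1 with hfQ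
  set fP : (Fin (qq k ℓ) → V) → (Fin (qq k ℓ) → V) → Finset V := fun x v =>
    (seg (qq k ℓ) ((z - 1) * ℓ) (qq k ℓ)).image v ∪ (seg (qq k ℓ) 0 ρ).image x with hfP
  let z0 : Fin (qq k ℓ) := ⟨0, by omega⟩
  -- The first entry of a member of `Q` lies in all windows into it, whereas the sets `fP x v` use
  -- only entries of `v` from position `(z - 1) * ℓ ≥ 1` on. This separates the two kinds of sets
  -- even if `P` and `Q` have a common member.
  have hQ0 : ∀ x y, y.1 z0 ∈ fQ x y := fun x y =>
    Finset.mem_union_right _ (Finset.mem_image_of_mem _ (by simp only [mem_seg, z0]; omega))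
  have hQmem : ∀ x ∈ prefixTuples H ℓ P S j, ∀ y, y.1 ∈ Q → ∀ w ∈ P ∪ Q, ∀ t, w t ∈ fQ x y →
      w = y.1 ∧ (t : ℕ) < y.2 * ℓ + (k - (qq k ℓ)) := by
    intro x hx y hy w hw t ht
    rcases Finset.mem_union.1 ht with h6 | h6
    · obtain ⟨s, hs, hs'⟩ := Finset.mem_image.1 h6
      exact absurd hs'.symm ((hX x hx).2 s (hsub0 _ hs) w hw t)
    · obtain ⟨s, hs, hs'⟩ := Finset.mem_image.1 h6
      by_cases hwy : w = y.1
      · refine ⟨hwy, ?_⟩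
        rw [hwy] at hs'
        rw [← hd.inj y.1 (Finset.mem_union_right _ hy) hs']
        exact (mem_seg.1 hs).2
      · exact absurd hs'.symm (hd.disj w hw y.1 (Finset.mem_union_right _ hy) hwy _ _)
  have hPmem : ∀ x ∈ prefixTuples H ℓ P S j, ∀ v ∈ P', ∀ w ∈ P ∪ Q, ∀ t, w t ∈ fP x v →
      w = v ∧ (z - 1) * ℓ ≤ (t : ℕ) := by
    intro x hx v hv w hw t ht
    have hvP := Finset.mem_union_left Q (hP'P hv)
    rcases Finset.mem_union.1 ht with h6 | h6
    · obtain ⟨s, hs, hs'⟩ := Finset.mem_image.1 h6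
      by_cases hwy : w = v
      · refine ⟨hwy, ?_⟩
        rw [hwy] at hs'
        rw [← hd.inj v hvP hs']
        exact (mem_seg.1 hs).1
      · exact absurd hs'.symm (hd.disj w hw v hvP hwy _ _)
    · obtain ⟨s, hs, hs'⟩ := Finset.mem_image.1 h6
      exact absurd hs'.symm ((hX x hx).2 s hs w hw t)
  have hz1 : 1 ≤ (z - 1) * ℓ := by omega
  have := h.card_step G (prefixTuples H ℓ P S j) (arcTuples H ℓ P Q)
      (fun x => S ∪ (seg (qq k ℓ) 0 ρ).image x)
      (fun x => (Q ×ˢ Finset.range z).image (fQ x) ∪ P'.image (fP x))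
      (s := Q.card * z + P'.card)
      (fun x hx y => prefixTuples_piecewise hk h (by omega) hx y)
      (fun x y => by rw [image_piecewise_of_disjoint hdisj])
      (fun x y => by
        have e1 : fQ (G.piecewise y x) = fQ x := by
          funext u
          simp only [hfQ]
          rw [image_piecewise_of_disjoint (hdisji _)]
        have e2 : fP (G.piecewise y x) = fP x := by
          funext u
          simp only [hfP]
          rw [image_piecewise_of_disjoint (hdisji _)]
        rw [e1, e2])
      (fun x hx => by
        refine (Finset.card_union_le _ _).trans ?_
        have : ((seg (qq k ℓ) 0 ρ).image x).card ≤ (qq k ℓ) := Finset.card_image_le.trans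
          ((Finset.card_le_univ _).trans (by simp))
        omega) (by omega) (by
          have e1 := Nat.mul_le_mul_right z hQ
          have e2 := Finset.card_le_card hP'P
          omega) (by omega)
      (fun x hx => by
        rw [Finset.card_union_of_disjoint, Finset.card_image_of_injOn, Finset.card_image_of_injOn,
          Finset.card_product, Finset.card_range]
        · intro v hv w hw hvw
          have hlast : v ⟨(qq k ℓ) - 1, by omega⟩ ∈ fP x v :=
            Finset.mem_union_left _ (Finset.mem_image_of_mem _ (by simp only [mem_seg]; omega))
          rw [hvw] at hlast
          exact (hPmem x hx w hw v (Finset.mem_union_left _ (hP'P hv)) _ hlast).1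
        · rintro ⟨v, i⟩ hv ⟨w, i'⟩ hw hvw
          simp only [Finset.coe_product, Set.mem_prod, Finset.mem_coe, Finset.mem_range] at hv hw
          have e1 := hQ0 x (v, i)
          rw [hvw] at e1
          have e2 := (hQmem x hx (w, i') hw.1 v (Finset.mem_union_right _ hv.1) _ e1).1
          -- The entry of `v` just behind the `i`-th window belongs to every later window.
          have lt_of : ∀ i i', i' < z → i < i' → fQ x (v, i) ≠ fQ x (v, i') := by
            intro i i' hi'z hii' hne
            have e3 := Nat.mul_le_mul_right ℓ hii'
            have e4 := hiz i' hi'z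
            rw [Nat.succ_mul] at e3
            have e5 : v ⟨i * ℓ + (k - (qq k ℓ)), by omega⟩ ∈ fQ x (v, i') :=
              Finset.mem_union_right _ (Finset.mem_image_of_mem _ (by simp only [mem_seg]; omega))
            rw [← hne] at e5
            have e6 := (hQmem x hx (v, i) hv.1 v (Finset.mem_union_right _ hv.1) _ e5).2
            simp at e6
          simp only at e2
          subst e2
          rcases lt_trichotomy i i' with h6 | h6 | h6
          · exact absurd hvw (lt_of i i' hw.2 h6)
          · rw [h6]
          · exact absurd hvw.symm (lt_of i' i hv.2 h6)
        · rw [Finset.disjoint_left]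
          intro a ha ha'
          obtain ⟨y, hy, rfl⟩ := Finset.mem_image.1 ha
          obtain ⟨v, hv, hv'⟩ := Finset.mem_image.1 ha'
          have hy1 := (Finset.mem_product.1 hy).1
          have e1 := hQ0 x y
          rw [← hv'] at e1
          have := (hPmem x hx v hv y.1 (Finset.mem_union_right _ hy1) _ e1).2
          simp only [z0] at this
          omega)
      (fun x hx a ha => by
        rcases Finset.mem_union.1 ha with ha | ha
        · obtain ⟨y, hy, rfl⟩ := Finset.mem_image.1 ha
          have hy1 := Finset.mem_union_right P (Finset.mem_product.1 hy).1
          have hy2 := hiz _ (Finset.mem_range.1 (Finset.mem_product.1 hy).2)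
          simp only [hfQ]
          rw [Finset.card_union_of_disjoint, Finset.card_image_of_injective _ (hd.inj _ hy1),
            Finset.card_image_of_injOn ((hX x hx).1.mono (Finset.coe_subset.2 (hsub0 _))),
            card_seg (by omega), card_seg (by omega), hGc]
          · omega
          · rw [Finset.disjoint_left]
            intro u hu hu'
            obtain ⟨t, -, rfl⟩ := Finset.mem_image.1 hu'
            obtain ⟨s, hs, hs'⟩ := Finset.mem_image.1 hu
            exact (hX x hx).2 s (hsub0 _ hs) y.1 hy1 _ hs'.symm
        · obtain ⟨v, hv, rfl⟩ := Finset.mem_image.1 ha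
          have hvP := Finset.mem_union_left Q (hP'P hv)
          have hc2 : j + 1 = z ∧ k = (qq k ℓ) + ℓ := by
            rcases hcase with h6 | h6
            · rw [h6.2.1] at hv; simp at hv
            · exact ⟨h6.1, h6.2.2⟩
          simp only [hfP]
          rw [Finset.card_union_of_disjoint, Finset.card_image_of_injective _ (hd.inj _ hvP),
            Finset.card_image_of_injOn (hX x hx).1, card_seg le_rfl, card_seg (by omega), hGc]
          · have : ρ + ℓ = (qq k ℓ) := by
              obtain ⟨i, rfl⟩ : ∃ i, j = i + 1 := ⟨j - 1, by omega⟩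
              have h8 : z - 1 = i + 1 := by omega
              rw [h8, Nat.succ_mul] at h5
              rw [hρ']
              simp only [Nat.add_sub_cancel]
              omega
            omega
          · rw [Finset.disjoint_left]
            intro u hu hu'
            obtain ⟨t, -, rfl⟩ := Finset.mem_image.1 hu
            obtain ⟨s, hs, hs'⟩ := Finset.mem_image.1 hu'
            exact (hX x hx).2 s hs v hvP _ hs'.symm)
      (fun x hx => by
        have hsub : ((Q ×ˢ Finset.range z).image (fQ x) ∪ P'.image (fP x)).biUnion id ⊆
            (Q.biUnion fun w => (seg (qq k ℓ) 0 (k - ℓ)).image w) ∪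
              (P'.biUnion fun v => (seg (qq k ℓ) ((z - 1) * ℓ) (qq k ℓ)).image v) ∪ (seg (qq k ℓ) 0 ρ).image x := by
          intro u hu
          simp only [Finset.mem_biUnion, id] at hu
          obtain ⟨a, ha, hu⟩ := hu
          rcases Finset.mem_union.1 ha with ha | ha
          · obtain ⟨y, hy, rfl⟩ := Finset.mem_image.1 ha
            have hy2 := hiz _ (Finset.mem_range.1 (Finset.mem_product.1 hy).2)
            rcases Finset.mem_union.1 hu with h6 | h6
            · exact Finset.mem_union_right _ (Finset.image_subset_image (hsub0 _) h6)
            · refine Finset.mem_union_left _ (Finset.mem_union_left _ (Finset.mem_biUnion.2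
                ⟨y.1, (Finset.mem_product.1 hy).1, Finset.image_subset_image (seg_subset le_rfl ?_) h6⟩))
              omega
          · obtain ⟨v, hv, rfl⟩ := Finset.mem_image.1 ha
            rcases Finset.mem_union.1 hu with h6 | h6
            · exact Finset.mem_union_left _ (Finset.mem_union_right _ (Finset.mem_biUnion.2
                ⟨v, hv, h6⟩))
            · exact Finset.mem_union_right _ h6
        refine (Finset.card_le_card hsub).trans ((Finset.card_union_le _ _).trans ?_)
        have e1 : ((seg (qq k ℓ) 0 ρ).image x).card ≤ ρ := Finset.card_image_le.trans
          (by rw [card_seg (by omega)]; omega)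
        have e2 : (Q.biUnion fun w => (seg (qq k ℓ) 0 (k - ℓ)).image w).card ≤ 2 * (k - ℓ) := by
          refine (Finset.card_biUnion_le_card_mul _ _ (k - ℓ) fun w _ =>
            Finset.card_image_le.trans (by rw [card_seg (by omega)]; omega)).trans ?_
          exact Nat.mul_le_mul_right _ hQ
        have e3 : (P'.biUnion fun v => (seg (qq k ℓ) ((z - 1) * ℓ) (qq k ℓ)).image v).card ≤ P'.card * ℓ :=
          Finset.card_biUnion_le_card_mul _ _ ℓ fun w _ =>
            Finset.card_image_le.trans (by rw [card_seg (by omega)]; omega)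
        have e4 := Finset.card_union_le (Q.biUnion fun w => (seg (qq k ℓ) 0 (k - ℓ)).image w)
              (P'.biUnion fun v => (seg (qq k ℓ) ((z - 1) * ℓ) (qq k ℓ)).image v)
        rcases hcase with h6 | h6
        · rw [h6.2.1] at e3 e4 ⊢
          simp only [Finset.card_empty, Nat.zero_mul] at e3
          omega
        · have : ρ + ℓ = (qq k ℓ) := by
            obtain ⟨i, rfl⟩ : ∃ i, j = i + 1 := ⟨j - 1, by omega⟩
            have h8 : z - 1 = i + 1 := by omega
            rw [h8, Nat.succ_mul] at h5
            rw [hρ']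
            simp only [Nat.add_sub_cancel]
            omega
          have e5 : P'.card * ℓ ≤ 2 * ℓ := Nat.mul_le_mul_right _ (by rw [h6.2.1]; exact hP)
          omega)
      (fun x => by
        simp only [arcTuples, prefixTuples, Finset.mem_filter, Finset.mem_univ, true_and]
        have e1 : Function.Injective x ↔ Set.InjOn x (seg (qq k ℓ) 0 ρ) ∧ Set.InjOn x G ∧
            Disjoint (G.image x) ((seg (qq k ℓ) 0 ρ).image x) := by
          rw [← injOn_union_iff hdisj, hun0, huniv, Finset.coe_univ, Set.injOn_univ]
        have e2 : (∀ v ∈ P ∪ Q, ∀ s t, x s ≠ v t) ↔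
            Disjoint ((seg (qq k ℓ) 0 ρ).image x) S ∧ Disjoint (G.image x) S := by
          rw [← Finset.disjoint_union_left, ← Finset.image_union, hun0, huniv, Finset.disjoint_left]
          constructor
          · intro h6 u hu hu'
            obtain ⟨s, -, rfl⟩ := Finset.mem_image.1 hu
            obtain ⟨v, hv, t, ht⟩ := mem_support.1 hu'
            exact h6 v hv s t ht.symm
          · intro h6 v hv s t hst
            exact h6 (Finset.mem_image_of_mem x (Finset.mem_univ s))
              (mem_support.2 ⟨v, hv, t, hst.symm⟩)
        have e3 : (∀ v ∈ P, Precedes H ℓ v x) ↔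
            (∀ v ∈ P, ∀ i < j, ownedEdge k ℓ v x i ∈ H.edges) ∧
            ∀ a ∈ P'.image (fP x), a ∪ G.image x ∈ H.edges := by
          rcases hcase with h6 | h6
          · rw [h6.2.1]
            simp only [Finset.image_empty, Finset.notMem_empty, false_imp_iff, implies_true,
              and_true]
            rw [h6.1]
            rfl
          · have e4 : ∀ v, ownedEdge k ℓ v x j = fP x v ∪ G.image x := fun v => by
              have e6 : z - 1 = j := by omega
              have e5 : j * ℓ + (k - qq k ℓ) = (qq k ℓ) := by rw [← e6]; omega
              rw [ownedEdge_eq h.l_pos hk (by omega), e5]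
              simp only [hfP, e6]
              rw [Finset.union_assoc, ← Finset.image_union, hun0]
            rw [h6.2.1]
            constructor
            · intro h7
              refine ⟨fun v hv i hi => h7 v hv i (by omega), fun a ha => ?_⟩
              obtain ⟨v, hv, rfl⟩ := Finset.mem_image.1 ha
              rw [← e4]
              exact h7 v hv j (by omega)
            · rintro ⟨h7, h8⟩ v hv i hi
              rcases Nat.lt_succ_iff_lt_or_eq.1 (show i < j + 1 by omega) with h9 | rfl
              · exact h7 v hv i h9
              · rw [e4]
                exact h8 _ (Finset.mem_image_of_mem _ hv)
        have e5 : (∀ w ∈ Q, Precedes H ℓ x w) ↔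
            ∀ a ∈ (Q ×ˢ Finset.range z).image (fQ x), a ∪ G.image x ∈ H.edges := by
          have e4 : ∀ w, ∀ i < z, ownedEdge k ℓ x w i = fQ x (w, i) ∪ G.image x := fun w i hi => by
            rw [ownedEdge_eq h.l_pos hk hi]
            simp only [hfQ]
            rw [Finset.union_right_comm, ← Finset.image_union, hun i hi]
          constructor
          · intro h7 a ha
            obtain ⟨⟨w, i⟩, hy, rfl⟩ := Finset.mem_image.1 ha
            rw [Finset.mem_product, Finset.mem_range] at hy
            rw [← e4 w i hy.2]
            exact h7 w hy.1 i hy.2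
          · intro h7 w hw i hi
            rw [e4 w i hi]
            exact h7 _ (Finset.mem_image_of_mem _ (Finset.mem_product.2
              ⟨hw, Finset.mem_range.2 hi⟩))
        rw [e1, e2, e3, e5, Finset.disjoint_union_right]
        simp only [Finset.mem_union, or_imp, forall_and]
        tauto)
  exact this

/-- There are `z` prefix steps and a final one, or `z - 1` and a final one if `k = q + ℓ`; the
exponent `z + 1` covers both cases. -/
theorem card_arcTuples (hk : 2 * ℓ < k) (h : LargeRegular H ℓ ε p θ)
    {P Q : Finset (Fin (qq k ℓ) → V)} (hP : P.card ≤ 2) (hQ : Q.card ≤ 2)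
    (hd : DisjointTuples (P ∪ Q)) :
    WithinPow (11 / 10 * ε) (zz k ℓ + 1) ((arcTuples H ℓ P Q).card : ℝ)
      ((Fintype.card V : ℝ) ^ qq k ℓ * p ^ (zz k ℓ * (P.card + Q.card))) := by
  obtain ⟨hz, h1, h2, h3, h4, h5⟩ := params_facts h.l_pos hk
  have hPQc : (P ∪ Q).card ≤ 4 := (Finset.card_union_le _ _).trans (by omega)
  have hPd : DisjointTuples P := ⟨fun v hv => hd.inj v (Finset.mem_union_left _ hv),
    fun v hv w hw => hd.disj v (Finset.mem_union_left _ hv) w (Finset.mem_union_left _ hw)⟩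
  have hPS : support P ⊆ support (P ∪ Q) :=
    Finset.biUnion_subset_biUnion_of_subset_left _ Finset.subset_union_left
  have he0 := h.eps_pos
  have he1 := h.eps_le
  have hp := h.p_pos
  rcases Nat.lt_or_ge k (qq k ℓ + ℓ) with hc | hc
  · have e1 := card_prefixTuples hk h hP (card_support_le hPQc) hPS hPd le_rfl
    have e2 := card_final hk h (P' := ∅) hP hQ hd (j := zz k ℓ) (by omega) (Or.inl ⟨rfl, rfl, hc⟩)
    have := e1.step (by linarith) (by linarith) (by positivity) e2
    convert this using 1
    rw [Finset.card_empty, mul_left_comm, ← pow_add]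
    congr 2
    ring
  · have e1 := card_prefixTuples hk h hP (card_support_le hPQc) hPS hPd
      (show zz k ℓ - 1 ≤ zz k ℓ by omega)
    have e2 := card_final hk h (P' := P) hP hQ hd (j := zz k ℓ - 1) (by omega)
      (Or.inr ⟨by omega, rfl, by omega⟩)
    have := (e1.step (by linarith) (by linarith) (by positivity) e2).mono (by linarith)
      (by linarith) (show zz k ℓ - 1 + 1 ≤ zz k ℓ + 1 by omega) (by positivity)
    convert this using 1
    rw [mul_left_comm, ← pow_add]
    congr 2
    obtain ⟨z, hz⟩ : ∃ z, zz k ℓ = z + 1 := ⟨zz k ℓ - 1, by omega⟩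
    rw [hz]
    simp only [Nat.add_sub_cancel]
    ring

end arcs

/-! ### Counting the tuples which own a given edge. -/

section windows

variable {V : Type} [Fintype V] [DecidableEq V] {k : ℕ}

open Classical in
/-- The `2q`-tuples whose windows `i₀, …, i₁` are edges, the `j`-th one being `e`. -/
noncomputable def windowTuples (H : KGraph V k) (ℓ : ℕ) (e : Finset V) (j i₀ i₁ : ℕ) :
    Finset (Fin (qq k ℓ + qq k ℓ) → V) :=
  Finset.univ.filter fun u =>
    Set.InjOn u (seg (qq k ℓ + qq k ℓ) (i₀ * ℓ) (i₁ * ℓ + k)) ∧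
    (seg (qq k ℓ + qq k ℓ) (j * ℓ) (j * ℓ + k)).image u = e ∧
    ∀ i, i₀ ≤ i → i ≤ i₁ → (seg (qq k ℓ + qq k ℓ) (i * ℓ) (i * ℓ + k)).image u ∈ H.edges

open Classical in
/-- The injective `2q`-tuples all of whose windows are edges, the `j`-th one being `e`. -/
noncomputable def owningTuples (H : KGraph V k) (ℓ : ℕ) (e : Finset V) (j : ℕ) :
    Finset (Fin (qq k ℓ + qq k ℓ) → V) :=
  Finset.univ.filter fun u =>
    Function.Injective u ∧ (seg (qq k ℓ + qq k ℓ) (j * ℓ) (j * ℓ + k)).image u = e ∧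
    ∀ i < zz k ℓ, (seg (qq k ℓ + qq k ℓ) (i * ℓ) (i * ℓ + k)).image u ∈ H.edges

variable {H : KGraph V k} {ℓ : ℕ} {ε p θ : ℝ}

theorem windowTuples_piecewise {e : Finset V} {j i₀ i₁ : ℕ} (hj : i₀ ≤ j) (hj' : j ≤ i₁)
    {G : Finset (Fin (qq k ℓ + qq k ℓ))}
    (hG : Disjoint (seg (qq k ℓ + qq k ℓ) (i₀ * ℓ) (i₁ * ℓ + k)) G)
    {x : Fin (qq k ℓ + qq k ℓ) → V} (hx : x ∈ windowTuples H ℓ e j i₀ i₁)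
    (y : Fin (qq k ℓ + qq k ℓ) → V) : G.piecewise y x ∈ windowTuples H ℓ e j i₀ i₁ := by
  have hsub : ∀ i, i₀ ≤ i → i ≤ i₁ →
      Disjoint (seg (qq k ℓ + qq k ℓ) (i * ℓ) (i * ℓ + k)) G := fun i h1 h2 =>
    Finset.disjoint_of_subset_left (seg_subset (Nat.mul_le_mul_right _ h1)
      (Nat.add_le_add_right (Nat.mul_le_mul_right _ h2) _)) hG
  simp only [windowTuples, Finset.mem_filter, Finset.mem_univ, true_and] at hx ⊢
  rw [injOn_piecewise_of_disjoint hG, image_piecewise_of_disjoint (hsub j hj hj')]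
  refine ⟨hx.1, hx.2.1, fun i h1 h2 => ?_⟩
  rw [image_piecewise_of_disjoint (hsub i h1 h2)]
  exact hx.2.2 i h1 h2

/-- A further window on either side needs `ℓ` new positions, and its other `k - ℓ` positions are
already filled; so this is a regularity step with a single set and `d = ℓ`. -/
theorem card_windowTuples_step (hk : 2 * ℓ < k) (h : LargeRegular H ℓ ε p θ) {e : Finset V}
    {j i₀ i₁ i₀' i₁' : ℕ} (hj : i₀ ≤ j) (hj' : j ≤ i₁) (hi₁ : i₁' < zz k ℓ)
    (hcase : (i₀' = i₀ ∧ i₁' = i₁ + 1) ∨ (i₀ = i₀' + 1 ∧ i₁' = i₁)) :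
    Within (11 / 10 * ε) ((windowTuples H ℓ e j i₀' i₁').card : ℝ)
      (p ^ 1 * (windowTuples H ℓ e j i₀ i₁).card) := by
  obtain ⟨hz, h1, h2, h3, h4, h5⟩ := params_facts h.l_pos hk
  have hl := h.l_pos
  have hi : i₁' * ℓ ≤ (zz k ℓ - 1) * ℓ := Nat.mul_le_mul_right _ (by omega)
  have hii : i₀ * ℓ ≤ i₁ * ℓ := Nat.mul_le_mul_right _ (by omega)
  obtain ⟨a, b, inew, hG, hA, hnew, hab, hlen⟩ : ∃ a b inew,
      Disjoint (seg (qq k ℓ + qq k ℓ) (i₀ * ℓ) (i₁ * ℓ + k)) (seg (qq k ℓ + qq k ℓ) a b) ∧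
      seg (qq k ℓ + qq k ℓ) (i₀ * ℓ) (i₁ * ℓ + k) ∪ seg (qq k ℓ + qq k ℓ) a b =
        seg (qq k ℓ + qq k ℓ) (i₀' * ℓ) (i₁' * ℓ + k) ∧
      (∀ i, (i₀' ≤ i ∧ i ≤ i₁') ↔ ((i₀ ≤ i ∧ i ≤ i₁) ∨ i = inew)) ∧
      b = a + ℓ ∧ b ≤ qq k ℓ + qq k ℓ ∧
      ∃ c d, seg (qq k ℓ + qq k ℓ) (inew * ℓ) (inew * ℓ + k) =
        seg (qq k ℓ + qq k ℓ) c d ∪ seg (qq k ℓ + qq k ℓ) a b ∧ d = c + (k - ℓ) ∧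
        d ≤ qq k ℓ + qq k ℓ ∧ i₀ * ℓ ≤ c ∧ d ≤ i₁ * ℓ + k := by
    rcases hcase with ⟨rfl, rfl⟩ | ⟨rfl, rfl⟩
    · rw [Nat.succ_mul] at hi
      refine ⟨i₁ * ℓ + k, i₁ * ℓ + k + ℓ, i₁ + 1, seg_disjoint le_rfl, ?_, fun i => by omega, rfl,
        by omega, (i₁ + 1) * ℓ, i₁ * ℓ + k, ?_, ?_, by omega, ?_, le_rfl⟩
      · rw [seg_union (by omega) (by omega), Nat.succ_mul]
        congr 1; omega
      · rw [Nat.succ_mul, seg_union (by omega) (by omega)]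
        congr 1; omega
      · rw [Nat.succ_mul]; omega
      · rw [Nat.succ_mul]; omega
    · rw [Nat.succ_mul] at hii
      refine ⟨i₀' * ℓ, i₀' * ℓ + ℓ, i₀', (seg_disjoint (by rw [Nat.succ_mul])).symm, ?_,
        fun i => by omega, rfl, by omega, (i₀' + 1) * ℓ, i₀' * ℓ + k, ?_, ?_, by omega, le_rfl,
        by omega⟩
      · rw [Finset.union_comm, Nat.succ_mul, seg_union (by omega) (by omega)]
      · rw [Finset.union_comm, Nat.succ_mul, seg_union (by omega) (by omega)]
      · rw [Nat.succ_mul]; omega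
  obtain ⟨hb, c, d, hcd, hdc, hdq, hc, hd⟩ := hlen
  set G := seg (qq k ℓ + qq k ℓ) a b with hGdef
  have hGc : G.card = ℓ := by rw [hGdef, card_seg hb]; omega
  have hGcd : Disjoint (seg (qq k ℓ + qq k ℓ) c d) G :=
    Finset.disjoint_of_subset_left (seg_subset hc hd) hG
  refine h.card_step G (windowTuples H ℓ e j i₀ i₁) _
    (fun x => (seg (qq k ℓ + qq k ℓ) (i₀ * ℓ) (i₁ * ℓ + k)).image x)
    (fun x => {(seg (qq k ℓ + qq k ℓ) c d).image x})
    (fun x hx y => windowTuples_piecewise hj hj' hG hx y)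
    (fun x y => by rw [image_piecewise_of_disjoint hG])
    (fun x y => by rw [image_piecewise_of_disjoint hGcd])
    (fun x _ => ?_) (by omega) (by omega) (Or.inr (by omega)) (fun x _ => rfl)
    (fun x hx a ha => ?_) (fun x _ => ?_) (fun x => ?_)
  · refine Finset.card_image_le.trans ((Finset.card_le_univ _).trans ?_)
    rw [Fintype.card_fin]; omega
  · rw [Finset.mem_singleton.1 ha, Finset.card_image_of_injOn, card_seg hdq]
    · omega
    · simp only [windowTuples, Finset.mem_filter, Finset.mem_univ, true_and] at hx
      exact hx.1.mono (Finset.coe_subset.2 (seg_subset hc hd))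
  · rw [Finset.singleton_biUnion]
    refine Finset.card_image_le.trans ((Finset.card_le_univ _).trans ?_)
    rw [Fintype.card_fin]; omega
  · simp only [windowTuples, Finset.mem_filter, Finset.mem_univ, true_and]
    rw [← hA, injOn_union_iff hG]
    have e1 : (∀ i, i₀' ≤ i → i ≤ i₁' →
        (seg (qq k ℓ + qq k ℓ) (i * ℓ) (i * ℓ + k)).image x ∈ H.edges) ↔
        (∀ i, i₀ ≤ i → i ≤ i₁ →
        (seg (qq k ℓ + qq k ℓ) (i * ℓ) (i * ℓ + k)).image x ∈ H.edges) ∧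
        ∀ a ∈ ({(seg (qq k ℓ + qq k ℓ) c d).image x} : Finset (Finset V)),
          a ∪ G.image x ∈ H.edges := by
      rw [show (∀ a ∈ ({(seg (qq k ℓ + qq k ℓ) c d).image x} : Finset (Finset V)),
          a ∪ G.image x ∈ H.edges) ↔
          (seg (qq k ℓ + qq k ℓ) (inew * ℓ) (inew * ℓ + k)).image x ∈ H.edges by
        rw [hcd, Finset.image_union]; simp]
      constructor
      · intro h6
        refine ⟨fun i h7 h8 => ?_, ?_⟩
        · have := (hnew i).2 (Or.inl ⟨h7, h8⟩)
          exact h6 i this.1 this.2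
        · have := (hnew inew).2 (Or.inr rfl)
          exact h6 _ this.1 this.2
      · rintro ⟨h6, h7⟩ i h8 h9
        rcases (hnew i).1 ⟨h8, h9⟩ with h10 | rfl
        · exact h6 i h10.1 h10.2
        · exact h7
    rw [e1]
    tauto

theorem card_windowTuples_base (hk : 2 * ℓ < k) (h : LargeRegular H ℓ ε p θ) {e : Finset V}
    (he : e ∈ H.edges) {j : ℕ} (hj : j < zz k ℓ) :
    (windowTuples H ℓ e j j j).card =
      k.factorial * Fintype.card V ^ (qq k ℓ + qq k ℓ - k) := by
  classical
  obtain ⟨hz, h1, h2, h3, h4, h5⟩ := params_facts h.l_pos hk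
  have hjl : j * ℓ ≤ (zz k ℓ - 1) * ℓ := Nat.mul_le_mul_right _ (by omega)
  have hc : (seg (qq k ℓ + qq k ℓ) (j * ℓ) (j * ℓ + k)).card = k := by
    rw [card_seg (by omega)]; omega
  have := card_injOn_image_eq (seg (qq k ℓ + qq k ℓ) (j * ℓ) (j * ℓ + k)) e
    (by rw [hc, H.uniform e he])
  rw [hc, Fintype.card_fin] at this
  rw [← this]
  congr 1
  ext u
  simp only [windowTuples, Finset.mem_filter, Finset.mem_univ, true_and]
  constructor
  · exact fun h6 => ⟨h6.1, h6.2.1⟩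
  · rintro ⟨h6, h7⟩
    refine ⟨h6, h7, fun i h8 h9 => ?_⟩
    obtain rfl : i = j := by omega
    rw [h7]
    exact he

/-- The window `j` receives `e` in one of `k!` orders. The windows to its right and then those to
its left are added one at a time, `z - 1` in all, and a last step makes the remaining entries
distinct from the rest. -/
theorem card_owningTuples (hk : 2 * ℓ < k) (h : LargeRegular H ℓ ε p θ) {e : Finset V}
    (he : e ∈ H.edges) {j : ℕ} (hj : j < zz k ℓ) :
    WithinPow (11 / 10 * ε) (zz k ℓ) ((owningTuples H ℓ e j).card : ℝ)
      (k.factorial * (Fintype.card V : ℝ) ^ (qq k ℓ + qq k ℓ - k) * p ^ (zz k ℓ - 1)) := by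
  classical
  obtain ⟨hz, h1, h2, h3, h4, h5⟩ := params_facts h.l_pos hk
  have he0 := h.eps_pos
  have he1 := h.eps_le
  have hp := h.p_pos
  set C : ℝ := k.factorial * (Fintype.card V : ℝ) ^ (qq k ℓ + qq k ℓ - k) with hC
  have right : ∀ m, j + m < zz k ℓ → WithinPow (11 / 10 * ε) m
      ((windowTuples H ℓ e j j (j + m)).card : ℝ) (p ^ m * C) := by
    intro m
    induction m with
    | zero =>
      intro _
      have := card_windowTuples_base hk h he hj
      simp only [Nat.add_zero, pow_zero, one_mul, this, hC]
      push_cast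
      exact WithinPow.zero _ _
    | succ m ih =>
      intro hm
      have := (ih (by omega)).step (by linarith) (by linarith) (by positivity)
        (card_windowTuples_step hk h (e := e) le_rfl (Nat.le_add_right j m) hm
          (Or.inl ⟨rfl, by omega⟩))
      convert this using 1
      ring
  have left : ∀ m, m ≤ j → WithinPow (11 / 10 * ε) (zz k ℓ - 1 - j + m)
      ((windowTuples H ℓ e j (j - m) (zz k ℓ - 1)).card : ℝ) (p ^ (zz k ℓ - 1 - j + m) * C) := by
    intro m
    induction m with
    | zero =>
      intro _
      have := right (zz k ℓ - 1 - j) (by omega)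
      rw [show j + (zz k ℓ - 1 - j) = zz k ℓ - 1 by omega] at this
      exact this
    | succ m ih =>
      intro hm
      have := (ih (by omega)).step (by linarith) (by linarith) (by positivity)
        (card_windowTuples_step hk h (e := e) (i₀' := j - (m + 1)) (i₁' := zz k ℓ - 1)
          (show j - m ≤ j by omega) (by omega) (by omega)
          (Or.inr ⟨by omega, rfl⟩))
      rw [← Nat.add_assoc, pow_succ, mul_comm (p ^ _) p, mul_assoc]
      rwa [pow_one] at this
  have full := left j le_rfl
  rw [show zz k ℓ - 1 - j + j = zz k ℓ - 1 by omega, Nat.sub_self] at full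
  set G := seg (qq k ℓ + qq k ℓ) ((zz k ℓ - 1) * ℓ + k) (qq k ℓ + qq k ℓ) with hG
  have hd : Disjoint (seg (qq k ℓ + qq k ℓ) (0 * ℓ) ((zz k ℓ - 1) * ℓ + k)) G :=
    seg_disjoint le_rfl
  have hun : seg (qq k ℓ + qq k ℓ) (0 * ℓ) ((zz k ℓ - 1) * ℓ + k) ∪ G = Finset.univ := by
    rw [seg_union (by omega) (by omega)]
    ext s
    simp only [mem_seg, Finset.mem_univ, iff_true]
    omega
  -- No edge is imposed in this step, and `G` is empty if `k = q + ℓ`; hence the alternative `s = 0`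
  -- in `card_step`.
  have last := h.card_step G (windowTuples H ℓ e j 0 (zz k ℓ - 1)) (owningTuples H ℓ e j)
    (fun x => (seg (qq k ℓ + qq k ℓ) (0 * ℓ) ((zz k ℓ - 1) * ℓ + k)).image x)
    (fun x => ∅) (s := 0)
    (fun x hx y => windowTuples_piecewise (by omega) (by omega) hd hx y)
    (fun x y => by rw [image_piecewise_of_disjoint hd])
    (fun x y => rfl)
    (fun x _ => by
      refine Finset.card_image_le.trans ((Finset.card_le_univ _).trans ?_)
      rw [Fintype.card_fin]; omega)
    (by rw [hG, card_seg le_rfl]; omega) (by omega) (Or.inl rfl) (fun x _ => rfl)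
    (fun x hx a ha => by simp at ha) (fun x _ => by simp) (fun x => by
      simp only [windowTuples, owningTuples, Finset.mem_filter, Finset.mem_univ, true_and]
      rw [show Function.Injective x ↔ _ from by
        rw [← Set.injOn_univ, ← Finset.coe_univ, ← hun, injOn_union_iff hd]]
      have e1 : (∀ i < zz k ℓ, (seg (qq k ℓ + qq k ℓ) (i * ℓ) (i * ℓ + k)).image x ∈ H.edges) ↔
          (∀ i, 0 ≤ i → i ≤ zz k ℓ - 1 →
            (seg (qq k ℓ + qq k ℓ) (i * ℓ) (i * ℓ + k)).image x ∈ H.edges) :=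
        ⟨fun h6 i _ h7 => h6 i (by omega), fun h6 i h7 => h6 i (by omega) (by omega)⟩
      rw [e1]
      simp only [Finset.notMem_empty, false_imp_iff, implies_true, and_true]
      tauto)
  have := full.step (by linarith) (by linarith) (by positivity) last
  rw [show zz k ℓ - 1 + 1 = zz k ℓ by omega] at this
  convert this using 1
  ring

end windows

/-! ### Restrictions of a random permutation to fixed positions. -/

section random_perm

theorem exists_perm_comp {κ V : Type} [Fintype V] {u u' : κ → V} (hu : Function.Injective u)
    (hu' : Function.Injective u') : ∃ τ : Equiv.Perm V, ∀ a, τ (u a) = u' a := by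
  classical
  let e : {x // x ∈ Set.range u} ≃ {x // x ∈ Set.range u'} :=
    (Equiv.ofInjective u hu).symm.trans (Equiv.ofInjective u' hu')
  refine ⟨e.extendSubtype, fun a => ?_⟩
  rw [Equiv.extendSubtype_apply_of_mem e (u a) ⟨a, rfl⟩]
  change ((Equiv.ofInjective u' hu') ((Equiv.ofInjective u hu).symm (Equiv.ofInjective u hu a)) : V) = _
  rw [Equiv.symm_apply_apply]
  rfl

variable {n : ℕ} {κ : Type} [Fintype κ]

/-- Left multiplication by a permutation carrying one injective tuple to another shows that the
number does not depend on `u`; summing over all injective tuples gives `n!`. -/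
theorem card_perm_comp_eq (ι : κ → Fin n) (hι : Function.Injective ι) (u : κ → Fin n)
    (hu : Function.Injective u) :
    (Finset.univ.filter fun σ : Equiv.Perm (Fin n) => ∀ a, σ (ι a) = u a).card *
      n.descFactorial (Fintype.card κ) = n.factorial := by
  classical
  have hconst : ∀ u' : κ ↪ Fin n,
      (Finset.univ.filter fun σ : Equiv.Perm (Fin n) => ∀ a, σ (ι a) = u' a).card =
      (Finset.univ.filter fun σ : Equiv.Perm (Fin n) => ∀ a, σ (ι a) = u a).card := by
    intro u'
    obtain ⟨τ, hτ⟩ := exists_perm_comp u'.injective hu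
    refine Finset.card_bij' (fun σ _ => τ * σ) (fun σ _ => τ⁻¹ * σ) ?_ ?_ ?_ ?_
    · intro σ hσ
      simp only [Finset.mem_filter, Finset.mem_univ, true_and] at hσ ⊢
      intro a
      rw [Equiv.Perm.mul_apply, hσ a, hτ]
    · intro σ hσ
      simp only [Finset.mem_filter, Finset.mem_univ, true_and] at hσ ⊢
      intro a
      rw [Equiv.Perm.mul_apply, hσ a, ← hτ]
      exact τ.symm_apply_apply _
    · intro σ _; simp
    · intro σ _; simp
  have hsum : ∑ u' : κ ↪ Fin n,
      (Finset.univ.filter fun σ : Equiv.Perm (Fin n) => ∀ a, σ (ι a) = u' a).card =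
      Fintype.card (Equiv.Perm (Fin n)) := by
    rw [← Finset.card_univ, Finset.card_eq_sum_card_fiberwise
      (f := fun σ : Equiv.Perm (Fin n) => (⟨fun a => σ (ι a), σ.injective.comp hι⟩ : κ ↪ Fin n))
      (t := Finset.univ) (by simp [Set.MapsTo])]
    refine Finset.sum_congr rfl fun u' _ => ?_
    congr 1
    ext σ
    simp only [Finset.mem_filter, Finset.mem_univ, true_and]
    constructor
    · intro h; ext a; simp [h a]
    · intro h a; rw [← h]; rfl
  rw [Finset.sum_congr rfl fun u' _ => hconst u', Finset.sum_const, Finset.card_univ,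
    Fintype.card_embedding_eq, Fintype.card_perm, Fintype.card_fin, smul_eq_mul] at hsum
  rw [mul_comm]
  exact hsum

theorem Pr_perm_comp (ι : κ → Fin n) (hι : Function.Injective ι) (W : Finset (κ → Fin n))
    (hW : ∀ u ∈ W, Function.Injective u) :
    Pr (unif (Equiv.Perm (Fin n))) (fun σ => (fun a => σ (ι a)) ∈ W) =
      W.card / (n.descFactorial (Fintype.card κ) : ℝ) := by
  classical
  have hD : 0 < n.descFactorial (Fintype.card κ) := by
    rw [Nat.descFactorial_pos]
    simpa using Fintype.card_le_of_injective ι hι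
  have hf : ∀ u ∈ W, Pr (unif (Equiv.Perm (Fin n))) (fun σ => (fun a => σ (ι a)) = u) =
      1 / (n.descFactorial (Fintype.card κ) : ℝ) := by
    intro u hu
    have h1 := card_perm_comp_eq ι hι u (hW u hu)
    have h2 : Pr (unif (Equiv.Perm (Fin n))) (fun σ => (fun a => σ (ι a)) = u) =
        ((Finset.univ.filter fun σ : Equiv.Perm (Fin n) => ∀ a, σ (ι a) = u a).card : ℝ) *
          (n.factorial : ℝ)⁻¹ := by
      unfold Pr unif
      rw [Finset.card_filter, Nat.cast_sum, Finset.sum_mul, Fintype.card_perm, Fintype.card_fin]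
      refine Finset.sum_congr rfl fun σ _ => ?_
      by_cases h : ∀ a, σ (ι a) = u a <;> simp [funext_iff, h]
    rw [h2, ← h1]
    push_cast
    have h3 : ((Finset.univ.filter fun σ : Equiv.Perm (Fin n) => ∀ a, σ (ι a) = u a).card : ℝ) ≠ 0 := by
      intro h0
      have : (n.factorial : ℝ) = 0 := by rw [← h1]; push_cast; rw [h0, zero_mul]
      exact n.factorial_ne_zero (by exact_mod_cast this)
    have h4 : (n.descFactorial (Fintype.card κ) : ℝ) ≠ 0 := by exact_mod_cast hD.ne'
    field_simp
  have := Pr_exists_eq (μ := unif (Equiv.Perm (Fin n))) W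
    (fun u σ => (fun a => σ (ι a)) = u) (fun σ u _ u' _ h h' => h.symm.trans h')
  rw [Finset.sum_congr rfl hf, Finset.sum_const, nsmul_eq_mul, mul_one_div] at this
  rw [← this]
  exact Pr_congr fun σ => by simp

end random_perm

/-! ### Blocks of a random permutation and the edges owned by its digraph. -/

section blocks

variable {n : ℕ}

/-- The block of the identity is the tuple of positions; separating it from `σ` gives the shape
required by `Pr_perm_comp`. -/
theorem block_apply (q : ℕ) (σ : Equiv.Perm (Fin n)) (a : Fin (n / q)) (j : Fin q) :
    block q σ a j = σ (block q 1 a j) := rfl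

theorem block_injective2 {q : ℕ} (σ : Equiv.Perm (Fin n)) {a b : Fin (n / q)} {i j : Fin q}
    (h : block q σ a i = block q σ b j) : a = b ∧ i = j := by
  have h1 := Fin.ext_iff.1 (σ.injective h)
  simp only at h1
  have hi := i.2
  have hj := j.2
  have hab : (a : ℕ) = b := by
    have e1 : ((a : ℕ) * q + i) / q = a := by
      rw [mul_comm, Nat.mul_add_div (by omega), Nat.div_eq_of_lt hi, add_zero]
    have e2 : ((b : ℕ) * q + j) / q = b := by
      rw [mul_comm, Nat.mul_add_div (by omega), Nat.div_eq_of_lt hj, add_zero]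
    rw [← e1, ← e2, h1]
  refine ⟨Fin.ext hab, Fin.ext ?_⟩
  rw [hab] at h1
  omega

theorem block_injective {q : ℕ} (σ : Equiv.Perm (Fin n)) (a : Fin (n / q)) :
    Function.Injective (block q σ a) := fun _ _ h => (block_injective2 σ h).2

open Classical in
-- Left multiplication by a transposition exchanges two values, so only the at most two blocks
-- containing them change.
theorem card_blocks_swap_le {q : ℕ} (W : Finset (Fin q → Fin n)) (c d : Fin n)
    (σ : Equiv.Perm (Fin n)) :
    (Finset.univ.filter fun x => block q (Equiv.swap c d * σ) x ∈ W).card ≤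
      (Finset.univ.filter fun x => block q σ x ∈ W).card + 2 := by
  have hone : ∀ c : Fin n, (Finset.univ.filter fun x => ∃ j, block q σ x j = c).card ≤ 1 := by
    intro c
    rw [Finset.card_le_one]
    intro x hx y hy
    simp only [Finset.mem_filter, Finset.mem_univ, true_and] at hx hy
    obtain ⟨i, hi⟩ := hx
    obtain ⟨j, hj⟩ := hy
    exact (block_injective2 σ (hi.trans hj.symm)).1
  have hsub : (Finset.univ.filter fun x => block q (Equiv.swap c d * σ) x ∈ W) ⊆
      (Finset.univ.filter fun x => block q σ x ∈ W) ∪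
      ((Finset.univ.filter fun x => ∃ j, block q σ x j = c) ∪
        (Finset.univ.filter fun x => ∃ j, block q σ x j = d)) := by
    intro x hx
    simp only [Finset.mem_union, Finset.mem_filter, Finset.mem_univ, true_and] at hx ⊢
    by_cases hc : ∃ j, block q σ x j = c
    · exact Or.inr (Or.inl hc)
    by_cases hd : ∃ j, block q σ x j = d
    · exact Or.inr (Or.inr hd)
    left
    have : block q (Equiv.swap c d * σ) x = block q σ x := by
      funext j
      rw [block_apply, Equiv.Perm.mul_apply, ← block_apply]
      exact Equiv.swap_apply_of_ne_of_ne (fun h => hc ⟨j, h⟩) (fun h => hd ⟨j, h⟩)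
    rwa [← this]
  refine (Finset.card_le_card hsub).trans ((Finset.card_union_le _ _).trans ?_)
  have := Finset.card_union_le (Finset.univ.filter fun x => ∃ j, block q σ x j = c)
        (Finset.univ.filter fun x => ∃ j, block q σ x j = d)
  have h1 := hone c
  have h2 := hone d
  omega

open Classical in
/-- The number of blocks of a random permutation in a given set of tuples is concentrated. -/
theorem blocks_concentration {q : ℕ} (hn : 0 < n) (W : Finset (Fin q → Fin n))
    (hW : ∀ u ∈ W, Function.Injective u) {t : ℝ} (ht : 0 ≤ t) :
    Pr (unif (Equiv.Perm (Fin n))) (fun σ =>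
      t ≤ |((Finset.univ.filter fun x => block q σ x ∈ W).card : ℝ) -
        (n / q : ℕ) * (W.card / (n.descFactorial q : ℝ))|) ≤
      2 * Real.exp (-(t ^ 2 / (32 * n))) := by
  have hE : Ex (unif (Equiv.Perm (Fin n)))
      (fun σ => ((Finset.univ.filter fun x => block q σ x ∈ W).card : ℝ)) =
      (n / q : ℕ) * (W.card / (n.descFactorial q : ℝ)) := by
    rw [Ex_card_filter]
    have : ∀ x ∈ (Finset.univ : Finset (Fin (n / q))),
        Pr (unif (Equiv.Perm (Fin n))) (fun σ => block q σ x ∈ W) =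
        W.card / (n.descFactorial q : ℝ) := fun x _ => by
      have := Pr_perm_comp (block q 1 x) (block_injective 1 x) W hW
      rw [Fintype.card_fin] at this
      exact this
    rw [Finset.sum_congr rfl this]
    simp
  have := perm_concentration hn
    (fun σ => ((Finset.univ.filter fun x => block q σ x ∈ W).card : ℝ)) (c := 2) two_pos
    (fun c d σ => by
      have h1 : ((Finset.univ.filter fun x => block q (Equiv.swap c d * σ) x ∈ W).card : ℝ) ≤
        ((Finset.univ.filter fun x => block q σ x ∈ W).card : ℝ) + 2 := by
        exact_mod_cast card_blocks_swap_le W c d σ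
      have h2 : ((Finset.univ.filter fun x => block q σ x ∈ W).card : ℝ) ≤
        ((Finset.univ.filter fun x => block q (Equiv.swap c d * σ) x ∈ W).card : ℝ) + 2 := by
        have := card_blocks_swap_le W c d (Equiv.swap c d * σ)
        rw [← mul_assoc, Equiv.swap_mul_self, one_mul] at this
        exact_mod_cast this
      rw [abs_le]
      constructor <;> linarith) ht
  rw [hE] at this
  refine this.trans (le_of_eq ?_)
  congr 4
  ring

theorem append_block (q : ℕ) (σ : Equiv.Perm (Fin n)) (a b : Fin (n / q)) :
    Fin.append (block q σ a) (block q σ b) =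
      fun t => σ (Fin.append (block q 1 a) (block q 1 b) t) := by
  funext t
  induction t using Fin.addCases with
  | left t => rw [Fin.append_left, Fin.append_left, block_apply]
  | right t => rw [Fin.append_right, Fin.append_right, block_apply]

theorem append_block_injective {q : ℕ} (σ : Equiv.Perm (Fin n)) {a b : Fin (n / q)} (hab : a ≠ b) :
    Function.Injective (Fin.append (block q σ a) (block q σ b)) := by
  intro s t hst
  induction s using Fin.addCases with
  | left s =>
    induction t using Fin.addCases with
    | left t =>
      rw [Fin.append_left, Fin.append_left] at hst
      rw [block_injective σ a hst]
    | right t =>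
      rw [Fin.append_left, Fin.append_right] at hst
      exact absurd (block_injective2 σ hst).1 hab
  | right s =>
    induction t using Fin.addCases with
    | left t =>
      rw [Fin.append_left, Fin.append_right] at hst
      exact absurd (block_injective2 σ hst).1.symm hab
    | right t =>
      rw [Fin.append_right, Fin.append_right] at hst
      rw [block_injective σ b hst]

variable {k ℓ : ℕ} {H : KGraph (Fin n) k}

/-- The windows of the pair `(v, v)` have at most `q < k` vertices. Hence the digraphs have no
loops, and each arc involves `2q` different vertices. -/
theorem not_precedes_self {V : Type} [DecidableEq V] {H : KGraph V k} (hℓ : 1 ≤ ℓ)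
    (hk : 2 * ℓ < k) (v : Fin (qq k ℓ) → V) :
    ¬ Precedes H ℓ v v := by
  obtain ⟨hz, h1, h2, h3, h4, h5⟩ := params_facts hℓ hk
  intro h
  have h6 := H.uniform _ (h 0 (by omega))
  rw [ownedEdge_eq hℓ hk (by omega), ← Finset.image_union] at h6
  have h7 : (seg (qq k ℓ) (0 * ℓ) (qq k ℓ) ∪ seg (qq k ℓ) 0 (0 * ℓ + (k - qq k ℓ))).card ≤ qq k ℓ :=
    (Finset.card_le_univ _).trans (by simp)
  have := h6 ▸ Finset.card_image_le (s := seg (qq k ℓ) (0 * ℓ) (qq k ℓ) ∪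
    seg (qq k ℓ) 0 (0 * ℓ + (k - qq k ℓ))) (f := v)
  omega

theorem mem_ownedEdge_block (hℓ : 1 ≤ ℓ) (hk : 2 * ℓ < k) (σ : Equiv.Perm (Fin n))
    {a b c : Fin (n / qq k ℓ)} {s : Fin (qq k ℓ)} {i : ℕ} (hi : i < zz k ℓ) :
    block (qq k ℓ) σ c s ∈ ownedEdge k ℓ (block (qq k ℓ) σ a) (block (qq k ℓ) σ b) i ↔
      (c = a ∧ i * ℓ ≤ s) ∨ (c = b ∧ (s : ℕ) < i * ℓ + (k - qq k ℓ)) := by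
  rw [ownedEdge_eq hℓ hk hi, Finset.mem_union, Finset.mem_image, Finset.mem_image]
  constructor
  · rintro (⟨t, ht, ht'⟩ | ⟨t, ht, ht'⟩)
    · obtain ⟨rfl, rfl⟩ := block_injective2 σ ht'
      exact Or.inl ⟨rfl, (mem_seg.1 ht).1⟩
    · obtain ⟨rfl, rfl⟩ := block_injective2 σ ht'
      exact Or.inr ⟨rfl, (mem_seg.1 ht).2⟩
  · rintro (⟨rfl, hs⟩ | ⟨rfl, hs⟩)
    · exact Or.inl ⟨s, mem_seg.2 ⟨hs, s.2⟩, rfl⟩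
    · exact Or.inr ⟨s, mem_seg.2 ⟨Nat.zero_le _, hs⟩, rfl⟩

/-- An edge is owned by at most one pair of blocks, and in only one way. -/
theorem ownedEdge_block_injective (hℓ : 1 ≤ ℓ) (hk : 2 * ℓ < k) (σ : Equiv.Perm (Fin n))
    {a b a' b' : Fin (n / qq k ℓ)} {i i' : ℕ} (hi : i < zz k ℓ) (hi' : i' < zz k ℓ)
    (hab : a ≠ b)
    (h : ownedEdge k ℓ (block (qq k ℓ) σ a) (block (qq k ℓ) σ b) i =
      ownedEdge k ℓ (block (qq k ℓ) σ a') (block (qq k ℓ) σ b') i') :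
    a = a' ∧ b = b' ∧ i = i' := by
  obtain ⟨hz, h1, h2, h3, h4, h5⟩ := params_facts hℓ hk
  have hil : i * ℓ ≤ (zz k ℓ - 1) * ℓ := Nat.mul_le_mul_right _ (by omega)
  have hil' : i' * ℓ ≤ (zz k ℓ - 1) * ℓ := Nat.mul_le_mul_right _ (by omega)
  have key : ∀ c (s : Fin (qq k ℓ)),
      ((c = a ∧ i * ℓ ≤ s) ∨ (c = b ∧ (s : ℕ) < i * ℓ + (k - qq k ℓ))) ↔
      ((c = a' ∧ i' * ℓ ≤ s) ∨ (c = b' ∧ (s : ℕ) < i' * ℓ + (k - qq k ℓ))) := by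
    intro c s
    rw [← mem_ownedEdge_block hℓ hk σ hi, ← mem_ownedEdge_block hℓ hk σ hi', h]
  -- Each window contains the last entry of its first block and the first entry of its second block.
  -- These could trade roles only in a window stretching over both blocks entirely, impossible as `k
  -- < 2 * q`.
  have A := (key a ⟨qq k ℓ - 1, by omega⟩).1 (Or.inl ⟨rfl, by simp only; omega⟩)
  have B := (key b ⟨0, by omega⟩).1 (Or.inr ⟨rfl, by simp only; omega⟩)
  simp only at A B
  have haa : a = a' := by
    rcases A with A | A
    · exact A.1
    · exfalso
      rcases B with B | B
      · omega
      · exact hab (A.1.trans B.1.symm)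
  have hbb : b = b' := by
    rcases B with B | B
    · exact absurd (haa.trans B.1.symm) hab
    · exact B.1
  subst haa hbb
  refine ⟨rfl, rfl, ?_⟩
  have e1 := (key a ⟨i * ℓ, by omega⟩).1 (Or.inl ⟨rfl, by simp only; omega⟩)
  have e2 := (key a ⟨i' * ℓ, by omega⟩).2 (Or.inl ⟨rfl, by simp only; omega⟩)
  simp only [hab, false_and, or_false, true_and] at e1 e2
  exact Nat.eq_of_mul_eq_mul_right (by omega) (le_antisymm e2 e1)

theorem mem_owned_iff (σ : Equiv.Perm (Fin n)) (e : Finset (Fin n)) :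
    e ∈ (ownedGraph H ℓ σ (permDigraph H ℓ σ)).edges ↔
      ∃ a b, (permDigraph H ℓ σ).Adj a b ∧ ∃ i < zz k ℓ,
        e = ownedEdge k ℓ (block (qq k ℓ) σ a) (block (qq k ℓ) σ b) i := by
  simp only [ownedGraph, Finset.mem_filter]
  constructor
  · exact fun h => h.2
  · intro h
    refine ⟨?_, h⟩
    obtain ⟨a, b, hab, i, hi, rfl⟩ := h
    exact hab i hi

theorem permDigraph_ne (hℓ : 1 ≤ ℓ) (hk : 2 * ℓ < k) {σ : Equiv.Perm (Fin n)}
    {a b : Fin (n / qq k ℓ)} (h : (permDigraph H ℓ σ).Adj a b) : a ≠ b := by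
  rintro rfl
  exact not_precedes_self hℓ hk _ h

/-- By `ownedEdge_block_injective` the events for the ordered pairs of blocks and the windows are
disjoint, so the probability is exactly the sum of theirs. -/
theorem Pr_owned_eq (hℓ : 1 ≤ ℓ) (hk : 2 * ℓ < k) (e : Finset (Fin n)) :
    Pr (unif (Equiv.Perm (Fin n)))
      (fun σ => e ∈ (ownedGraph H ℓ σ (permDigraph H ℓ σ)).edges) =
      ((n / qq k ℓ * (n / qq k ℓ - 1) : ℕ) : ℝ) *
        ((∑ i ∈ Finset.range (zz k ℓ), ((owningTuples H ℓ e i).card : ℝ)) /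
          (n.descFactorial (qq k ℓ + qq k ℓ) : ℝ)) := by
  classical
  set T : Finset ((Fin (n / qq k ℓ) × Fin (n / qq k ℓ)) × ℕ) :=
    Finset.univ.offDiag ×ˢ Finset.range (zz k ℓ) with hT
  have h1 : Pr (unif (Equiv.Perm (Fin n)))
      (fun σ => e ∈ (ownedGraph H ℓ σ (permDigraph H ℓ σ)).edges) =
      Pr (unif (Equiv.Perm (Fin n))) (fun σ => ∃ y ∈ T,
        (permDigraph H ℓ σ).Adj y.1.1 y.1.2 ∧
          e = ownedEdge k ℓ (block (qq k ℓ) σ y.1.1) (block (qq k ℓ) σ y.1.2) y.2) := by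
    refine Pr_congr fun σ => ?_
    rw [mem_owned_iff]
    constructor
    · rintro ⟨a, b, hab, i, hi, he⟩
      exact ⟨((a, b), i), by simp [hT, hi, permDigraph_ne hℓ hk hab], hab, he⟩
    · rintro ⟨⟨⟨a, b⟩, i⟩, hy, hab, he⟩
      simp only [hT, Finset.mem_product, Finset.mem_range] at hy
      exact ⟨a, b, hab, i, hy.2, he⟩
  rw [h1, Pr_exists_eq]
  · have h2 : ∀ y ∈ T, Pr (unif (Equiv.Perm (Fin n))) (fun σ =>
        (permDigraph H ℓ σ).Adj y.1.1 y.1.2 ∧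
          e = ownedEdge k ℓ (block (qq k ℓ) σ y.1.1) (block (qq k ℓ) σ y.1.2) y.2) =
        ((owningTuples H ℓ e y.2).card : ℝ) / (n.descFactorial (qq k ℓ + qq k ℓ) : ℝ) := by
      rintro ⟨⟨a, b⟩, i⟩ hy
      simp only [hT, Finset.mem_product, Finset.mem_range, Finset.mem_offDiag] at hy
      have := Pr_perm_comp (Fin.append (block (qq k ℓ) 1 a) (block (qq k ℓ) 1 b))
        (append_block_injective 1 hy.1.2.2) (owningTuples H ℓ e i) (fun u hu => by
          simp only [owningTuples, Finset.mem_filter] at hu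
          exact hu.2.1)
      rw [Fintype.card_fin] at this
      rw [← this]
      refine Pr_congr fun σ => ?_
      rw [← append_block]
      simp only [owningTuples, Finset.mem_filter, Finset.mem_univ, true_and]
      constructor
      · rintro ⟨h3, h4⟩
        exact ⟨append_block_injective σ hy.1.2.2, h4.symm, h3⟩
      · rintro ⟨-, h4, h3⟩
        exact ⟨h3, h4.symm⟩
    rw [Finset.sum_congr rfl h2, hT, Finset.sum_product]
    simp only
    rw [Finset.sum_const, nsmul_eq_mul, Finset.sum_div, Finset.offDiag_card, Finset.card_univ,
      Fintype.card_fin, Nat.mul_sub_one]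
  · rintro σ ⟨⟨a, b⟩, i⟩ hy ⟨⟨a', b'⟩, i'⟩ hy' ⟨h3, h4⟩ ⟨h5, h6⟩
    simp only [hT, Finset.mem_product, Finset.mem_range] at hy hy'
    obtain ⟨rfl, rfl, rfl⟩ := ownedEdge_block_injective hℓ hk σ hy.2 hy'.2
      (permDigraph_ne hℓ hk h3) (h4.symm.trans h6)
    rfl

/-- `e` and `e'` are owned by the same arc of the digraph of `σ`. -/
def CoOwned (H : KGraph (Fin n) k) (ℓ : ℕ) (σ : Equiv.Perm (Fin n)) (e e' : Finset (Fin n)) :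
    Prop :=
  ∃ a b, (permDigraph H ℓ σ).Adj a b ∧
    (∃ i < zz k ℓ, e = ownedEdge k ℓ (block (qq k ℓ) σ a) (block (qq k ℓ) σ b) i) ∧
    ∃ i < zz k ℓ, e' = ownedEdge k ℓ (block (qq k ℓ) σ a) (block (qq k ℓ) σ b) i

/-- Two different windows cover at least `k + 1` positions, and each of these takes its value in one
of two fixed `k`-sets. Only the saving of `n ^ (k + 1)` matters, so the powers of `k` are estimated
crudely. -/
theorem card_two_windows_le (hℓ : 1 ≤ ℓ) (hk : 2 * ℓ < k) {e e' : Finset (Fin n)} (he : e.card = k)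
    (he' : e'.card = k) {i i' : ℕ} (hi : i < zz k ℓ) (hi' : i' < zz k ℓ) (hii' : i ≠ i') :
    (Finset.univ.filter fun u : Fin (qq k ℓ + qq k ℓ) → Fin n => Function.Injective u ∧
      (seg (qq k ℓ + qq k ℓ) (i * ℓ) (i * ℓ + k)).image u = e ∧
      (seg (qq k ℓ + qq k ℓ) (i' * ℓ) (i' * ℓ + k)).image u = e').card * n ^ (k + 1) ≤
      (k * n) ^ (qq k ℓ + qq k ℓ) := by
  classical
  obtain ⟨hz, h1, h2, h3, h4, h5⟩ := params_facts hℓ hk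
  have hil : i * ℓ ≤ (zz k ℓ - 1) * ℓ := Nat.mul_le_mul_right _ (by omega)
  have hil' : i' * ℓ ≤ (zz k ℓ - 1) * ℓ := Nat.mul_le_mul_right _ (by omega)
  set T := seg (qq k ℓ + qq k ℓ) (i * ℓ) (i * ℓ + k) with hT
  set T' := seg (qq k ℓ + qq k ℓ) (i' * ℓ) (i' * ℓ + k) with hT'
  have hTc : T.card = k := by rw [hT, card_seg (by omega)]; omega
  have hTc' : T'.card = k := by rw [hT', card_seg (by omega)]; omega
  rcases Nat.eq_zero_or_pos n with hn0 | hn0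
  · simp [hn0]
  have hTU : k + 1 ≤ (T ∪ T').card := by
    by_contra hcon
    have hle : (T ∪ T').card ≤ k := by omega
    have e1 : T = T ∪ T' := Finset.eq_of_subset_of_card_le Finset.subset_union_left (by omega)
    have e2 : T' = T ∪ T' := Finset.eq_of_subset_of_card_le Finset.subset_union_right (by omega)
    have e3 : T = T' := e1.trans e2.symm
    have m1 : (⟨i * ℓ, by omega⟩ : Fin (qq k ℓ + qq k ℓ)) ∈ T' := by
      rw [← e3]; simp only [hT, mem_seg]; omega
    have m2 : (⟨i' * ℓ, by omega⟩ : Fin (qq k ℓ + qq k ℓ)) ∈ T := by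
      rw [e3]; simp only [hT', mem_seg]; omega
    simp only [hT, hT', mem_seg] at m1 m2
    exact hii' (Nat.eq_of_mul_eq_mul_right (by omega) (le_antisymm m2.1 m1.1))
  set t : Fin (qq k ℓ + qq k ℓ) → Finset (Fin n) := fun s =>
    if s ∈ T then e else if s ∈ T' then e' else Finset.univ with ht
  have hsub : (Finset.univ.filter fun u : Fin (qq k ℓ + qq k ℓ) → Fin n => Function.Injective u ∧
      T.image u = e ∧ T'.image u = e') ⊆ Fintype.piFinset t := by
    intro u hu
    simp only [Finset.mem_filter, Finset.mem_univ, true_and] at hu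
    rw [Fintype.mem_piFinset]
    intro s
    simp only [ht]
    split_ifs with h6 h7
    · rw [← hu.2.1]; exact Finset.mem_image_of_mem u h6
    · rw [← hu.2.2]; exact Finset.mem_image_of_mem u h7
    · exact Finset.mem_univ _
  have hcard : (Fintype.piFinset t).card ≤ k ^ (T ∪ T').card *
      n ^ (qq k ℓ + qq k ℓ - (T ∪ T').card) := by
    rw [Fintype.card_piFinset]
    have : ∏ s, (t s).card = ∏ s, if s ∈ T ∪ T' then k else n := by
      refine Finset.prod_congr rfl fun s _ => ?_
      simp only [ht, Finset.mem_union]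
      by_cases h6 : s ∈ T <;> by_cases h7 : s ∈ T' <;> simp [h6, h7, he, he']
    rw [this, Finset.prod_ite, Finset.prod_const, Finset.prod_const]
    have e1 : (Finset.univ.filter fun s => s ∈ T ∪ T') = T ∪ T' := by ext s; simp
    have e2 : (Finset.univ.filter fun s => s ∉ T ∪ T').card =
        qq k ℓ + qq k ℓ - (T ∪ T').card := by
      have : (Finset.univ.filter fun s => s ∉ T ∪ T') = (T ∪ T')ᶜ := by ext s; simp
      rw [this, Finset.card_compl, Fintype.card_fin]
    rw [e1, e2]
  have hTUle : (T ∪ T').card ≤ qq k ℓ + qq k ℓ := by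
    have := Finset.card_le_univ (T ∪ T')
    rwa [Fintype.card_fin] at this
  calc _ ≤ k ^ (T ∪ T').card * n ^ (qq k ℓ + qq k ℓ - (T ∪ T').card) * n ^ (k + 1) :=
        Nat.mul_le_mul_right _ ((Finset.card_le_card hsub).trans hcard)
    _ ≤ k ^ (qq k ℓ + qq k ℓ) * n ^ (qq k ℓ + qq k ℓ - (T ∪ T').card) * n ^ (T ∪ T').card := by
        gcongr
        · omega
    _ = _ := by
        rw [mul_assoc, ← pow_add, Nat.sub_add_cancel hTUle, mul_pow]

theorem Pr_coOwned_le (hℓ : 1 ≤ ℓ) (hk : 2 * ℓ < k) (hn : 0 < n) {e e' : Finset (Fin n)}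
    (he : e.card = k) (he' : e'.card = k) (hne : e ≠ e') :
    Pr (unif (Equiv.Perm (Fin n))) (fun σ => CoOwned H ℓ σ e e') ≤
      (((n / qq k ℓ) ^ 2 * zz k ℓ ^ 2 : ℕ) : ℝ) * ((k * n : ℝ) ^ (qq k ℓ + qq k ℓ) / n ^ (k + 1) /
        (n.descFactorial (qq k ℓ + qq k ℓ) : ℝ)) := by
  classical
  have hp := unif_isProb (Equiv.Perm (Fin n))
  set T : Finset ((Fin (n / qq k ℓ) × Fin (n / qq k ℓ)) × (ℕ × ℕ)) :=
    Finset.univ.offDiag ×ˢ (Finset.range (zz k ℓ)).offDiag with hT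
  set W : ℕ × ℕ → Finset (Fin (qq k ℓ + qq k ℓ) → Fin n) := fun y =>
    Finset.univ.filter fun u => Function.Injective u ∧
      (seg (qq k ℓ + qq k ℓ) (y.1 * ℓ) (y.1 * ℓ + k)).image u = e ∧
      (seg (qq k ℓ + qq k ℓ) (y.2 * ℓ) (y.2 * ℓ + k)).image u = e' with hW
  refine (Pr_mono hp (B := fun σ => ∃ y ∈ T,
    (fun t => σ (Fin.append (block (qq k ℓ) 1 y.1.1) (block (qq k ℓ) 1 y.1.2) t)) ∈ W y.2)
    fun σ => ?_).trans ((Pr_exists_le hp T _).trans ?_)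
  · rintro ⟨a, b, hab, ⟨i, hi, h1⟩, ⟨i', hi', h2⟩⟩
    have hab' := permDigraph_ne hℓ hk hab
    refine ⟨((a, b), (i, i')), ?_, ?_⟩
    · simp only [hT, Finset.mem_product, Finset.mem_offDiag, Finset.mem_univ, true_and,
        Finset.mem_range]
      refine ⟨hab', hi, hi', ?_⟩
      rintro rfl
      exact hne (h1.trans h2.symm)
    · simp only [hW, Finset.mem_filter, Finset.mem_univ, true_and]
      rw [← append_block]
      exact ⟨append_block_injective σ hab', h1.symm, h2.symm⟩
  · have hbound : ∀ y ∈ T, Pr (unif (Equiv.Perm (Fin n))) (fun σ =>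
        (fun t => σ (Fin.append (block (qq k ℓ) 1 y.1.1) (block (qq k ℓ) 1 y.1.2) t)) ∈ W y.2) ≤
        (k * n : ℝ) ^ (qq k ℓ + qq k ℓ) / n ^ (k + 1) /
        (n.descFactorial (qq k ℓ + qq k ℓ) : ℝ) := by
      rintro ⟨⟨a, b⟩, ⟨i, i'⟩⟩ hy
      simp only [hT, Finset.mem_product, Finset.mem_offDiag, Finset.mem_univ, true_and,
        Finset.mem_range] at hy
      have := Pr_perm_comp (Fin.append (block (qq k ℓ) 1 a) (block (qq k ℓ) 1 b))
        (append_block_injective 1 hy.1) (W (i, i')) (fun u hu => by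
          simp only [hW, Finset.mem_filter] at hu
          exact hu.2.1)
      rw [Fintype.card_fin] at this
      rw [this]
      refine div_le_div_of_nonneg_right ?_ (by positivity)
      rw [le_div_iff₀ (by positivity)]
      have := card_two_windows_le hℓ hk he he' hy.2.1 hy.2.2.1 hy.2.2.2
      exact_mod_cast this
    refine (Finset.sum_le_sum hbound).trans ?_
    rw [Finset.sum_const, nsmul_eq_mul]
    refine mul_le_mul_of_nonneg_right ?_ (by positivity)
    have : T.card ≤ (n / qq k ℓ) ^ 2 * zz k ℓ ^ 2 := by
      rw [hT, Finset.card_product, Finset.offDiag_card, Finset.offDiag_card, Finset.card_univ,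
        Fintype.card_fin, Finset.card_range, sq, sq]
      exact Nat.mul_le_mul (Nat.sub_le _ _) (Nat.sub_le _ _)
    exact_mod_cast this

end blocks

/-! ### Edges owned by one arc. -/

section coowned

variable {n k ℓ : ℕ} {H : KGraph (Fin n) k}

open Classical in
/-- The edges owned by the same arc as `e`. -/
noncomputable def coOwnedEdges (H : KGraph (Fin n) k) (ℓ : ℕ) (σ : Equiv.Perm (Fin n))
    (e : Finset (Fin n)) : Finset (Finset (Fin n)) :=
  Finset.univ.filter fun f => CoOwned H ℓ σ e f

@[simp] theorem mem_coOwnedEdges {σ : Equiv.Perm (Fin n)} {e f : Finset (Fin n)} :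
    f ∈ coOwnedEdges H ℓ σ e ↔ CoOwned H ℓ σ e f := by simp [coOwnedEdges]

theorem CoOwned.symm {σ : Equiv.Perm (Fin n)} {e f : Finset (Fin n)} (h : CoOwned H ℓ σ e f) :
    CoOwned H ℓ σ f e := by
  obtain ⟨a, b, hab, h1, h2⟩ := h
  exact ⟨a, b, hab, h2, h1⟩

/-- An owned edge determines its arc. Thus the owned edges fall into classes of `z`, one class for
each arc. -/
theorem CoOwned.trans (hℓ : 1 ≤ ℓ) (hk : 2 * ℓ < k) {σ : Equiv.Perm (Fin n)}
    {e f g : Finset (Fin n)} (h : CoOwned H ℓ σ e f) (h' : CoOwned H ℓ σ f g) :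
    CoOwned H ℓ σ e g := by
  obtain ⟨a, b, hab, h1, i, hi, h2⟩ := h
  obtain ⟨a', b', hab', ⟨i', hi', h3⟩, h4⟩ := h'
  obtain ⟨rfl, rfl, -⟩ := ownedEdge_block_injective hℓ hk σ hi hi' (permDigraph_ne hℓ hk hab)
    (h2.symm.trans h3)
  exact ⟨a, b, hab, h1, h4⟩

theorem CoOwned.mem_edges {σ : Equiv.Perm (Fin n)} {e f : Finset (Fin n)}
    (h : CoOwned H ℓ σ e f) : f ∈ H.edges := by
  obtain ⟨a, b, hab, -, i, hi, rfl⟩ := h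
  exact hab i hi

theorem coOwned_self_iff {σ : Equiv.Perm (Fin n)} {e : Finset (Fin n)} :
    CoOwned H ℓ σ e e ↔ e ∈ (ownedGraph H ℓ σ (permDigraph H ℓ σ)).edges := by
  rw [mem_owned_iff]
  constructor
  · rintro ⟨a, b, hab, h, -⟩
    exact ⟨a, b, hab, h⟩
  · rintro ⟨a, b, hab, h⟩
    exact ⟨a, b, hab, h, h⟩

theorem CoOwned.owned_left {σ : Equiv.Perm (Fin n)} {e f : Finset (Fin n)}
    (h : CoOwned H ℓ σ e f) : e ∈ (ownedGraph H ℓ σ (permDigraph H ℓ σ)).edges := by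
  rw [mem_owned_iff]
  obtain ⟨a, b, hab, h, -⟩ := h
  exact ⟨a, b, hab, h⟩

theorem coOwnedEdges_eq (hℓ : 1 ≤ ℓ) (hk : 2 * ℓ < k) {σ : Equiv.Perm (Fin n)}
    {a b : Fin (n / qq k ℓ)} (hab : (permDigraph H ℓ σ).Adj a b) {i : ℕ} (hi : i < zz k ℓ) :
    coOwnedEdges H ℓ σ (ownedEdge k ℓ (block (qq k ℓ) σ a) (block (qq k ℓ) σ b) i) =
      (Finset.range (zz k ℓ)).image fun j =>
        ownedEdge k ℓ (block (qq k ℓ) σ a) (block (qq k ℓ) σ b) j := by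
  ext f
  simp only [mem_coOwnedEdges, Finset.mem_image, Finset.mem_range]
  constructor
  · rintro ⟨a', b', hab', ⟨i', hi', h3⟩, j, hj, rfl⟩
    obtain ⟨rfl, rfl, -⟩ := ownedEdge_block_injective hℓ hk σ hi hi' (permDigraph_ne hℓ hk hab) h3
    exact ⟨j, hj, rfl⟩
  · rintro ⟨j, hj, rfl⟩
    exact ⟨a, b, hab, ⟨i, hi, rfl⟩, j, hj, rfl⟩

theorem card_coOwnedEdges (hℓ : 1 ≤ ℓ) (hk : 2 * ℓ < k) {σ : Equiv.Perm (Fin n)}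
    {e : Finset (Fin n)} (he : e ∈ (ownedGraph H ℓ σ (permDigraph H ℓ σ)).edges) :
    (coOwnedEdges H ℓ σ e).card = zz k ℓ := by
  rw [mem_owned_iff] at he
  obtain ⟨a, b, hab, i, hi, rfl⟩ := he
  rw [coOwnedEdges_eq hℓ hk hab hi, Finset.card_image_of_injOn, Finset.card_range]
  intro j hj j' hj' h
  exact (ownedEdge_block_injective hℓ hk σ (Finset.mem_range.1 hj) (Finset.mem_range.1 hj')
    (permDigraph_ne hℓ hk hab) h).2.2

theorem card_coOwnedEdges_le (hℓ : 1 ≤ ℓ) (hk : 2 * ℓ < k) (σ : Equiv.Perm (Fin n))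
    (e : Finset (Fin n)) : (coOwnedEdges H ℓ σ e).card ≤ zz k ℓ := by
  by_cases he : e ∈ (ownedGraph H ℓ σ (permDigraph H ℓ σ)).edges
  · exact (card_coOwnedEdges hℓ hk he).le
  · have : coOwnedEdges H ℓ σ e = ∅ := by
      rw [Finset.eq_empty_iff_forall_notMem]
      intro f hf
      exact he (mem_coOwnedEdges.1 hf).owned_left
    rw [this]
    simp

variable {r : ℕ} {σ : Fin r → Equiv.Perm (Fin n)}

theorem mem_indexSet {e : Finset (Fin n)} {i : Fin r} :
    i ∈ indexSet H ℓ σ e ↔ CoOwned H ℓ (σ i) e e := by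
  rw [coOwned_self_iff]
  simp [indexSet]

theorem CoOwned.mem_index {e f : Finset (Fin n)} {i : Fin r} (h : CoOwned H ℓ (σ i) e f) :
    i ∈ indexSet H ℓ σ e := by
  rw [mem_indexSet, coOwned_self_iff]
  exact h.owned_left

end coowned

/-! ### Labels for fixed permutations, and the pruned digraphs. -/

section labels

variable {n k ℓ r : ℕ} {H : KGraph (Fin n) k} {σ : Fin r → Equiv.Perm (Fin n)}

/-- The distribution of the label of `e`, as real weights. -/
noncomputable def labelWeight (H : KGraph (Fin n) k) (ℓ : ℕ) (σ : Fin r → Equiv.Perm (Fin n))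
    (e : Finset (Fin n)) : Option (Fin r) → ℝ :=
  fun o => (labelPMF H ℓ σ e o).toReal

theorem isProb_toReal {Ω : Type*} [Fintype Ω] (p : PMF Ω) : IsProb fun ω => (p ω).toReal where
  nonneg ω := ENNReal.toReal_nonneg
  sum_one := by
    rw [← ENNReal.toReal_sum fun ω _ => p.apply_ne_top ω]
    have := p.tsum_coe
    rw [tsum_fintype] at this
    rw [this, ENNReal.toReal_one]

theorem labelWeight_isProb (e : Finset (Fin n)) : IsProb (labelWeight H ℓ σ e) := isProb_toReal _

theorem Pr_label_eq {e : Finset (Fin n)} {i : Fin r} (hi : i ∈ indexSet H ℓ σ e) :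
    Pr (labelWeight H ℓ σ e) (fun o => o = some i) = ((indexSet H ℓ σ e).card : ℝ)⁻¹ := by
  classical
  have hne : (indexSet H ℓ σ e).Nonempty := ⟨i, hi⟩
  have h1 : Pr (labelWeight H ℓ σ e) (fun o => o = some i) = labelWeight H ℓ σ e (some i) := by
    unfold Pr
    rw [Finset.sum_eq_single (some i)]
    · simp
    · intro o _ ho; simp [ho]
    · intro h; exact absurd (Finset.mem_univ _) h
  rw [h1, labelWeight, labelPMF, dif_pos hne, PMF.map_apply, tsum_fintype,
    Finset.sum_eq_single i]
  · simp [hi]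
  · intro j _ hj
    simp [hj.symm]
  · intro h; exact absurd (Finset.mem_univ _) h

/-- The joint distribution of the labels, given the permutations. -/
noncomputable def labelsWeight (H : KGraph (Fin n) k) (ℓ : ℕ) (σ : Fin r → Equiv.Perm (Fin n)) :
    (Finset (Fin n) → Option (Fin r)) → ℝ :=
  prodWeight fun e => labelWeight H ℓ σ e

theorem labelsWeight_isProb : IsProb (labelsWeight H ℓ σ) :=
  prodWeight_isProb fun e => labelWeight_isProb e

theorem Pr_labels_const (F : Finset (Finset (Fin n))) (i : Fin r)
    (hF : ∀ f ∈ F, i ∈ indexSet H ℓ σ f) :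
    Pr (labelsWeight H ℓ σ) (fun lab => ∀ f ∈ F, lab f = some i) =
      ∏ f ∈ F, ((indexSet H ℓ σ f).card : ℝ)⁻¹ := by
  rw [labelsWeight, Pr_prodWeight_forall (fun e => labelWeight_isProb e) F fun _ o => o = some i]
  exact Finset.prod_congr rfl fun f hf => Pr_label_eq (hF f hf)

/-- All index sets have sizes in `[lo, hi]`. -/
structure IndexBounds (H : KGraph (Fin n) k) (ℓ : ℕ) (σ : Fin r → Equiv.Perm (Fin n))
    (lo hi : ℝ) : Prop where
  lo_pos : 0 < lo
  lower : ∀ e ∈ H.edges, lo ≤ (indexSet H ℓ σ e).card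
  upper : ∀ e ∈ H.edges, ((indexSet H ℓ σ e).card : ℝ) ≤ hi

theorem IndexBounds.prod_bounds {lo hi : ℝ} (h : IndexBounds H ℓ σ lo hi)
    {F : Finset (Finset (Fin n))} (hF : ∀ f ∈ F, f ∈ H.edges) :
    hi⁻¹ ^ F.card ≤ ∏ f ∈ F, ((indexSet H ℓ σ f).card : ℝ)⁻¹ ∧
      ∏ f ∈ F, ((indexSet H ℓ σ f).card : ℝ)⁻¹ ≤ lo⁻¹ ^ F.card := by
  have hlo := h.lo_pos
  constructor
  · rw [← Finset.prod_const]
    refine Finset.prod_le_prod (fun f hf => ?_) fun f hf => ?_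
    · exact inv_nonneg.2 ((hlo.le.trans (h.lower f (hF f hf))).trans (h.upper f (hF f hf)))
    · exact inv_anti₀ (hlo.trans_le (h.lower f (hF f hf))) (h.upper f (hF f hf))
  · rw [← Finset.prod_const]
    refine Finset.prod_le_prod (fun f hf => by positivity) fun f hf => ?_
    exact inv_anti₀ hlo (h.lower f (hF f hf))

open Classical in
/-- The vertices joined to all members of `P` and `Q` by arcs of `D` from `P` and into `Q`. -/
noncomputable def commonNbrs {m : ℕ} (D : Digraph (Fin m)) (P Q : Finset (Fin m)) : Finset (Fin m) :=
  Finset.univ.filter fun x => (∀ a ∈ P, D.Adj a x) ∧ ∀ b ∈ Q, D.Adj x b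

theorem mem_commonNbrs {m : ℕ} {D : Digraph (Fin m)} {P Q : Finset (Fin m)} {x : Fin m} :
    x ∈ commonNbrs D P Q ↔ (∀ a ∈ P, D.Adj a x) ∧ ∀ b ∈ Q, D.Adj x b := by
  simp [commonNbrs]

/-- The pairs in `P × {x}` and `{x} × Q`. -/
def arcPairs {m : ℕ} (P Q : Finset (Fin m)) (x : Fin m) : Finset (Fin m × Fin m) :=
  P.image (fun a => (a, x)) ∪ Q.image (fun b => (x, b))

/-- The edges owned by the arcs between `x` and `P`, `Q`. -/
def starEdges (k ℓ : ℕ) (τ : Equiv.Perm (Fin n)) (P Q : Finset (Fin (n / qq k ℓ)))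
    (x : Fin (n / qq k ℓ)) : Finset (Finset (Fin n)) :=
  (arcPairs P Q x ×ˢ Finset.range (zz k ℓ)).image fun y =>
    ownedEdge k ℓ (block (qq k ℓ) τ y.1.1) (block (qq k ℓ) τ y.1.2) y.2

theorem arcPairs_adj {τ : Equiv.Perm (Fin n)} {P Q : Finset (Fin (n / qq k ℓ))}
    {x : Fin (n / qq k ℓ)} (hx : x ∈ commonNbrs (permDigraph H ℓ τ) P Q) :
    ∀ y ∈ arcPairs P Q x, (permDigraph H ℓ τ).Adj y.1 y.2 := by
  intro y hy
  rw [mem_commonNbrs] at hx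
  simp only [arcPairs, Finset.mem_union, Finset.mem_image] at hy
  rcases hy with ⟨a, ha, rfl⟩ | ⟨b, hb, rfl⟩
  · exact hx.1 a ha
  · exact hx.2 b hb

theorem card_starEdges (hℓ : 1 ≤ ℓ) (hk : 2 * ℓ < k) {τ : Equiv.Perm (Fin n)}
    {P Q : Finset (Fin (n / qq k ℓ))} {x : Fin (n / qq k ℓ)}
    (hx : x ∈ commonNbrs (permDigraph H ℓ τ) P Q) :
    (starEdges k ℓ τ P Q x).card = zz k ℓ * (P.card + Q.card) := by
  have hadj := arcPairs_adj hx
  rw [starEdges, Finset.card_image_of_injOn, Finset.card_product, Finset.card_range, arcPairs,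
    Finset.card_union_of_disjoint, Finset.card_image_of_injective, Finset.card_image_of_injective,
    mul_comm]
  · intro b b' h; exact (Prod.ext_iff.1 h).2
  · intro b b' h; exact (Prod.ext_iff.1 h).1
  · rw [Finset.disjoint_left]
    intro y hy hy'
    obtain ⟨a, ha, rfl⟩ := Finset.mem_image.1 hy
    obtain ⟨b, hb, hab⟩ := Finset.mem_image.1 hy'
    have := permDigraph_ne hℓ hk (hadj (a, x) (Finset.mem_union_left _ hy))
    exact this (Prod.ext_iff.1 hab).1.symm
  · rintro ⟨⟨a, b⟩, i⟩ hy ⟨⟨a', b'⟩, i'⟩ hy' h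
    simp only [Finset.coe_product, Set.mem_prod, Finset.mem_coe, Finset.mem_range] at hy hy'
    obtain ⟨rfl, rfl, rfl⟩ := ownedEdge_block_injective hℓ hk τ hy.2 hy'.2
      (permDigraph_ne hℓ hk (hadj _ hy.1)) h
    rfl

/-- Different arcs own different edges, and without loops no common neighbour lies in `P`, so no arc
is counted for both `x` and `x'`. This makes the survival of different common neighbours
independent. -/
theorem starEdges_disjoint (hℓ : 1 ≤ ℓ) (hk : 2 * ℓ < k) {τ : Equiv.Perm (Fin n)}
    {P Q : Finset (Fin (n / qq k ℓ))} {x x' : Fin (n / qq k ℓ)}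
    (hx : x ∈ commonNbrs (permDigraph H ℓ τ) P Q) (hx' : x' ∈ commonNbrs (permDigraph H ℓ τ) P Q)
    (hne : x ≠ x') : Disjoint (starEdges k ℓ τ P Q x) (starEdges k ℓ τ P Q x') := by
  have hadj := arcPairs_adj hx
  have hadj' := arcPairs_adj hx'
  have hmemP : ∀ y ∈ commonNbrs (permDigraph H ℓ τ) P Q, y ∉ P := by
    intro y hy hyP
    rw [mem_commonNbrs] at hy
    exact permDigraph_ne hℓ hk (hy.1 y hyP) rfl
  rw [Finset.disjoint_left]
  intro f hf hf'
  obtain ⟨⟨⟨a, b⟩, i⟩, hy, rfl⟩ := Finset.mem_image.1 hf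
  obtain ⟨⟨⟨a', b'⟩, i'⟩, hy', h⟩ := Finset.mem_image.1 hf'
  simp only [Finset.mem_product, Finset.mem_range] at hy hy'
  obtain ⟨rfl, rfl, rfl⟩ := ownedEdge_block_injective hℓ hk τ hy'.2 hy.2
    (permDigraph_ne hℓ hk (hadj' _ hy'.1)) h
  simp only [arcPairs, Finset.mem_union, Finset.mem_image, Prod.mk.injEq] at hy hy'
  rcases hy.1 with ⟨c, hc, rfl, rfl⟩ | ⟨c, hc, rfl, rfl⟩
  · rcases hy'.1 with ⟨c', hc', rfl, rfl⟩ | ⟨c', hc', rfl, rfl⟩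
    · exact hne rfl
    · exact hmemP _ hx' hc
  · rcases hy'.1 with ⟨c', hc', rfl, rfl⟩ | ⟨c', hc', rfl, rfl⟩
    · exact hmemP _ hx hc'
    · exact hne rfl

open Classical in
theorem commonNbrs_pruned_eq (i : Fin r) (P Q : Finset (Fin (n / qq k ℓ)))
    (lab : Finset (Fin n) → Option (Fin r)) :
    commonNbrs (prunedDigraph H ℓ (σ, lab) i) P Q =
      (commonNbrs (permDigraph H ℓ (σ i)) P Q).filter fun x =>
        ∀ f ∈ starEdges k ℓ (σ i) P Q x, lab f = some i := by
  ext x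
  rw [Finset.mem_filter, mem_commonNbrs, mem_commonNbrs]
  constructor
  · rintro ⟨h1, h2⟩
    refine ⟨⟨fun a ha => (h1 a ha).1, fun b hb => (h2 b hb).1⟩, fun f hf => ?_⟩
    obtain ⟨⟨⟨a, b⟩, j⟩, hy, rfl⟩ := Finset.mem_image.1 hf
    simp only [Finset.mem_product, Finset.mem_range, arcPairs, Finset.mem_union,
      Finset.mem_image] at hy
    obtain ⟨h3 | h3, h4⟩ := hy
    · obtain ⟨c, hc, h5⟩ := h3
      rw [← h5]
      exact (h1 c hc).2 j h4
    · obtain ⟨c, hc, h5⟩ := h3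
      rw [← h5]
      exact (h2 c hc).2 j h4
  · rintro ⟨⟨h1, h2⟩, h3⟩
    refine ⟨fun a ha => ⟨h1 a ha, fun j hj => h3 _ (Finset.mem_image.2 ⟨((a, x), j), ?_, rfl⟩)⟩,
      fun b hb => ⟨h2 b hb, fun j hj => h3 _ (Finset.mem_image.2 ⟨((x, b), j), ?_, rfl⟩)⟩⟩
    · exact Finset.mem_product.2 ⟨Finset.mem_union_left _ (Finset.mem_image.2 ⟨a, ha, rfl⟩),
        Finset.mem_range.2 hj⟩
    · exact Finset.mem_product.2 ⟨Finset.mem_union_right _ (Finset.mem_image.2 ⟨b, hb, rfl⟩),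
        Finset.mem_range.2 hj⟩

theorem starEdges_index {i : Fin r} {P Q : Finset (Fin (n / qq k ℓ))} {x : Fin (n / qq k ℓ)}
    (hx : x ∈ commonNbrs (permDigraph H ℓ (σ i)) P Q) :
    ∀ f ∈ starEdges k ℓ (σ i) P Q x, f ∈ H.edges ∧ i ∈ indexSet H ℓ σ f := by
  intro f hf
  obtain ⟨⟨⟨a, b⟩, j⟩, hy, rfl⟩ := Finset.mem_image.1 hf
  simp only [Finset.mem_product, Finset.mem_range] at hy
  have := arcPairs_adj hx _ hy.1
  refine ⟨this j hy.2, ?_⟩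
  rw [mem_indexSet]
  exact ⟨a, b, this, ⟨j, hy.2, rfl⟩, ⟨j, hy.2, rfl⟩⟩

/-- The size of a common neighbourhood in a pruned digraph is concentrated. -/
theorem commonNbrs_concentration (hℓ : 1 ≤ ℓ) (hk : 2 * ℓ < k) {lo hi : ℝ}
    (h : IndexBounds H ℓ σ lo hi) (i : Fin r) (P Q : Finset (Fin (n / qq k ℓ))) {M₁ M₂ t : ℝ}
    (hM₁ : 0 < M₁) (ht : 0 ≤ t) (ht₁ : t ≤ 2 * M₁) (h12 : M₁ ≤ M₂)
    (h₁ : M₁ ≤ (commonNbrs (permDigraph H ℓ (σ i)) P Q).card *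
      hi⁻¹ ^ (zz k ℓ * (P.card + Q.card)))
    (h₂ : (commonNbrs (permDigraph H ℓ (σ i)) P Q).card *
      lo⁻¹ ^ (zz k ℓ * (P.card + Q.card)) ≤ M₂) :
    Pr (labelsWeight H ℓ σ) (fun lab => ¬ (
      M₁ - t ≤ ((commonNbrs (prunedDigraph H ℓ (σ, lab) i) P Q).card : ℝ) ∧
      ((commonNbrs (prunedDigraph H ℓ (σ, lab) i) P Q).card : ℝ) ≤ M₂ + t)) ≤
      2 * Real.exp (-(t ^ 2 / (4 * M₂))) := by
  classical
  set T := commonNbrs (permDigraph H ℓ (σ i)) P Q with hT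
  set A : Fin (n / qq k ℓ) → (Finset (Fin n) → Option (Fin r)) → Prop := fun x lab =>
    ∀ f ∈ starEdges k ℓ (σ i) P Q x, lab f = some i with hA
  set p : Fin (n / qq k ℓ) → ℝ := fun x =>
    ∏ f ∈ starEdges k ℓ (σ i) P Q x, ((indexSet H ℓ σ f).card : ℝ)⁻¹ with hp
  have hind : ∀ S ⊆ T, Pr (labelsWeight H ℓ σ) (fun lab => ∀ x ∈ S, A x lab) = ∏ x ∈ S, p x := by
    intro S hS
    rw [← Finset.prod_biUnion, ← Pr_labels_const (H := H) (ℓ := ℓ) (σ := σ) _ i]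
    · refine Pr_congr fun lab => ?_
      simp only [hA, Finset.mem_biUnion]
      constructor
      · rintro h1 f ⟨x, hx, hf⟩; exact h1 x hx f hf
      · intro h1 x hx f hf; exact h1 f ⟨x, hx, hf⟩
    · intro f hf
      obtain ⟨x, hx, hf⟩ := Finset.mem_biUnion.1 hf
      exact (starEdges_index (hS hx) f hf).2
    · intro x hx x' hx' hne
      exact starEdges_disjoint hℓ hk (hS hx) (hS hx') hne
  have hb : ∀ x ∈ T, hi⁻¹ ^ (zz k ℓ * (P.card + Q.card)) ≤ p x ∧
      p x ≤ lo⁻¹ ^ (zz k ℓ * (P.card + Q.card)) := by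
    intro x hx
    have := h.prod_bounds (F := starEdges k ℓ (σ i) P Q x) fun f hf => (starEdges_index hx f hf).1
    rwa [card_starEdges hℓ hk hx] at this
  have hs1 : M₁ ≤ ∑ x ∈ T, p x := by
    refine h₁.trans ?_
    rw [← nsmul_eq_mul]
    exact Finset.card_nsmul_le_sum _ _ _ fun x hx => (hb x hx).1
  have hs2 : ∑ x ∈ T, p x ≤ M₂ := by
    refine le_trans ?_ h₂
    rw [← nsmul_eq_mul]
    exact Finset.sum_le_card_nsmul _ _ _ fun x hx => (hb x hx).2
  have hL := labelsWeight_isProb (H := H) (ℓ := ℓ) (σ := σ)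
  have c1 := chernoff_lower hL T A p hind hM₁ hs1 ht ht₁
  have c2 := chernoff_upper hL T A p hind (hM₁.trans_le h12) hs2 ht (by linarith)
  have hexp : Real.exp (-(t ^ 2 / (4 * M₁))) ≤ Real.exp (-(t ^ 2 / (4 * M₂))) := by
    refine Real.exp_le_exp.2 (neg_le_neg ?_)
    gcongr
  refine (Pr_mono hL (B := fun lab => ((T.filter fun x => A x lab).card : ℝ) ≤ M₁ - t ∨
    M₂ + t ≤ ((T.filter fun x => A x lab).card : ℝ)) fun lab hlab => ?_).trans
    ((Pr_or_le hL _ _).trans (by linarith))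
  rw [commonNbrs_pruned_eq] at hlab
  by_contra hcon
  push Not at hcon
  exact hlab ⟨hcon.1.le, hcon.2.le⟩

end labels

/-! ### Bonferroni inequalities. -/

section bonferroni

variable {Ω : Type*} [Fintype Ω] {μ : Ω → ℝ}

theorem Pr_none_ge (h : IsProb μ) {ι : Type*} (T : Finset ι) (R : ι → Ω → Prop) :
    1 - ∑ x ∈ T, Pr μ (R x) ≤ Pr μ (fun ω => ∀ x ∈ T, ¬ R x ω) := by
  have h1 := Pr_exists_le h T R
  have h2 := Pr_not h (fun ω => ∃ x ∈ T, R x ω)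
  have h3 : Pr μ (fun ω => ¬ ∃ x ∈ T, R x ω) = Pr μ (fun ω => ∀ x ∈ T, ¬ R x ω) :=
    Pr_congr fun ω => by push Not; rfl
  rw [h3] at h2
  linarith

/-- Pointwise this is `c - c * (c - 1) ≤ 1` for the number `c` of events which occur. Ordered pairs
count every pair twice, which is affordable. -/
theorem Pr_none_le (h : IsProb μ) {ι : Type*} [DecidableEq ι] (T : Finset ι) (R : ι → Ω → Prop) :
    Pr μ (fun ω => ∀ x ∈ T, ¬ R x ω) ≤
      1 - ∑ x ∈ T, Pr μ (R x) + ∑ y ∈ T.offDiag, Pr μ (fun ω => R y.1 ω ∧ R y.2 ω) := by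
  classical
  have key : ∑ x ∈ T, Pr μ (R x) - ∑ y ∈ T.offDiag, Pr μ (fun ω => R y.1 ω ∧ R y.2 ω) ≤
      Pr μ (fun ω => ∃ x ∈ T, R x ω) := by
    rw [← Ex_card_filter T R, ← Ex_card_filter T.offDiag fun y ω => R y.1 ω ∧ R y.2 ω]
    unfold Ex Pr
    rw [← Finset.sum_sub_distrib]
    refine Finset.sum_le_sum fun ω _ => ?_
    rw [← mul_sub]
    beta_reduce
    have h0 := h.nonneg ω
    have e1 : (T.offDiag.filter fun y => R y.1 ω ∧ R y.2 ω) = (T.filter fun x => R x ω).offDiag := by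
      ext y
      simp only [Finset.mem_filter, Finset.mem_offDiag]
      tauto
    have e2 : ((T.filter fun x => R x ω).offDiag.card : ℝ) =
        ((T.filter fun x => R x ω).card : ℝ) * ((T.filter fun x => R x ω).card - 1) := by
      rw [Finset.offDiag_card, Nat.cast_sub (Nat.le_mul_self _)]
      push_cast
      ring
    rw [e1, e2]
    set c := (T.filter fun x => R x ω).card with hc
    split_ifs with hx
    · have h3 : (c : ℝ) - (c : ℝ) * ((c : ℝ) - 1) ≤ 1 := by nlinarith [sq_nonneg ((c : ℝ) - 1)]
      nlinarith
    · have : c = 0 := by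
        rw [hc, Finset.card_eq_zero, Finset.filter_eq_empty_iff]
        exact fun x hxT hxR => hx ⟨x, hxT, hxR⟩
      rw [this]
      simp
  have h2 := Pr_not h (fun ω => ∃ x ∈ T, R x ω)
  have h3 : Pr μ (fun ω => ¬ ∃ x ∈ T, R x ω) = Pr μ (fun ω => ∀ x ∈ T, ¬ R x ω) :=
    Pr_congr fun ω => by push Not; rfl
  rw [h3] at h2
  linarith

end bonferroni

/-! ### Removed edges and the leftover hypergraph. -/

section removed

variable {n k ℓ r : ℕ} {H : KGraph (Fin n) k} {σ : Fin r → Equiv.Perm (Fin n)}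

/-- `e` is an edge of one of the graphs owned by the pruned digraphs. -/
def Removed (H : KGraph (Fin n) k) (ℓ : ℕ) (σ : Fin r → Equiv.Perm (Fin n))
    (e : Finset (Fin n)) (lab : Finset (Fin n) → Option (Fin r)) : Prop :=
  ∃ i, e ∈ (ownedGraph H ℓ (σ i) (prunedDigraph H ℓ (σ, lab) i)).edges

theorem removed_iff (hℓ : 1 ≤ ℓ) (hk : 2 * ℓ < k) (e : Finset (Fin n))
    (lab : Finset (Fin n) → Option (Fin r)) :
    Removed H ℓ σ e lab ↔
      ∃ i ∈ indexSet H ℓ σ e, ∀ f ∈ coOwnedEdges H ℓ (σ i) e, lab f = some i := by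
  constructor
  · rintro ⟨i, hi⟩
    simp only [ownedGraph, Finset.mem_filter] at hi
    obtain ⟨-, a, b, hab, j, hj, rfl⟩ := hi
    refine ⟨i, mem_indexSet.2 ⟨a, b, hab.1, ⟨j, hj, rfl⟩, ⟨j, hj, rfl⟩⟩, fun f hf => ?_⟩
    rw [coOwnedEdges_eq hℓ hk hab.1 hj] at hf
    obtain ⟨j', hj', rfl⟩ := Finset.mem_image.1 hf
    exact hab.2 j' (Finset.mem_range.1 hj')
  · rintro ⟨i, hi, hf⟩
    obtain ⟨a, b, hab, ⟨j, hj, rfl⟩, -⟩ := mem_indexSet.1 hi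
    refine ⟨i, ?_⟩
    simp only [ownedGraph, Finset.mem_filter]
    refine ⟨hab j hj, a, b, ⟨hab, fun j' hj' => hf _ ?_⟩, j, hj, rfl⟩
    rw [coOwnedEdges_eq hℓ hk hab hj]
    exact Finset.mem_image.2 ⟨j', Finset.mem_range.2 hj', rfl⟩

theorem coOwnedEdges_index {i : Fin r} {e f : Finset (Fin n)}
    (hf : f ∈ coOwnedEdges H ℓ (σ i) e) : f ∈ H.edges ∧ i ∈ indexSet H ℓ σ f :=
  ⟨(mem_coOwnedEdges.1 hf).mem_edges, (mem_coOwnedEdges.1 hf).symm.mem_index⟩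

/-- The probability that all edges owned by the arc of `e` in the `i`-th digraph
are labelled `i`. -/
noncomputable def arcProb (H : KGraph (Fin n) k) (ℓ : ℕ) (σ : Fin r → Equiv.Perm (Fin n))
    (e : Finset (Fin n)) (i : Fin r) : ℝ :=
  ∏ f ∈ coOwnedEdges H ℓ (σ i) e, ((indexSet H ℓ σ f).card : ℝ)⁻¹

/-- The events for different indices are disjoint because `e` carries only one label. -/
theorem Pr_removed (hℓ : 1 ≤ ℓ) (hk : 2 * ℓ < k) (e : Finset (Fin n)) :
    Pr (labelsWeight H ℓ σ) (Removed H ℓ σ e) = ∑ i ∈ indexSet H ℓ σ e, arcProb H ℓ σ e i := by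
  rw [Pr_congr (removed_iff hℓ hk e), Pr_exists_eq]
  · refine Finset.sum_congr rfl fun i _ => ?_
    exact Pr_labels_const _ i fun f hf => (coOwnedEdges_index hf).2
  · intro lab i hi j hj h1 h2
    have e1 := h1 e (mem_coOwnedEdges.2 (mem_indexSet.1 hi))
    have e2 := h2 e (mem_coOwnedEdges.2 (mem_indexSet.1 hj))
    exact Option.some_injective _ (e1.symm.trans e2)

/-- Each summand has a factor `1 / |I_e|` from `e` itself, which cancels against the number `|I_e|`
of summands. The other `z - 1` factors lie between `1 / hi` and `1 / lo`. -/
theorem Pr_removed_bounds (hℓ : 1 ≤ ℓ) (hk : 2 * ℓ < k) {lo hi : ℝ}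
    (h : IndexBounds H ℓ σ lo hi) {e : Finset (Fin n)} (he : e ∈ H.edges) :
    hi⁻¹ ^ (zz k ℓ - 1) ≤ Pr (labelsWeight H ℓ σ) (Removed H ℓ σ e) ∧
      Pr (labelsWeight H ℓ σ) (Removed H ℓ σ e) ≤ lo⁻¹ ^ (zz k ℓ - 1) := by
  have hc : 0 < ((indexSet H ℓ σ e).card : ℝ) := h.lo_pos.trans_le (h.lower e he)
  have hsplit : ∀ i ∈ indexSet H ℓ σ e, arcProb H ℓ σ e i =
      ((indexSet H ℓ σ e).card : ℝ)⁻¹ *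
        ∏ f ∈ (coOwnedEdges H ℓ (σ i) e).erase e, ((indexSet H ℓ σ f).card : ℝ)⁻¹ := by
    intro i hi
    exact (Finset.mul_prod_erase _ _ (mem_coOwnedEdges.2 (mem_indexSet.1 hi))).symm
  have hb : ∀ i ∈ indexSet H ℓ σ e,
      hi⁻¹ ^ (zz k ℓ - 1) ≤
        ∏ f ∈ (coOwnedEdges H ℓ (σ i) e).erase e, ((indexSet H ℓ σ f).card : ℝ)⁻¹ ∧
      ∏ f ∈ (coOwnedEdges H ℓ (σ i) e).erase e, ((indexSet H ℓ σ f).card : ℝ)⁻¹ ≤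
        lo⁻¹ ^ (zz k ℓ - 1) := by
    intro i hi
    have := h.prod_bounds (F := (coOwnedEdges H ℓ (σ i) e).erase e) fun f hf =>
      (coOwnedEdges_index (Finset.mem_of_mem_erase hf)).1
    rwa [Finset.card_erase_of_mem (mem_coOwnedEdges.2 (mem_indexSet.1 hi)),
      card_coOwnedEdges hℓ hk (coOwned_self_iff.1 (mem_indexSet.1 hi))] at this
  rw [Pr_removed hℓ hk, Finset.sum_congr rfl hsplit, ← Finset.mul_sum]
  constructor
  · rw [inv_mul_eq_div, le_div_iff₀ hc, mul_comm, ← nsmul_eq_mul]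
    exact Finset.card_nsmul_le_sum _ _ _ fun i hi => (hb i hi).1
  · rw [inv_mul_eq_div, div_le_iff₀ hc, mul_comm, ← nsmul_eq_mul]
    exact Finset.sum_le_card_nsmul _ _ _ fun i hi => (hb i hi).2

open Classical in
-- Arcs with disjoint sets of owned edges survive independently. Arcs of different indices sharing
-- an owned edge cannot both survive, since that edge has one label. Arcs of the same index sharing
-- one coincide, so `e` and `e'` are co-owned there; only this case goes beyond the product.
theorem Pr_removed_pair_le (hℓ : 1 ≤ ℓ) (hk : 2 * ℓ < k) {lo hi : ℝ}
    (h : IndexBounds H ℓ σ lo hi) (e e' : Finset (Fin n)) :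
    Pr (labelsWeight H ℓ σ) (fun lab => Removed H ℓ σ e lab ∧ Removed H ℓ σ e' lab) ≤
      Pr (labelsWeight H ℓ σ) (Removed H ℓ σ e) * Pr (labelsWeight H ℓ σ) (Removed H ℓ σ e') +
      (Finset.univ.filter fun i => CoOwned H ℓ (σ i) e e').card * lo⁻¹ ^ zz k ℓ := by
  have hL := labelsWeight_isProb (H := H) (ℓ := ℓ) (σ := σ)
  have hlo := h.lo_pos
  set B : Fin r × Fin r → (Finset (Fin n) → Option (Fin r)) → Prop := fun y lab =>
    (∀ f ∈ coOwnedEdges H ℓ (σ y.1) e, lab f = some y.1) ∧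
      ∀ f ∈ coOwnedEdges H ℓ (σ y.2) e', lab f = some y.2 with hB
  have hap : ∀ e i, 0 ≤ arcProb H ℓ σ e i := fun e i =>
    Finset.prod_nonneg fun f _ => by positivity
  have step : ∀ y ∈ indexSet H ℓ σ e ×ˢ indexSet H ℓ σ e', Pr (labelsWeight H ℓ σ) (B y) ≤
      arcProb H ℓ σ e y.1 * arcProb H ℓ σ e' y.2 +
        (if y.1 = y.2 ∧ CoOwned H ℓ (σ y.1) e e' then lo⁻¹ ^ zz k ℓ else 0) := by
    rintro ⟨i, j⟩ hy
    obtain ⟨hi, hj⟩ := Finset.mem_product.1 hy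
    simp only at hi hj ⊢
    have hif : 0 ≤ (if i = j ∧ CoOwned H ℓ (σ i) e e' then lo⁻¹ ^ zz k ℓ else 0) := by
      split_ifs <;> positivity
    by_cases hd : Disjoint (coOwnedEdges H ℓ (σ i) e) (coOwnedEdges H ℓ (σ j) e')
    · have e1 : Pr (labelsWeight H ℓ σ) (B (i, j)) = arcProb H ℓ σ e i * arcProb H ℓ σ e' j := by
        have := Pr_prodWeight_forall (fun e => labelWeight_isProb (H := H) (ℓ := ℓ) (σ := σ) e)
          (coOwnedEdges H ℓ (σ i) e ∪ coOwnedEdges H ℓ (σ j) e')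
          (fun f o => o = some (if f ∈ coOwnedEdges H ℓ (σ i) e then i else j))
        rw [Finset.prod_union hd] at this
        have e2 : Pr (labelsWeight H ℓ σ) (B (i, j)) = _ := (Pr_congr fun lab => ?_).trans this
        · rw [e2]
          unfold arcProb
          congr 1
          · refine Finset.prod_congr rfl fun f hf => ?_
            rw [if_pos hf]
            exact Pr_label_eq (coOwnedEdges_index hf).2
          · refine Finset.prod_congr rfl fun f hf => ?_
            rw [if_neg (Finset.disjoint_right.1 hd hf)]
            exact Pr_label_eq (coOwnedEdges_index hf).2
        · simp only [hB, Finset.mem_union]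
          constructor
          · rintro ⟨h1, h2⟩ f (hf | hf)
            · rw [if_pos hf]; exact h1 f hf
            · rw [if_neg (Finset.disjoint_right.1 hd hf)]; exact h2 f hf
          · intro h1
            refine ⟨fun f hf => ?_, fun f hf => ?_⟩
            · have := h1 f (Or.inl hf)
              rwa [if_pos hf] at this
            · have := h1 f (Or.inr hf)
              rwa [if_neg (Finset.disjoint_right.1 hd hf)] at this
      rw [e1]
      linarith
    · obtain ⟨f, hf, hf'⟩ := Finset.not_disjoint_iff.1 hd
      by_cases hij : i = j
      · subst hij
        have hco : CoOwned H ℓ (σ i) e e' :=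
          (mem_coOwnedEdges.1 hf).trans hℓ hk (mem_coOwnedEdges.1 hf').symm
        rw [if_pos ⟨rfl, hco⟩]
        have h1 : Pr (labelsWeight H ℓ σ) (B (i, i)) ≤ arcProb H ℓ σ e i := by
          refine (Pr_mono hL fun lab hlab => hlab.1).trans (le_of_eq ?_)
          exact Pr_labels_const _ i fun f hf => (coOwnedEdges_index hf).2
        have h2 : arcProb H ℓ σ e i ≤ lo⁻¹ ^ zz k ℓ := by
          have := (h.prod_bounds (F := coOwnedEdges H ℓ (σ i) e) fun f hf =>
            (coOwnedEdges_index hf).1).2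
          rwa [card_coOwnedEdges hℓ hk hco.owned_left] at this
        have := mul_nonneg (hap e i) (hap e' i)
        linarith
      · have h1 : Pr (labelsWeight H ℓ σ) (B (i, j)) = 0 := Pr_eq_zero fun lab hlab =>
          hij (Option.some_injective _ ((hlab.1 f hf).symm.trans (hlab.2 f hf')))
        rw [h1]
        have := mul_nonneg (hap e i) (hap e' j)
        linarith
  calc _ ≤ Pr (labelsWeight H ℓ σ)
        (fun lab => ∃ y ∈ indexSet H ℓ σ e ×ˢ indexSet H ℓ σ e', B y lab) := by
        refine Pr_mono hL fun lab hlab => ?_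
        obtain ⟨h1, h2⟩ := hlab
        rw [removed_iff hℓ hk] at h1 h2
        obtain ⟨i, hi, h1⟩ := h1
        obtain ⟨j, hj, h2⟩ := h2
        exact ⟨(i, j), Finset.mem_product.2 ⟨hi, hj⟩, h1, h2⟩
    _ ≤ _ := Pr_exists_le hL _ _
    _ ≤ _ := Finset.sum_le_sum step
    _ ≤ _ := by
        rw [Finset.sum_add_distrib, Pr_removed hℓ hk, Pr_removed hℓ hk, Finset.sum_mul_sum,
          Finset.sum_product]
        refine add_le_add le_rfl ?_
        rw [← Finset.sum_filter, Finset.sum_const, nsmul_eq_mul]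
        refine mul_le_mul_of_nonneg_right ?_ (by positivity)
        have : ((indexSet H ℓ σ e ×ˢ indexSet H ℓ σ e').filter
            fun y => y.1 = y.2 ∧ CoOwned H ℓ (σ y.1) e e').card ≤
            (Finset.univ.filter fun i => CoOwned H ℓ (σ i) e e').card := by
          refine Finset.card_le_card_of_injOn Prod.fst (fun y hy => ?_) fun y hy y' hy' h => ?_
          · have hy := (Finset.mem_filter.1 hy).2
            simpa using hy.2
          · have hy := (Finset.mem_filter.1 hy).2
            have hy' := (Finset.mem_filter.1 hy').2
            exact Prod.ext h (hy.1.symm.trans (h.trans hy'.1))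
        exact_mod_cast this

open Classical in
/-- The sets of `d` vertices which complete all members of `A` to edges. -/
noncomputable def completions (H : KGraph (Fin n) k) (d : ℕ) (A : Finset (Finset (Fin n))) :
    Finset (Finset (Fin n)) :=
  Finset.univ.filter fun D => D.card = d ∧ ∀ a ∈ A, a ∪ D ∈ H.edges

theorem mem_completions {d : ℕ} {A : Finset (Finset (Fin n))} {D : Finset (Fin n)} :
    D ∈ completions H d A ↔ D.card = d ∧ ∀ a ∈ A, a ∪ D ∈ H.edges := by simp [completions]

/-- Uniformity forces this. Its use is that `a` and the edge `a ∪ D` determine `D`, and `D` and the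
edge determine `a`. -/
theorem completions_disjoint {d : ℕ} (hd : d ≤ k) {A : Finset (Finset (Fin n))}
    (hA : ∀ a ∈ A, a.card = k - d) {D : Finset (Fin n)} (hD : D ∈ completions H d A)
    {a : Finset (Fin n)} (ha : a ∈ A) : Disjoint a D := by
  rw [mem_completions] at hD
  rw [← Finset.card_union_eq_card_add_card, H.uniform _ (hD.2 a ha), hA a ha, hD.1]
  omega

open Classical in
theorem completions_leftover (d : ℕ) (A : Finset (Finset (Fin n)))
    (lab : Finset (Fin n) → Option (Fin r)) :
    completions (leftover H ℓ (σ, lab)) d A =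
      (completions H d A).filter fun D => ∀ a ∈ A, ¬ Removed H ℓ σ (a ∪ D) lab := by
  ext D
  rw [Finset.mem_filter, mem_completions, mem_completions]
  simp only [leftover, Finset.mem_filter, Removed, not_exists]
  constructor
  · rintro ⟨h1, h2⟩
    exact ⟨⟨h1, fun a ha => (h2 a ha).1⟩, fun a ha => (h2 a ha).2⟩
  · rintro ⟨⟨h1, h2⟩, h3⟩
    exact ⟨h1, fun a ha => ⟨h2 a ha, h3 a ha⟩⟩

open Classical in
-- Bonferroni for the removals of the edges `a ∪ D`. For fixed `D` these edges are different, so `N`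
-- bounds the number of indices at which two of them are co-owned.
theorem leftover_mean (hℓ : 1 ≤ ℓ) (hk : 2 * ℓ < k) {lo hi N : ℝ} (h : IndexBounds H ℓ σ lo hi)
    (hN : ∀ e ∈ H.edges, ∀ e' ∈ H.edges, e ≠ e' →
      ((Finset.univ.filter fun i => CoOwned H ℓ (σ i) e e').card : ℝ) ≤ N)
    (hN0 : 0 ≤ N) {d : ℕ} (hd : d ≤ k) {A : Finset (Finset (Fin n))}
    (hA : ∀ a ∈ A, a.card = k - d) :
    (completions H d A).card * (1 - A.card * lo⁻¹ ^ (zz k ℓ - 1)) ≤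
      Ex (labelsWeight H ℓ σ) (fun lab => ((completions (leftover H ℓ (σ, lab)) d A).card : ℝ)) ∧
    Ex (labelsWeight H ℓ σ) (fun lab => ((completions (leftover H ℓ (σ, lab)) d A).card : ℝ)) ≤
      (completions H d A).card * (1 - A.card * hi⁻¹ ^ (zz k ℓ - 1) +
        (A.card : ℝ) ^ 2 * ((lo⁻¹ ^ (zz k ℓ - 1)) ^ 2 + N * lo⁻¹ ^ zz k ℓ)) := by
  have hL := labelsWeight_isProb (H := H) (ℓ := ℓ) (σ := σ)
  have hlo := h.lo_pos
  have hE : Ex (labelsWeight H ℓ σ)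
      (fun lab => ((completions (leftover H ℓ (σ, lab)) d A).card : ℝ)) =
      ∑ D ∈ completions H d A, Pr (labelsWeight H ℓ σ)
        (fun lab => ∀ a ∈ A, ¬ Removed H ℓ σ (a ∪ D) lab) := by
    rw [← Ex_card_filter]
    congr 1
    funext lab
    rw [completions_leftover]
  have hedge : ∀ D ∈ completions H d A, ∀ a ∈ A, a ∪ D ∈ H.edges := fun D hD =>
    (mem_completions.1 hD).2
  have hne : ∀ D ∈ completions H d A, ∀ a ∈ A, ∀ b ∈ A, a ≠ b → a ∪ D ≠ b ∪ D := by
    intro D hD a ha b hb hab heq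
    apply hab
    rw [← Finset.union_sdiff_cancel_right (completions_disjoint hd hA hD ha),
      ← Finset.union_sdiff_cancel_right (completions_disjoint hd hA hD hb), heq]
  rw [hE]
  constructor
  · rw [← nsmul_eq_mul]
    refine Finset.card_nsmul_le_sum _ _ _ fun D hD => ?_
    refine le_trans ?_ (Pr_none_ge hL A fun a => Removed H ℓ σ (a ∪ D))
    have : ∑ a ∈ A, Pr (labelsWeight H ℓ σ) (Removed H ℓ σ (a ∪ D)) ≤
        A.card * lo⁻¹ ^ (zz k ℓ - 1) := by
      rw [← nsmul_eq_mul]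
      exact Finset.sum_le_card_nsmul _ _ _ fun a ha =>
        (Pr_removed_bounds hℓ hk h (hedge D hD a ha)).2
    linarith
  · rw [← nsmul_eq_mul]
    refine Finset.sum_le_card_nsmul _ _ _ fun D hD => ?_
    refine (Pr_none_le hL A fun a => Removed H ℓ σ (a ∪ D)).trans ?_
    have h1 : A.card * hi⁻¹ ^ (zz k ℓ - 1) ≤
        ∑ a ∈ A, Pr (labelsWeight H ℓ σ) (Removed H ℓ σ (a ∪ D)) := by
      rw [← nsmul_eq_mul]
      exact Finset.card_nsmul_le_sum _ _ _ fun a ha =>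
        (Pr_removed_bounds hℓ hk h (hedge D hD a ha)).1
    have h2 : ∑ y ∈ A.offDiag, Pr (labelsWeight H ℓ σ)
        (fun lab => Removed H ℓ σ (y.1 ∪ D) lab ∧ Removed H ℓ σ (y.2 ∪ D) lab) ≤
        (A.card : ℝ) ^ 2 * ((lo⁻¹ ^ (zz k ℓ - 1)) ^ 2 + N * lo⁻¹ ^ zz k ℓ) := by
      have h3 : ∀ y ∈ A.offDiag, Pr (labelsWeight H ℓ σ)
          (fun lab => Removed H ℓ σ (y.1 ∪ D) lab ∧ Removed H ℓ σ (y.2 ∪ D) lab) ≤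
          (lo⁻¹ ^ (zz k ℓ - 1)) ^ 2 + N * lo⁻¹ ^ zz k ℓ := by
        rintro ⟨a, b⟩ hy
        obtain ⟨ha, hb, hab⟩ := Finset.mem_offDiag.1 hy
        refine (Pr_removed_pair_le hℓ hk h _ _).trans (add_le_add ?_ ?_)
        · rw [sq]
          exact mul_le_mul (Pr_removed_bounds hℓ hk h (hedge D hD a ha)).2
            (Pr_removed_bounds hℓ hk h (hedge D hD b hb)).2 (Pr_nonneg hL _) (by positivity)
        · exact mul_le_mul_of_nonneg_right (hN _ (hedge D hD a ha) _ (hedge D hD b hb)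
            (hne D hD a ha b hb hab)) (by positivity)
      refine (Finset.sum_le_card_nsmul _ _ _ h3).trans ?_
      rw [nsmul_eq_mul]
      refine mul_le_mul_of_nonneg_right ?_ (by positivity)
      rw [Finset.offDiag_card]
      have : A.card * A.card - A.card ≤ A.card ^ 2 := by rw [sq]; exact Nat.sub_le _ _
      exact_mod_cast this
    linarith

/-- The edges whose removal depends on the label of `g`, if this label is `o`. -/
noncomputable def affected (H : KGraph (Fin n) k) (ℓ : ℕ) (σ : Fin r → Equiv.Perm (Fin n))
    (g : Finset (Fin n)) (o : Option (Fin r)) : Finset (Finset (Fin n)) :=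
  o.elim ∅ fun i => coOwnedEdges H ℓ (σ i) g

theorem card_affected_le (hℓ : 1 ≤ ℓ) (hk : 2 * ℓ < k) (g : Finset (Fin n))
    (o : Option (Fin r)) : (affected H ℓ σ g o).card ≤ zz k ℓ := by
  cases o with
  | none => simp [affected]
  | some i => exact card_coOwnedEdges_le hℓ hk _ _

/-- A removal that depends on the label of `g` takes place at the index `lab g`, through the arc
owning `g` there. -/
theorem removed_update (hℓ : 1 ≤ ℓ) (hk : 2 * ℓ < k) {e g : Finset (Fin n)}
    {lab lab' : Finset (Fin n) → Option (Fin r)} (hlab : ∀ f, f ≠ g → lab f = lab' f)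
    (h : Removed H ℓ σ e lab) (h' : ¬ Removed H ℓ σ e lab') : e ∈ affected H ℓ σ g (lab g) := by
  rw [removed_iff hℓ hk] at h h'
  obtain ⟨i, hi, h⟩ := h
  push Not at h'
  obtain ⟨f, hf, hf'⟩ := h' i hi
  have hfg : f = g := by
    by_contra hne
    exact hf' ((hlab f hne).symm.trans (h f hf))
  subst hfg
  rw [h f hf]
  exact mem_coOwnedEdges.2 (mem_coOwnedEdges.1 hf).symm

open Classical in
/-- The number of completions which survive in the leftover graph is concentrated. -/
theorem leftover_concentration (hℓ : 1 ≤ ℓ) (hk : 2 * ℓ < k) {lo hi : ℝ}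
    (h : IndexBounds H ℓ σ lo hi) {d : ℕ} (hd : d ≤ k) {A : Finset (Finset (Fin n))}
    (hA : ∀ a ∈ A, a.card = k - d) {B t : ℝ} (hB : 0 < B) (ht : 0 ≤ t)
    (hcB : ((completions H d A).card * A.card * hi * zz k ℓ) * (2 * zz k ℓ * A.card) ^ 2 ≤ B) :
    Pr (labelsWeight H ℓ σ) (fun lab =>
      t ≤ |((completions (leftover H ℓ (σ, lab)) d A).card : ℝ) - Ex (labelsWeight H ℓ σ)
        (fun lab => ((completions (leftover H ℓ (σ, lab)) d A).card : ℝ))|) ≤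
      2 * Real.exp (-(t ^ 2 / (2 * B))) := by
  set relevant : Finset (Finset (Fin n)) := Finset.univ.filter fun g =>
    ∃ D ∈ completions H d A, ∃ a ∈ A, ∃ i, CoOwned H ℓ (σ i) (a ∪ D) g with hrel
  -- Changing the label of `g` affects at most `z` edges at the old index and `z` at the new one,
  -- and each of them arises from at most one `D` for each `a`. Edges `g` never co-owned with some
  -- `a ∪ D` have no influence; discarding them keeps the sum of squares linear in the number of
  -- completions.
  set c : Finset (Fin n) → ℝ := fun g =>
    if g ∈ relevant then (2 * zz k ℓ * A.card : ℝ) else 0 with hc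
  have hrelc : (relevant.card : ℝ) ≤ (completions H d A).card * A.card * hi * zz k ℓ := by
    have hsub : relevant ⊆ (completions H d A).biUnion fun D => A.biUnion fun a =>
        (indexSet H ℓ σ (a ∪ D)).biUnion fun i => coOwnedEdges H ℓ (σ i) (a ∪ D) := by
      intro g hg
      simp only [hrel, Finset.mem_filter, Finset.mem_univ, true_and] at hg
      obtain ⟨D, hD, a, ha, i, hi⟩ := hg
      simp only [Finset.mem_biUnion]
      exact ⟨D, hD, a, ha, i, hi.mem_index, mem_coOwnedEdges.2 hi⟩
    have h1 : ∀ D ∈ completions H d A, ∀ a ∈ A,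
        (((indexSet H ℓ σ (a ∪ D)).biUnion fun i =>
          coOwnedEdges H ℓ (σ i) (a ∪ D)).card : ℝ) ≤ hi * zz k ℓ := by
      intro D hD a ha
      have h2 := Finset.card_biUnion_le_card_mul (indexSet H ℓ σ (a ∪ D))
        (fun i => coOwnedEdges H ℓ (σ i) (a ∪ D)) (zz k ℓ)
        fun i _ => card_coOwnedEdges_le hℓ hk _ _
      have h3 := h.upper (a ∪ D) ((mem_completions.1 hD).2 a ha)
      calc _ ≤ ((indexSet H ℓ σ (a ∪ D)).card : ℝ) * zz k ℓ := by exact_mod_cast h2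
        _ ≤ _ := mul_le_mul_of_nonneg_right h3 (by positivity)
    have h4 : ∀ D ∈ completions H d A, ((A.biUnion fun a =>
        (indexSet H ℓ σ (a ∪ D)).biUnion fun i => coOwnedEdges H ℓ (σ i) (a ∪ D)).card : ℝ) ≤
        A.card * (hi * zz k ℓ) := by
      intro D hD
      calc _ ≤ ((∑ a ∈ A, ((indexSet H ℓ σ (a ∪ D)).biUnion fun i =>
            coOwnedEdges H ℓ (σ i) (a ∪ D)).card : ℕ) : ℝ) := by
            exact_mod_cast Finset.card_biUnion_le
        _ ≤ _ := by
            push_cast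
            rw [← nsmul_eq_mul]
            exact Finset.sum_le_card_nsmul _ _ _ (h1 D hD)
    calc (relevant.card : ℝ) ≤ ((∑ D ∈ completions H d A, (A.biUnion fun a =>
          (indexSet H ℓ σ (a ∪ D)).biUnion fun i =>
            coOwnedEdges H ℓ (σ i) (a ∪ D)).card : ℕ) : ℝ) := by
          exact_mod_cast (Finset.card_le_card hsub).trans Finset.card_biUnion_le
      _ ≤ (completions H d A).card * (A.card * (hi * zz k ℓ)) := by
          push_cast
          rw [← nsmul_eq_mul]
          exact Finset.sum_le_card_nsmul _ _ _ h4
      _ = _ := by ring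
  have hone : ∀ (lab lab' : Finset (Fin n) → Option (Fin r)) (g : Finset (Fin n)),
      (∀ f, f ≠ g → lab f = lab' f) →
      ((completions (leftover H ℓ (σ, lab')) d A).card : ℝ) ≤
        (completions (leftover H ℓ (σ, lab)) d A).card +
          if g ∈ relevant then (zz k ℓ * A.card : ℝ) else 0 := by
    intro lab lab' g hlab
    rw [completions_leftover, completions_leftover]
    set S' := (completions H d A).filter fun D => ∀ a ∈ A, ¬ Removed H ℓ σ (a ∪ D) lab' with hS'
    set S := (completions H d A).filter fun D => ∀ a ∈ A, ¬ Removed H ℓ σ (a ∪ D) lab with hS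
    have hdiff : ∀ D ∈ S', D ∉ S → ∃ a ∈ A, a ∪ D ∈ affected H ℓ σ g (lab g) := by
      intro D hD hDS
      simp only [hS, hS', Finset.mem_filter, not_and, not_forall, not_not] at hD hDS
      obtain ⟨a, ha, hR⟩ := hDS hD.1
      exact ⟨a, ha, removed_update hℓ hk hlab hR (hD.2 a ha)⟩
    split_ifs with hg
    · have hsub : S' ⊆ S ∪ (A ×ˢ affected H ℓ σ g (lab g)).image fun y => y.2 \ y.1 := by
        intro D hD
        by_cases hDS : D ∈ S
        · exact Finset.mem_union_left _ hDS
        · obtain ⟨a, ha, haff⟩ := hdiff D hD hDS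
          refine Finset.mem_union_right _ (Finset.mem_image.2
            ⟨(a, a ∪ D), Finset.mem_product.2 ⟨ha, haff⟩, ?_⟩)
          exact Finset.union_sdiff_cancel_left
            (completions_disjoint hd hA (Finset.mem_filter.1 hD).1 ha)
      have h1 : S'.card ≤ S.card + zz k ℓ * A.card := by
        refine (Finset.card_le_card hsub).trans ((Finset.card_union_le _ _).trans ?_)
        refine Nat.add_le_add_left (Finset.card_image_le.trans ?_) _
        rw [Finset.card_product, mul_comm]
        exact Nat.mul_le_mul_right _ (card_affected_le hℓ hk g _)
      exact_mod_cast h1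
    · have hsub : S' ⊆ S := by
        intro D hD
        by_contra hDS
        obtain ⟨a, ha, haff⟩ := hdiff D hD hDS
        apply hg
        simp only [hrel, Finset.mem_filter, Finset.mem_univ, true_and]
        refine ⟨D, (Finset.mem_filter.1 hD).1, a, ha, ?_⟩
        cases hlg : lab g with
        | none => rw [hlg] at haff; simp [affected] at haff
        | some i =>
          rw [hlg] at haff
          exact ⟨i, (mem_coOwnedEdges.1 haff).symm⟩
      rw [add_zero]
      exact_mod_cast Finset.card_le_card hsub
  refine mcdiarmid (fun e => labelWeight_isProb (H := H) (ℓ := ℓ) (σ := σ) e) c _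
    (fun lab g o => ?_) hB ?_ ht
  · have h1 := hone lab (Function.update lab g o) g fun f hf => (Function.update_of_ne hf _ _).symm
    have h2 := hone (Function.update lab g o) lab g fun f hf => Function.update_of_ne hf _ _
    have h3 : (if g ∈ relevant then (zz k ℓ * A.card : ℝ) else 0) ≤ c g := by
      simp only [hc]
      have : (0 : ℝ) ≤ zz k ℓ * A.card := by positivity
      split_ifs
      · linarith
      · exact le_rfl
    rw [abs_le]
    constructor <;> linarith
  · have : ∑ g, c g ^ 2 = relevant.card * (2 * zz k ℓ * A.card : ℝ) ^ 2 := by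
      have : ∀ g, c g ^ 2 = if g ∈ relevant then (2 * zz k ℓ * A.card : ℝ) ^ 2 else 0 := by
        intro g
        simp only [hc]
        split_ifs <;> simp
      simp_rw [this]
      rw [← Finset.sum_filter, Finset.sum_const, nsmul_eq_mul]
      congr 3
      ext g
      simp
    rw [this]
    exact (mul_le_mul_of_nonneg_right hrelc (by positivity)).trans hcB

end removed

/-! ### Arithmetic of relative errors. -/

section within

/-- From `(1 + e) ^ m * (1 - e) ^ m ≤ 1` and Bernoulli's inequality for the second factor; `103 /
100` absorbs the quadratic term. -/
theorem one_add_pow_le {e : ℝ} {m : ℕ} (he : 0 ≤ e) (hm : m * e ≤ 1 / 50) :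
    (1 + e) ^ m ≤ 1 + 103 / 100 * (m * e) := by
  rcases Nat.eq_zero_or_pos m with rfl | hm0
  · simp
  have hm1 : (1 : ℝ) ≤ m := by exact_mod_cast hm0
  have he1 : e ≤ 1 := by nlinarith
  have h1 : 1 - m * e ≤ (1 - e) ^ m := by
    have := one_add_mul_le_pow (a := -e) (by linarith) m
    calc 1 - m * e = 1 + m * -e := by ring
      _ ≤ (1 + -e) ^ m := this
      _ = _ := by ring
  have h2 : (1 + e) ^ m * (1 - e) ^ m ≤ 1 := by
    rw [← mul_pow]
    exact pow_le_one₀ (by nlinarith) (by nlinarith)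
  have h3 : (0 : ℝ) ≤ (1 + e) ^ m := by positivity
  have h4 : 0 ≤ m * e := by positivity
  nlinarith [mul_le_mul_of_nonneg_left h1 h3]

theorem one_sub_pow_ge {e : ℝ} {m : ℕ} (he1 : e ≤ 1) :
    1 - m * e ≤ (1 - e) ^ m := by
  have := one_add_mul_le_pow (a := -e) (by linarith) m
  calc 1 - m * e = 1 + m * -e := by ring
    _ ≤ (1 + -e) ^ m := this
    _ = _ := by ring

theorem WithinPow.within {e : ℝ} {m : ℕ} {A B : ℝ} (h : WithinPow e m A B) (he : 0 ≤ e)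
    (he1 : e ≤ 1) (hB : 0 ≤ B) (hm : m * e ≤ 1 / 50) : Within (103 / 100 * (m * e)) A B := by
  have h4 : 0 ≤ m * e := by positivity
  refine ⟨le_trans (mul_le_mul_of_nonneg_right ?_ hB) h.1,
    h.2.trans (mul_le_mul_of_nonneg_right (one_add_pow_le he hm) hB)⟩
  have := one_sub_pow_ge (m := m) he1
  linarith

theorem Within.mono {a b A B : ℝ} (h : Within a A B) (hab : a ≤ b) (hB : 0 ≤ B) : Within b A B :=
  ⟨le_trans (mul_le_mul_of_nonneg_right (by linarith) hB) h.1,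
    h.2.trans (mul_le_mul_of_nonneg_right (by linarith) hB)⟩

theorem Within.mul {a b A B C D : ℝ} (h : Within a A B) (h' : Within b C D) (ha : 0 ≤ a)
    (ha1 : a ≤ 1) (hb : 0 ≤ b) (hb1 : b ≤ 1) (hB : 0 ≤ B) (hD : 0 ≤ D) :
    Within (a + b + a * b) (A * C) (B * D) := by
  have h1 : 0 ≤ (1 - a) * B := mul_nonneg (by linarith) hB
  have h2 : 0 ≤ (1 - b) * D := mul_nonneg (by linarith) hD
  have h3 : 0 ≤ A := h1.trans h.1
  have h4 : 0 ≤ C := h2.trans h'.1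
  have hBD := mul_nonneg hB hD
  constructor
  · calc (1 - (a + b + a * b)) * (B * D) ≤ ((1 - a) * B) * ((1 - b) * D) := by
          nlinarith [mul_nonneg (mul_nonneg ha hb) hBD]
      _ ≤ A * C := mul_le_mul h.1 h'.1 h2 h3
  · calc A * C ≤ ((1 + a) * B) * ((1 + b) * D) := mul_le_mul h.2 h'.2 h4 (by positivity)
      _ = _ := by ring

theorem Within.sum {ι : Type*} {T : Finset ι} {a B : ℝ} {f : ι → ℝ}
    (h : ∀ i ∈ T, Within a (f i) B) : Within a (∑ i ∈ T, f i) (T.card * B) := by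
  constructor
  · have := Finset.card_nsmul_le_sum T f _ fun i hi => (h i hi).1
    rw [nsmul_eq_mul] at this
    linarith
  · have := Finset.sum_le_card_nsmul T f _ fun i hi => (h i hi).2
    rw [nsmul_eq_mul] at this
    linarith

theorem Within.inv {a A B : ℝ} (h : Within a A B) (ha : 0 ≤ a) (ha1 : a ≤ 1 / 50) (hB : 0 < B) :
    Within (103 / 100 * a) A⁻¹ B⁻¹ := by
  have hA : 0 < A := lt_of_lt_of_le (by nlinarith) h.1
  have hAB : A * B⁻¹ ≤ 1 + a := by
    rw [← div_eq_mul_inv, div_le_iff₀ hB]; exact h.2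
  have hAB' : 1 - a ≤ A * B⁻¹ := by
    rw [← div_eq_mul_inv, le_div_iff₀ hB]; exact h.1
  constructor
  · rw [← one_div A, le_div_iff₀ hA]
    have : (1 - 103 / 100 * a) * (A * B⁻¹) ≤ 1 := by nlinarith
    linarith
  · rw [← one_div A, div_le_iff₀ hA]
    have : 1 ≤ (1 + 103 / 100 * a) * (A * B⁻¹) := by nlinarith
    linarith

theorem within_descFactorial {n m : ℕ} (hn : 0 < n) (hm : m ≤ n) :
    Within ((m : ℝ) ^ 2 / n) (n.descFactorial m : ℝ) ((n : ℝ) ^ m) := by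
  have hn0 : (0 : ℝ) < n := by exact_mod_cast hn
  have hn' : (0 : ℝ) < n ^ m := by positivity
  constructor
  · have h1 : ((n - m : ℕ) : ℝ) ^ m ≤ (n.descFactorial m : ℝ) := by
      exact_mod_cast (Nat.pow_le_pow_left (by omega) m).trans (Nat.pow_sub_le_descFactorial n m)
    refine le_trans ?_ h1
    rw [Nat.cast_sub hm]
    have h2 := one_sub_pow_ge (e := (m : ℝ) / n) (m := m)
      (by rw [div_le_one hn0]; exact_mod_cast hm)
    calc (1 - (m : ℝ) ^ 2 / n) * (n : ℝ) ^ m = (1 - m * ((m : ℝ) / n)) * (n : ℝ) ^ m := by ring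
      _ ≤ (1 - (m : ℝ) / n) ^ m * (n : ℝ) ^ m := mul_le_mul_of_nonneg_right h2 hn'.le
      _ = ((n : ℝ) - m) ^ m := by
        rw [← mul_pow]
        congr 1
        field_simp
  · have h1 : (n.descFactorial m : ℝ) ≤ (n : ℝ) ^ m := by exact_mod_cast Nat.descFactorial_le_pow n m
    have : 0 ≤ (m : ℝ) ^ 2 / n * (n : ℝ) ^ m := by positivity
    linarith

end within

/-! ### Estimates for fixed `n`, and the mean number of owners of an edge. -/

/-- The numerical hypotheses under which the procedure is analysed for a fixed number `n` of
vertices; `K` is a large constant. -/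
structure Scale (k ℓ n : ℕ) (ε p K : ℝ) : Prop where
  l_pos : 1 ≤ ℓ
  l_lt : 2 * ℓ < k
  dvd : qq k ℓ ∣ n
  eps_pos : 0 < ε
  eps_small : 1000 * (zz k ℓ : ℝ) ^ 2 * ε ≤ 1
  p_pos : 0 < p
  p_le : p ≤ 2
  one_le : 1 ≤ K
  log_ge : K ≤ Real.log n
  growth : K * Real.log n ^ (4 * zz k ℓ + 1) ≤
    ε ^ (8 * zz k ℓ + 2) * n * (min 1 p) ^ (8 * zz k ℓ)

namespace Scale

variable {k ℓ n : ℕ} {ε p K : ℝ}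

theorem two_le_zz (S : Scale k ℓ n ε p K) : (2 : ℝ) ≤ zz k ℓ := by
  exact_mod_cast (params_facts S.l_pos S.l_lt).1

theorem zz_eps (S : Scale k ℓ n ε p K) : 500 * zz k ℓ * ε ≤ 1 / 4 * 1 ∧ ε ≤ 1 / 4000 ∧
    zz k ℓ ^ 2 * ε ≤ 1 / 1000 := by
  have h1 := S.two_le_zz
  have h2 := S.eps_small
  have h3 := S.eps_pos
  refine ⟨?_, ?_, ?_⟩ <;> nlinarith [mul_nonneg (sub_nonneg.2 h1) h3.le]

theorem log_ge_one (S : Scale k ℓ n ε p K) : 1 ≤ Real.log n := S.one_le.trans S.log_ge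

theorem n_pos (S : Scale k ℓ n ε p K) : 0 < n := by
  rcases Nat.eq_zero_or_pos n with rfl | h
  · have := S.log_ge_one
    norm_num at this
  · exact h

theorem theta_pos (S : Scale k ℓ n ε p K) : 0 < min 1 p := lt_min one_pos S.p_pos

theorem theta_le_one (_ : Scale k ℓ n ε p K) : min 1 p ≤ 1 := min_le_left _ _

/-- The growth hypothesis is used through this lemma only: exponents may be lowered since `ε` and
`min 1 p` are at most `1` and `log n` is at least `1`. The minimum is there because regularity does
not force `p ≤ 1`. -/
theorem le (S : Scale k ℓ n ε p K) {C : ℝ} (hCK : C ≤ K) {a b c : ℕ}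
    (ha : a ≤ 4 * zz k ℓ + 1) (hb : b ≤ 8 * zz k ℓ + 2) (hc : c ≤ 8 * zz k ℓ) :
    C * Real.log n ^ a ≤ ε ^ b * n * (min 1 p) ^ c := by
  have h1 : ε ^ (8 * zz k ℓ + 2) ≤ ε ^ b :=
    pow_le_pow_of_le_one S.eps_pos.le (by linarith [S.zz_eps.2.1]) hb
  have h2 : (min 1 p) ^ (8 * zz k ℓ) ≤ (min 1 p) ^ c :=
    pow_le_pow_of_le_one S.theta_pos.le S.theta_le_one hc
  have h3 : Real.log n ^ a ≤ Real.log n ^ (4 * zz k ℓ + 1) := pow_le_pow_right₀ S.log_ge_one ha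
  have h4 := S.eps_pos
  have h5 := S.theta_pos
  have h6 := S.log_ge_one
  have h7 : 0 ≤ K := zero_le_one.trans S.one_le
  calc C * Real.log n ^ a ≤ K * Real.log n ^ (4 * zz k ℓ + 1) := by gcongr
    _ ≤ _ := S.growth
    _ ≤ _ := by gcongr

/-- `C ≤ ε n`. -/
theorem le_eps_mul (S : Scale k ℓ n ε p K) {C : ℝ} (hCK : C ≤ K) : C ≤ ε * n := by
  have := S.le hCK (a := 0) (b := 1) (c := 0) (by omega) (by omega) (by omega)
  simpa using this

theorem le_n (S : Scale k ℓ n ε p K) {C : ℝ} (hCK : C ≤ K) : C ≤ n := by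
  have h1 := S.le_eps_mul hCK
  have h2 := S.zz_eps.2.1
  have h3 : (0 : ℝ) ≤ n := by positivity
  nlinarith [S.eps_pos]

theorem kap_eq (S : Scale k ℓ n ε p K) : ε ^ 2 * kap n k ε = 6 * (k + 1) * Real.log n := by
  have := S.eps_pos
  unfold kap
  field_simp

theorem kap_pos (S : Scale k ℓ n ε p K) : 0 < kap n k ε := by
  have := S.eps_pos
  have := S.log_ge_one
  unfold kap
  positivity

theorem eps_sq_kap (S : Scale k ℓ n ε p K) : 6 ≤ ε ^ 2 * kap n k ε := by
  rw [S.kap_eq]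
  have := S.log_ge_one
  have h : (0 : ℝ) ≤ k := by positivity
  nlinarith

theorem one_le_kap (S : Scale k ℓ n ε p K) : 1 ≤ kap n k ε := by
  have h1 := S.eps_sq_kap
  have h2 := S.zz_eps.2.1
  have h3 := S.eps_pos
  have h4 := S.kap_pos
  nlinarith [mul_le_of_le_one_left h4.le (show ε ^ 2 ≤ 1 by nlinarith)]

theorem largeRegular (S : Scale k ℓ n ε p K) {H : KGraph (Fin n) k} (h : H.IsRegular ℓ ε p)
    (hK : 20 * (5 * qq k ℓ + (ℓ : ℝ) ^ 2) * ℓ.factorial ≤ K) :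
    LargeRegular H ℓ ε p ((min 1 p) ^ (2 * zz k ℓ + 2)) where
  reg := h
  l_pos := S.l_pos
  eps_pos := S.eps_pos
  eps_le := by linarith [S.zz_eps.2.1]
  p_pos := S.p_pos
  theta_pos := pow_pos S.theta_pos _
  theta_le_one := pow_le_one₀ S.theta_pos.le S.theta_le_one
  theta_le_pow s hs := (pow_le_pow_of_le_one S.theta_pos.le S.theta_le_one hs).trans
    (pow_le_pow_left₀ S.theta_pos.le (min_le_right _ _) s)
  large := by
    have := S.le (a := 0) (b := 1) (c := 2 * zz k ℓ + 2) hK (by omega) (by omega)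
      (by have := (params_facts S.l_pos S.l_lt).1; omega)
    simpa using this

theorem exp_le (S : Scale k ℓ n ε p K) {M : ℕ} {y : ℝ} (h : M * Real.log n ≤ y) :
    Real.exp (-y) ≤ ((n : ℝ) ^ M)⁻¹ := by
  have hn : (0 : ℝ) < n := by exact_mod_cast S.n_pos
  rw [Real.exp_neg]
  apply inv_anti₀ (by positivity)
  calc (n : ℝ) ^ M = Real.exp (M * Real.log n) := by rw [Real.exp_nat_mul, Real.exp_log hn]
    _ ≤ _ := Real.exp_le_exp.2 h

/-- The number `n / q` of blocks. -/
theorem cast_div (S : Scale k ℓ n ε p K) : ((n / qq k ℓ : ℕ) : ℝ) = n / qq k ℓ := by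
  have h := params_facts S.l_pos S.l_lt
  rw [Nat.cast_div S.dvd]
  have : 0 < qq k ℓ := by have := S.l_pos; omega
  positivity

theorem within_desc (S : Scale k ℓ n ε p K) {m : ℕ} (hK : 100 * (m : ℝ) ^ 2 + m ≤ K) :
    Within (ε / 100) (n.descFactorial m : ℝ) ((n : ℝ) ^ m) := by
  have hn : (0 : ℝ) < n := by exact_mod_cast S.n_pos
  have hm : m ≤ n := by
    have := S.le_n (C := m) (by nlinarith [sq_nonneg (m : ℝ)])
    exact_mod_cast this
  refine (within_descFactorial S.n_pos hm).mono ?_ (by positivity)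
  have := S.le_eps_mul (C := 100 * (m : ℝ) ^ 2)
    (by linarith [show (0 : ℝ) ≤ m by positivity])
  rw [div_le_iff₀ hn]
  linarith

theorem qq_pos (S : Scale k ℓ n ε p K) : 0 < qq k ℓ := by
  have := params_facts S.l_pos S.l_lt
  have := S.l_pos
  omega

theorem numPerms_ge (S : Scale k ℓ n ε p K) :
    (n : ℝ) / (k.factorial * 2 ^ (zz k ℓ - 1)) ≤ numPerms n k ℓ ε p := by
  have hn : (1 : ℝ) ≤ n := by exact_mod_cast S.n_pos
  have hp := S.p_pos
  have hk : 2 < k := by have := S.l_pos; have := S.l_lt; omega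
  unfold numPerms
  have h1 : (1 : ℝ) ≤ ℓ * qq k ℓ := by
    exact_mod_cast Nat.mul_pos S.l_pos S.qq_pos
  have h2 : (n : ℝ) ≤ n ^ (k - 2) := le_self_pow₀ hn (by omega)
  have h3 : p ^ (zz k ℓ - 1) ≤ 2 ^ (zz k ℓ - 1) := pow_le_pow_left₀ hp.le S.p_le _
  have h4 := S.one_le_kap
  calc (n : ℝ) / (k.factorial * 2 ^ (zz k ℓ - 1))
      ≤ (1 * n) / (k.factorial * p ^ (zz k ℓ - 1)) * 1 := by rw [mul_one, one_mul]; gcongr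
    _ ≤ _ := by gcongr

theorem within_perms (S : Scale k ℓ n ε p K) (hK : 100 * (k.factorial * 2 ^ (zz k ℓ - 1)) ≤ K)
    {r : ℕ} (hr : |(r : ℝ) - numPerms n k ℓ ε p| < 1) :
    Within (ε / 100) (r : ℝ) (numPerms n k ℓ ε p) := by
  have h1 := S.numPerms_ge
  have h2 := S.le_eps_mul hK
  have h3 : 100 ≤ ε * numPerms n k ℓ ε p := by
    refine le_trans ?_ (mul_le_mul_of_nonneg_left h1 S.eps_pos.le)
    rw [← mul_div_assoc, le_div_iff₀ (by positivity)]
    exact h2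
  rw [abs_lt] at hr
  constructor <;> linarith

theorem within_blocks (S : Scale k ℓ n ε p K) (hK : 100 * (qq k ℓ : ℝ) ≤ K) :
    Within (ε / 100) ((n / qq k ℓ * (n / qq k ℓ - 1) : ℕ) : ℝ) (((n : ℝ) / qq k ℓ) ^ 2) := by
  have hq : (0 : ℝ) < qq k ℓ := by exact_mod_cast S.qq_pos
  have hn : (0 : ℝ) < n := by exact_mod_cast S.n_pos
  have h1 := S.le_eps_mul hK
  have hν : 0 < n / qq k ℓ := Nat.div_pos (Nat.le_of_dvd S.n_pos S.dvd) S.qq_pos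
  rw [Nat.cast_mul, Nat.cast_sub (by omega), S.cast_div]
  set ν : ℝ := (n : ℝ) / qq k ℓ with hνdef
  have hν0 : 0 < ν := by positivity
  have h2 : 100 ≤ ε * ν := by
    rw [hνdef, ← mul_div_assoc, le_div_iff₀ hq]
    exact h1
  push_cast
  constructor
  · nlinarith
  · nlinarith [S.eps_pos, mul_pos S.eps_pos (mul_pos hν0 hν0)]

/-- The reason for the choice of `numPerms`: permutations times pairs of blocks times the idealised
probability that a pair owns a given edge is `κ`. -/
theorem perms_mul_eq (S : Scale k ℓ n ε p K) :
    numPerms n k ℓ ε p * ((n : ℝ) / qq k ℓ) ^ 2 * ((n : ℝ) ^ (qq k ℓ + qq k ℓ))⁻¹ *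
      (zz k ℓ * (k.factorial * (n : ℝ) ^ (qq k ℓ + qq k ℓ - k) * p ^ (zz k ℓ - 1))) =
    kap n k ε := by
  have hn : (n : ℝ) ≠ 0 := by exact_mod_cast S.n_pos.ne'
  have hp := S.p_pos.ne'
  have hl : (ℓ : ℝ) ≠ 0 := by have := S.l_pos; positivity
  have hz : (zz k ℓ : ℝ) ≠ 0 := by have := S.two_le_zz; positivity
  have hq : (qq k ℓ : ℝ) = ℓ * zz k ℓ := by unfold qq; push_cast; rfl
  have hpf := params_facts S.l_pos S.l_lt
  have h1 : (n : ℝ) ^ (qq k ℓ + qq k ℓ) = n ^ (k - 2) * n ^ 2 * n ^ (qq k ℓ + qq k ℓ - k) := by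
    rw [← pow_add, ← pow_add]
    congr 1
    have := S.l_pos
    have := S.l_lt
    omega
  rw [h1]
  unfold numPerms
  rw [hq]
  have h2 : (k.factorial : ℝ) ≠ 0 := by positivity
  field_simp

/-- The main error `1.03 * 1.1 * z * ε` is that of `card_owningTuples`. Rounding `r`, replacing `n /
q - 1` by `n / q` and replacing the falling factorial by a power cost about `ε / 100` each. -/
theorem mean_owned (S : Scale k ℓ n ε p K) {H : KGraph (Fin n) k} (hH : H.IsRegular ℓ ε p)
    (hK1 : 20 * (5 * qq k ℓ + (ℓ : ℝ) ^ 2) * ℓ.factorial ≤ K)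
    (hK2 : 100 * (k.factorial * 2 ^ (zz k ℓ - 1)) ≤ K)
    (hK3 : 100 * ((qq k ℓ + qq k ℓ : ℕ) : ℝ) ^ 2 + (qq k ℓ + qq k ℓ : ℕ) ≤ K)
    {r : ℕ} (hr : |(r : ℝ) - numPerms n k ℓ ε p| < 1) {e : Finset (Fin n)} (he : e ∈ H.edges) :
    Within (116 / 100 * (zz k ℓ * ε))
      (r * Pr (unif (Equiv.Perm (Fin n))) fun σ => e ∈ (ownedGraph H ℓ σ (permDigraph H ℓ σ)).edges)
      (kap n k ε) := by
  have hε := S.eps_pos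
  obtain ⟨hz1, hε1, -⟩ := S.zz_eps
  have hz := S.two_le_zz
  have hzε : 2 * ε ≤ zz k ℓ * ε := mul_le_mul_of_nonneg_right hz hε.le
  have hn : (0 : ℝ) < n := by exact_mod_cast S.n_pos
  have hq : (0 : ℝ) < qq k ℓ := by exact_mod_cast S.qq_pos
  have hp := S.p_pos
  have hκ := S.kap_pos
  have hR : 0 ≤ numPerms n k ℓ ε p := le_trans (by positivity) S.numPerms_ge
  have w1 := S.within_perms hK2 hr
  have w2 := S.within_blocks (by
    refine le_trans ?_ hK3
    push_cast
    have : (1 : ℝ) ≤ qq k ℓ := by exact_mod_cast S.qq_pos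
    nlinarith)
  have w3 := (S.within_desc hK3).inv (by linarith) (by linarith) (by positivity)
  have w4 : Within (103 / 100 * (zz k ℓ * (11 / 10 * ε)))
      (∑ i ∈ Finset.range (zz k ℓ), ((owningTuples H ℓ e i).card : ℝ))
      (zz k ℓ * (k.factorial * (n : ℝ) ^ (qq k ℓ + qq k ℓ - k) * p ^ (zz k ℓ - 1))) := by
    have := Within.sum (T := Finset.range (zz k ℓ))
      (f := fun i => ((owningTuples H ℓ e i).card : ℝ))
      (a := 103 / 100 * (zz k ℓ * (11 / 10 * ε)))
      (B := k.factorial * (n : ℝ) ^ (qq k ℓ + qq k ℓ - k) * p ^ (zz k ℓ - 1)) (fun i hi => by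
        have h1 := card_owningTuples S.l_lt (S.largeRegular hH hK1) he (Finset.mem_range.1 hi)
        rw [Fintype.card_fin] at h1
        exact h1.within (by linarith) (by linarith) (by positivity) (by linarith))
    rwa [Finset.card_range] at this
  have w12 := (w1.mul w2 (by linarith) (by linarith) (by linarith) (by linarith) hR
    (by positivity)).mono (b := ε / 40) (by nlinarith) (by positivity)
  have w123 := (w12.mul w3 (by linarith) (by linarith) (by linarith) (by linarith) (by positivity)
    (by positivity)).mono (b := ε / 25) (by nlinarith) (by positivity)
  have w := w123.mul w4 (by linarith) (by linarith) (by linarith) (by linarith) (by positivity)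
    (by positivity)
  rw [S.perms_mul_eq] at w
  rw [Pr_owned_eq S.l_pos S.l_lt]
  have hz2 : ε * (zz k ℓ * ε) ≤ ε * (1 / 2000) := mul_le_mul_of_nonneg_left (by linarith) hε.le
  have hfin : ε / 25 + 103 / 100 * (zz k ℓ * (11 / 10 * ε)) +
      ε / 25 * (103 / 100 * (zz k ℓ * (11 / 10 * ε))) ≤ 116 / 100 * (zz k ℓ * ε) := by
    have : ε / 25 * (103 / 100 * (zz k ℓ * (11 / 10 * ε))) =
      103 / 100 * (11 / 10) / 25 * (ε * (zz k ℓ * ε)) := by ring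
    linarith
  refine Within.mono ?_ hfin hκ.le
  · convert w using 1
    rw [div_eq_mul_inv]
    ring

end Scale

/-! ### Properties of typical permutations. -/

/-- The lower bounds on the constant `K` of `Scale` which the analysis uses. -/
structure LargeConst (k ℓ : ℕ) (K : ℝ) : Prop where
  reg : 20 * (5 * qq k ℓ + (ℓ : ℝ) ^ 2) * ℓ.factorial ≤ K
  perms : 100 * (k.factorial * 2 ^ (zz k ℓ - 1)) ≤ K
  desc : 100 * ((qq k ℓ + qq k ℓ : ℕ) : ℝ) ^ 2 + (qq k ℓ + qq k ℓ : ℕ) ≤ K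
  pairs : (4 * (zz k ℓ : ℝ) ^ 2 * (k : ℝ) ^ (qq k ℓ + qq k ℓ)) * (6 * (k + 1)) ≤ K
  count : (2 * ℓ * qq k ℓ : ℝ) * (6 * (k + 1)) ≤ K
  blocks : (2 * k + 4 * (qq k ℓ + 1) + 10 : ℝ) * (512 * (qq k ℓ : ℝ) ^ 2) ≤ K
  nbrs : (k + 12 : ℝ) * (8 * qq k ℓ) * (6 * (k + 1)) ^ (4 * zz k ℓ) ≤ K
  leftover : (k * (2 * zz k ℓ + 2) + k + 2 * zz k ℓ + 10 : ℝ) *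
    (1000 * (zz k ℓ : ℝ) ^ 6 * ℓ.factorial) * (6 * (k + 1)) ^ (2 * zz k ℓ - 1) ≤ K

/-- The joint law of `r` independent uniformly random permutations. -/
noncomputable def permsWeight (n r : ℕ) : (Fin r → Equiv.Perm (Fin n)) → ℝ :=
  prodWeight fun _ : Fin r => unif (Equiv.Perm (Fin n))

theorem permsWeight_isProb (n r : ℕ) : IsProb (permsWeight n r) :=
  prodWeight_isProb fun _ => unif_isProb _

theorem Pr_perms_forall {n r : ℕ} (S : Finset (Fin r)) (A : Equiv.Perm (Fin n) → Prop) :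
    Pr (permsWeight n r) (fun σ => ∀ i ∈ S, A (σ i)) =
      ∏ _i ∈ S, Pr (unif (Equiv.Perm (Fin n))) A :=
  Pr_prodWeight_forall (fun _ => unif_isProb _) S fun _ => A

theorem Pr_perms_single {n r : ℕ} (i : Fin r) (A : Equiv.Perm (Fin n) → Prop) :
    Pr (permsWeight n r) (fun σ => A (σ i)) = Pr (unif (Equiv.Perm (Fin n))) A := by
  have := Pr_perms_forall {i} A
  simpa using this

namespace Scale

variable {k ℓ n : ℕ} {ε p K : ℝ}

theorem kap_mul_le (S : Scale k ℓ n ε p K) {C : ℝ} (hCK : C * (6 * (k + 1)) ≤ K) :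
    C * kap n k ε ≤ n * p ^ (zz k ℓ - 1) := by
  have h1 := S.le hCK (a := 1) (b := 2) (c := zz k ℓ - 1) (by omega) (by omega)
    (by omega)
  have hε := S.eps_pos
  have h2 : (min 1 p) ^ (zz k ℓ - 1) ≤ p ^ (zz k ℓ - 1) :=
    pow_le_pow_left₀ S.theta_pos.le (min_le_right _ _) _
  have h3 : ε ^ 2 * (C * kap n k ε) ≤ ε ^ 2 * (n * p ^ (zz k ℓ - 1)) := by
    calc ε ^ 2 * (C * kap n k ε) = C * (ε ^ 2 * kap n k ε) := by ring
      _ = C * (6 * (k + 1)) * Real.log n ^ 1 := by rw [S.kap_eq]; ring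
      _ ≤ _ := h1
      _ ≤ ε ^ 2 * n * p ^ (zz k ℓ - 1) := by gcongr
      _ = _ := by ring
  exact le_of_mul_le_mul_left h3 (by positivity)

theorem perms_le (S : Scale k ℓ n ε p K) (hK : LargeConst k ℓ K) {r : ℕ}
    (hr : |(r : ℝ) - numPerms n k ℓ ε p| < 1) : (r : ℝ) ≤ 2 * numPerms n k ℓ ε p := by
  have h1 := (S.within_perms hK.perms hr).2
  have h2 : 0 ≤ numPerms n k ℓ ε p := le_trans (by positivity) S.numPerms_ge
  have := S.zz_eps.2.1
  nlinarith

theorem perms_le_pow (S : Scale k ℓ n ε p K) (hK : LargeConst k ℓ K) {r : ℕ}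
    (hr : |(r : ℝ) - numPerms n k ℓ ε p| < 1) : (r : ℝ) ≤ (n : ℝ) ^ k := by
  have hn : (1 : ℝ) ≤ n := by exact_mod_cast S.n_pos
  have hp := S.p_pos
  have hκ := S.kap_pos
  have hk : 2 < k := by have := S.l_pos; have := S.l_lt; omega
  have h1 := S.kap_mul_le (C := 2 * ℓ * qq k ℓ) hK.count
  have hf : (1 : ℝ) ≤ k.factorial := by exact_mod_cast Nat.factorial_pos k
  refine (S.perms_le hK hr).trans ?_
  unfold numPerms
  calc 2 * (ℓ * qq k ℓ * (n : ℝ) ^ (k - 2) / (k.factorial * p ^ (zz k ℓ - 1)) * kap n k ε)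
      = (n : ℝ) ^ (k - 2) * (2 * ℓ * qq k ℓ * kap n k ε) / (k.factorial * p ^ (zz k ℓ - 1)) := by
        ring
    _ ≤ (n : ℝ) ^ (k - 2) * (n * p ^ (zz k ℓ - 1)) / (1 * p ^ (zz k ℓ - 1)) := by gcongr
    _ = (n : ℝ) ^ (k - 2 + 1) := by rw [pow_succ]; field_simp
    _ ≤ _ := pow_le_pow_right₀ hn (by omega)

/-- The number of permutations whose digraphs own a given edge is concentrated. -/
theorem Pr_index_bad (S : Scale k ℓ n ε p K) (hK : LargeConst k ℓ K) {H : KGraph (Fin n) k}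
    (hH : H.IsRegular ℓ ε p) {r : ℕ} (hr : |(r : ℝ) - numPerms n k ℓ ε p| < 1)
    {e : Finset (Fin n)} (he : e ∈ H.edges) :
    Pr (permsWeight n r) (fun σ =>
      ¬ ((1 - 2 * (zz k ℓ * ε)) * kap n k ε ≤ (indexSet H ℓ σ e).card ∧
        ((indexSet H ℓ σ e).card : ℝ) ≤ (1 + 2 * (zz k ℓ * ε)) * kap n k ε)) ≤
      2 * ((n : ℝ) ^ (3 * (k + 1)))⁻¹ := by
  classical
  have hε := S.eps_pos
  obtain ⟨hz1, hε1, -⟩ := S.zz_eps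
  have hz := S.two_le_zz
  have hzε : 2 * ε ≤ zz k ℓ * ε := mul_le_mul_of_nonneg_right hz hε.le
  have hκ := S.kap_pos
  have hP := permsWeight_isProb n r
  set κ := kap n k ε with hκdef
  set y := (zz k ℓ : ℝ) * ε with hy
  have hy1 : y ≤ 1 / 2000 := by rw [hy]; linarith
  obtain ⟨hm1, hm2⟩ := S.mean_owned hH hK.reg hK.perms hK.desc hr he
  set π := Pr (unif (Equiv.Perm (Fin n)))
    fun σ => e ∈ (ownedGraph H ℓ σ (permDigraph H ℓ σ)).edges with hπ
  have hcard : ∀ σ : Fin r → Equiv.Perm (Fin n), (indexSet H ℓ σ e).card =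
      (Finset.univ.filter fun i => e ∈ (ownedGraph H ℓ (σ i) (permDigraph H ℓ (σ i))).edges).card := by
    intro σ
    unfold indexSet
    congr
  have hprod : ∀ T ⊆ (Finset.univ : Finset (Fin r)), Pr (permsWeight n r) (fun σ => ∀ i ∈ T,
      e ∈ (ownedGraph H ℓ (σ i) (permDigraph H ℓ (σ i))).edges) = ∏ _i ∈ T, π := fun T _ =>
    Pr_perms_forall T fun σ => e ∈ (ownedGraph H ℓ σ (permDigraph H ℓ σ)).edges
  have hsum : ∑ _i : Fin r, π = r * π := by simp
  -- Since `ε ^ 2 * κ = 6 * (k + 1) * log n`, a deviation of `3/2 * ε * κ` has an exponent above `3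
  -- * (k + 1) * log n`. As `z ≥ 2`, it is at most `0.75 * z * ε * κ`, which together with the error
  -- `1.16 * z * ε` of the mean stays below `2 * z * ε`.
  have hexp : ∀ M : ℝ, 0 < M → M ≤ 101 / 100 * κ →
      Real.exp (-((3 / 2 * (ε * κ)) ^ 2 / (4 * M))) ≤ ((n : ℝ) ^ (3 * (k + 1)))⁻¹ := by
    intro M hM0 hM
    apply S.exp_le
    rw [le_div_iff₀ (by positivity)]
    have h1 : (3 / 2 * (ε * κ)) ^ 2 = 9 / 4 * (6 * (k + 1) * Real.log n) * κ := by
      rw [← S.kap_eq]; ring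
    rw [h1]
    have h2 : 0 ≤ (k + 1 : ℝ) * Real.log n := by
      have := S.log_ge_one
      positivity
    push_cast
    nlinarith [mul_le_mul_of_nonneg_left hM h2, mul_nonneg h2 hκ.le]
  have up := chernoff_upper hP Finset.univ
    (fun i (σ : Fin r → Equiv.Perm (Fin n)) =>
      e ∈ (ownedGraph H ℓ (σ i) (permDigraph H ℓ (σ i))).edges) (fun _ => π) hprod
    (M := (1 + 116 / 100 * y) * κ) (t := 3 / 2 * (ε * κ)) (by positivity)
    (by rw [hsum]; exact hm2) (by positivity) (by nlinarith [mul_pos hε hκ])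
  have lo := chernoff_lower hP Finset.univ
    (fun i (σ : Fin r → Equiv.Perm (Fin n)) =>
      e ∈ (ownedGraph H ℓ (σ i) (permDigraph H ℓ (σ i))).edges) (fun _ => π) hprod
    (M := (1 - 116 / 100 * y) * κ) (t := 3 / 2 * (ε * κ))
    (mul_pos (by linarith) hκ)
    (by rw [hsum]; exact hm1) (by positivity) (by nlinarith [mul_pos hε hκ])
  have hy0 : 0 ≤ y := by positivity
  have hyκ : 2 * (ε * κ) ≤ y * κ := by
    have := mul_le_mul_of_nonneg_right hzε hκ.le
    linarith
  refine (Pr_mono hP (B := fun σ => _ ∨ _) fun σ hσ => ?_).trans ((Pr_or_le hP _ _).trans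
    ((add_le_add (up.trans (hexp _ (by positivity) (by nlinarith)))
      (lo.trans (hexp _ (mul_pos (by linarith) hκ) (by nlinarith)))).trans (by linarith)))
  rw [hcard] at hσ
  rw [not_and_or, not_le, not_le] at hσ
  rcases hσ with hσ | hσ
  · right
    refine hσ.le.trans ?_
    nlinarith
  · left
    refine le_trans ?_ hσ.le
    nlinarith

/-- There are `O(n^(k-2) κ / p^(z-1))` permutations, `O(n²)` pairs of blocks in each, and a
probability `O(n^(-k-1))` for each pair. The product `O(κ / (n p^(z-1)))` is small by the growth
hypothesis. -/
theorem mean_coOwned (S : Scale k ℓ n ε p K) (hK : LargeConst k ℓ K) {H : KGraph (Fin n) k}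
    {r : ℕ} (hr : |(r : ℝ) - numPerms n k ℓ ε p| < 1)
    {e e' : Finset (Fin n)} (he : e ∈ H.edges) (he' : e' ∈ H.edges) (hne : e ≠ e') :
    r * Pr (unif (Equiv.Perm (Fin n))) (fun σ => CoOwned H ℓ σ e e') ≤ 1 := by
  have hn : (0 : ℝ) < n := by exact_mod_cast S.n_pos
  have hq : (0 : ℝ) < qq k ℓ := by exact_mod_cast S.qq_pos
  have hq1 : (1 : ℝ) ≤ qq k ℓ := by exact_mod_cast S.qq_pos
  have hl : (1 : ℝ) ≤ ℓ := by exact_mod_cast S.l_pos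
  have hp := S.p_pos
  have hκ := S.kap_pos
  have hk : 2 < k := by have := S.l_pos; have := S.l_lt; omega
  have hf : (1 : ℝ) ≤ k.factorial := by exact_mod_cast Nat.factorial_pos k
  have h1 := Pr_coOwned_le (H := H) S.l_pos S.l_lt S.n_pos (H.uniform e he) (H.uniform e' he') hne
  have h2 := S.kap_mul_le hK.pairs
  have h3 : (n : ℝ) ^ (qq k ℓ + qq k ℓ) / 2 ≤ n.descFactorial (qq k ℓ + qq k ℓ) := by
    refine le_trans ?_ (S.within_desc hK.desc).1
    have : (0 : ℝ) < (n : ℝ) ^ (qq k ℓ + qq k ℓ) := by positivity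
    have := S.zz_eps.2.1
    nlinarith
  rw [Nat.cast_mul, Nat.cast_pow, Nat.cast_pow, S.cast_div] at h1
  have h4 : (ℓ : ℝ) * qq k ℓ ≤ qq k ℓ ^ 2 * k.factorial := by
    have : ℓ ≤ qq k ℓ := by have := params_facts S.l_pos S.l_lt; omega
    have : (ℓ : ℝ) ≤ qq k ℓ := by exact_mod_cast this
    nlinarith [mul_le_mul_of_nonneg_right this hq.le, mul_nonneg hq.le hq.le]
  calc (r : ℝ) * Pr (unif (Equiv.Perm (Fin n))) (fun σ => CoOwned H ℓ σ e e')
      ≤ (2 * numPerms n k ℓ ε p) * (((n : ℝ) / qq k ℓ) ^ 2 * (zz k ℓ : ℝ) ^ 2 *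
        ((k * n) ^ (qq k ℓ + qq k ℓ) / n ^ (k + 1) / (n ^ (qq k ℓ + qq k ℓ) / 2))) := by
        have hR : 0 ≤ numPerms n k ℓ ε p := le_trans (by positivity) S.numPerms_ge
        refine mul_le_mul (S.perms_le hK hr) (h1.trans ?_) (Pr_nonneg (unif_isProb _) _)
          (by positivity)
        gcongr
    _ = (4 * (zz k ℓ : ℝ) ^ 2 * (k : ℝ) ^ (qq k ℓ + qq k ℓ) * kap n k ε) *
        ((ℓ * qq k ℓ) / (qq k ℓ ^ 2 * k.factorial)) / (n * p ^ (zz k ℓ - 1)) := by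
        unfold numPerms
        have e1 : (n : ℝ) ^ (k + 1) = n ^ (k - 2) * n ^ 3 := by
          rw [← pow_add]; congr 1; omega
        rw [e1, mul_pow]
        field_simp
        ring
    _ ≤ (n * p ^ (zz k ℓ - 1)) * 1 / (n * p ^ (zz k ℓ - 1)) := by
        gcongr
        rw [div_le_one (by positivity)]
        exact h4
    _ = 1 := by field_simp

open Classical in
/-- Few permutations own two given edges by the same arc. -/
theorem Pr_coOwned_bad (S : Scale k ℓ n ε p K) (hK : LargeConst k ℓ K) {H : KGraph (Fin n) k}
    {r : ℕ} (hr : |(r : ℝ) - numPerms n k ℓ ε p| < 1)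
    {e e' : Finset (Fin n)} (he : e ∈ H.edges) (he' : e' ∈ H.edges) (hne : e ≠ e') :
    Pr (permsWeight n r) (fun σ =>
      ¬ ((Finset.univ.filter fun i => CoOwned H ℓ (σ i) e e').card : ℝ) ≤ ε ^ 2 * kap n k ε) ≤
      ((n : ℝ) ^ (3 * (k + 1)))⁻¹ := by
  have hP := permsWeight_isProb n r
  have h := chernoff_far hP Finset.univ
    (fun i (σ : Fin r → Equiv.Perm (Fin n)) => CoOwned H ℓ (σ i) e e')
    (fun _ => Pr (unif (Equiv.Perm (Fin n))) fun σ => CoOwned H ℓ σ e e')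
    (fun T _ => Pr_perms_forall T fun σ => CoOwned H ℓ σ e e') (t := ε ^ 2 * kap n k ε)
    (by simpa using S.mean_coOwned hK hr he he' hne)
  refine (Pr_mono hP fun σ hσ => (not_le.1 hσ).le).trans (h.trans ?_)
  rw [S.kap_eq, show 2 - 6 * (k + 1 : ℝ) * Real.log n =
    -(6 * (k + 1) * Real.log n - 2) by ring]
  apply S.exp_le
  have := S.log_ge_one
  have : (0 : ℝ) ≤ k * Real.log n := by positivity
  push_cast
  nlinarith

open Classical in
-- The constant: `z + 1 ≤ 3/2 * z` steps of error `1.1 * ε` give `1.03 * 1.1 * 1.5 < 1.7`, and the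
-- falling factorial fits into the rest.
theorem blocks_mean (S : Scale k ℓ n ε p K) (hK : LargeConst k ℓ K) {H : KGraph (Fin n) k}
    (hH : H.IsRegular ℓ ε p) {P Q : Finset (Fin (qq k ℓ) → Fin n)} (hP : P.card ≤ 2)
    (hQ : Q.card ≤ 2) (hPQ : DisjointTuples (P ∪ Q)) :
    Within (7 / 4 * (zz k ℓ * ε)) (((n / qq k ℓ : ℕ) : ℝ) *
      ((arcTuples H ℓ P Q).card / (n.descFactorial (qq k ℓ))))
      (n / qq k ℓ * p ^ (zz k ℓ * (P.card + Q.card))) := by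
  have hε := S.eps_pos
  obtain ⟨hz1, hε1, -⟩ := S.zz_eps
  have hz := S.two_le_zz
  have hzε : 2 * ε ≤ zz k ℓ * ε := mul_le_mul_of_nonneg_right hz hε.le
  have hn : (0 : ℝ) < n := by exact_mod_cast S.n_pos
  have hq : (0 : ℝ) < qq k ℓ := by exact_mod_cast S.qq_pos
  have hp := S.p_pos
  have w1 := card_arcTuples S.l_lt (S.largeRegular hH hK.reg) hP hQ hPQ
  rw [Fintype.card_fin] at w1
  have w2 := w1.within (by linarith) (by linarith) (by positivity) (by push_cast; linarith)
  have w3 := (S.within_desc (m := qq k ℓ) (by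
    refine le_trans ?_ hK.desc
    push_cast
    nlinarith)).inv (by linarith) (by linarith) (by positivity)
  have w := w2.mul w3 (by positivity) (by push_cast; linarith) (by linarith) (by linarith)
    (by positivity) (by positivity)
  have w' := w.mono (b := 7 / 4 * (zz k ℓ * ε)) (by
    have hz2 : ε * (zz k ℓ * ε) ≤ ε * (1 / 2000) := mul_le_mul_of_nonneg_left (by linarith) hε.le
    push_cast
    have : 103 / 100 * (((zz k ℓ : ℝ) + 1) * (11 / 10 * ε)) * (103 / 100 * (ε / 100)) =
      103 / 100 * (11 / 10) * (103 / 100) / 100 * (ε * (zz k ℓ * ε) + ε * ε) := by ring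
    nlinarith) (by positivity)
  rw [S.cast_div]
  have hν : (0 : ℝ) ≤ n / qq k ℓ := by positivity
  constructor
  · calc _ = n / qq k ℓ * ((1 - 7 / 4 * (zz k ℓ * ε)) * ((n : ℝ) ^ qq k ℓ *
        p ^ (zz k ℓ * (P.card + Q.card)) * ((n : ℝ) ^ qq k ℓ)⁻¹)) := by field_simp
      _ ≤ _ := by
        rw [div_eq_mul_inv ((arcTuples H ℓ P Q).card : ℝ)]
        exact mul_le_mul_of_nonneg_left w'.1 hν
  · calc _ ≤ n / qq k ℓ * ((1 + 7 / 4 * (zz k ℓ * ε)) * ((n : ℝ) ^ qq k ℓ *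
        p ^ (zz k ℓ * (P.card + Q.card)) * ((n : ℝ) ^ qq k ℓ)⁻¹)) := by
          rw [div_eq_mul_inv ((arcTuples H ℓ P Q).card : ℝ)]
          exact mul_le_mul_of_nonneg_left w'.2 hν
      _ = _ := by field_simp

end Scale

theorem card_finsets_card_le_two (α : Type*) [Fintype α] [DecidableEq α] :
    (Finset.univ.filter fun P : Finset α => P.card ≤ 2).card ≤ (Fintype.card α + 1) ^ 2 := by
  have hsub : (Finset.univ.filter fun P : Finset α => P.card ≤ 2) ⊆
      (Finset.univ : Finset (Option α × Option α)).image fun y => y.1.toFinset ∪ y.2.toFinset := by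
    intro P hP
    have hP := (Finset.mem_filter.1 hP).2
    simp only [Finset.mem_image, Finset.mem_univ, true_and, Prod.exists]
    have : P.card = 0 ∨ P.card = 1 ∨ P.card = 2 := by omega
    rcases this with h | h | h
    · exact ⟨none, none, by simp [Finset.card_eq_zero.1 h]⟩
    · obtain ⟨a, rfl⟩ := Finset.card_eq_one.1 h
      exact ⟨some a, none, by simp⟩
    · obtain ⟨a, b, -, rfl⟩ := Finset.card_eq_two.1 h
      exact ⟨some a, some b, by ext; simp⟩
  refine (Finset.card_le_card hsub).trans (Finset.card_image_le.trans ?_)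
  simp [sq]

theorem card_edges_le {n k : ℕ} (H : KGraph (Fin n) k) : H.edges.card ≤ n ^ k := by
  have : H.edges ⊆ Finset.powersetCard k Finset.univ := fun e he =>
    Finset.mem_powersetCard.2 ⟨Finset.subset_univ _, H.uniform e he⟩
  refine (Finset.card_le_card this).trans ?_
  rw [Finset.card_powersetCard, Finset.card_univ, Fintype.card_fin]
  exact Nat.choose_le_pow n k

open Classical in
-- The blocks with indices in `P` and `Q` are themselves random. Passing to their tuples allows a
-- union bound over all fixed tuples instead of conditioning on a part of the permutation.
theorem commonNbrs_eq_blocks {n k ℓ : ℕ} {H : KGraph (Fin n) k} (hℓ : 1 ≤ ℓ) (hk : 2 * ℓ < k)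
    (σ : Equiv.Perm (Fin n)) (P Q : Finset (Fin (n / qq k ℓ))) :
    commonNbrs (permDigraph H ℓ σ) P Q = Finset.univ.filter fun x => block (qq k ℓ) σ x ∈
      arcTuples H ℓ (P.image (block (qq k ℓ) σ)) (Q.image (block (qq k ℓ) σ)) := by
  ext x
  rw [mem_commonNbrs, Finset.mem_filter]
  simp only [arcTuples, Finset.mem_filter, Finset.mem_univ, true_and, Finset.mem_union,
    Finset.mem_image]
  constructor
  · rintro ⟨h1, h2⟩
    refine ⟨block_injective σ x, ?_, ?_, ?_⟩
    · rintro v (⟨a, ha, rfl⟩ | ⟨a, ha, rfl⟩) s t hst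
      · exact permDigraph_ne hℓ hk (h1 a ha) (block_injective2 σ hst).1.symm
      · exact permDigraph_ne hℓ hk (h2 a ha) (block_injective2 σ hst).1
    · rintro v ⟨a, ha, rfl⟩
      exact h1 a ha
    · rintro v ⟨a, ha, rfl⟩
      exact h2 a ha
  · rintro ⟨-, -, h1, h2⟩
    exact ⟨fun a ha => h1 _ ⟨a, ha, rfl⟩, fun a ha => h2 _ ⟨a, ha, rfl⟩⟩

theorem block_ne {n q : ℕ} (hq : 0 < q) (σ : Equiv.Perm (Fin n)) :
    Function.Injective (block (n := n) q σ) := fun _ _ hab =>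
  (block_injective2 σ (congrFun hab ⟨0, hq⟩)).1

theorem disjointTuples_blocks {n q : ℕ} (σ : Equiv.Perm (Fin n)) (P : Finset (Fin (n / q))) :
    DisjointTuples (P.image (block q σ)) where
  inj v hv := by
    obtain ⟨a, -, rfl⟩ := Finset.mem_image.1 hv
    exact block_injective σ a
  disj v hv w hw hne s t hst := by
    obtain ⟨a, -, rfl⟩ := Finset.mem_image.1 hv
    obtain ⟨b, -, rfl⟩ := Finset.mem_image.1 hw
    exact hne (by rw [(block_injective2 σ hst).1])

open Classical in
/-- The properties of the permutations under which the labelling succeeds with high probability. -/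
structure GoodPerms {n k r : ℕ} (H : KGraph (Fin n) k) (ℓ : ℕ) (ε p : ℝ)
    (σ : Fin r → Equiv.Perm (Fin n)) : Prop where
  index : IndexBounds H ℓ σ ((1 - 2 * (zz k ℓ * ε)) * kap n k ε)
    ((1 + 2 * (zz k ℓ * ε)) * kap n k ε)
  pairs : ∀ e ∈ H.edges, ∀ e' ∈ H.edges, e ≠ e' →
    ((Finset.univ.filter fun i => CoOwned H ℓ (σ i) e e').card : ℝ) ≤ ε ^ 2 * kap n k ε
  nbrs : ∀ (i : Fin r) (P Q : Finset (Fin (n / qq k ℓ))), P.card ≤ 2 → Q.card ≤ 2 →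
    Within (2 * (zz k ℓ * ε)) ((commonNbrs (permDigraph H ℓ (σ i)) P Q).card : ℝ)
      (n / qq k ℓ * p ^ (zz k ℓ * (P.card + Q.card)))

namespace Scale

variable {k ℓ n : ℕ} {ε p K : ℝ}

open Classical in
-- The deviation `ε / 4` of the main term must beat fluctuations of order `√n`, up to logarithms.
-- With `|P| + |Q| = 4` this is the place where the full power `p ^ (8 * z)` is needed.
theorem Pr_blocks_bad (S : Scale k ℓ n ε p K) (hK : LargeConst k ℓ K) {H : KGraph (Fin n) k}
    (hH : H.IsRegular ℓ ε p) {P Q : Finset (Fin (qq k ℓ) → Fin n)} (hP : P.card ≤ 2)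
    (hQ : Q.card ≤ 2) (hPQ : DisjointTuples (P ∪ Q)) :
    Pr (unif (Equiv.Perm (Fin n))) (fun σ =>
      ¬ Within (2 * (zz k ℓ * ε))
        ((Finset.univ.filter fun x => block (qq k ℓ) σ x ∈ arcTuples H ℓ P Q).card : ℝ)
        (n / qq k ℓ * p ^ (zz k ℓ * (P.card + Q.card)))) ≤
      2 * ((n : ℝ) ^ (2 * k + 4 * (qq k ℓ + 1) + 10))⁻¹ := by
  have hn : (0 : ℝ) < n := by exact_mod_cast S.n_pos
  have hq : (0 : ℝ) < qq k ℓ := by exact_mod_cast S.qq_pos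
  have hp := S.p_pos
  have hε := S.eps_pos
  have hz := S.two_le_zz
  have hzε : 2 * ε ≤ zz k ℓ * ε := mul_le_mul_of_nonneg_right hz hε.le
  obtain ⟨w1, w2⟩ := S.blocks_mean hK hH hP hQ hPQ
  set m := P.card + Q.card with hm
  set B : ℝ := n / qq k ℓ * p ^ (zz k ℓ * m) with hB
  have hB0 : 0 < B := by positivity
  have hconc := blocks_concentration S.n_pos (arcTuples H ℓ P Q) (fun u hu =>
    (Finset.mem_filter.1 hu).2.1) (t := ε / 4 * B) (by positivity)
  have hexp : Real.exp (-((ε / 4 * B) ^ 2 / (32 * n))) ≤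
      ((n : ℝ) ^ (2 * k + 4 * (qq k ℓ + 1) + 10))⁻¹ := by
    apply S.exp_le
    have h1 := S.le hK.blocks (a := 1) (b := 2) (c := 2 * (zz k ℓ * m)) (by omega)
      (by omega) (by
        have : zz k ℓ * m ≤ zz k ℓ * 4 := Nat.mul_le_mul_left _ (by omega)
        omega)
    have h2 : (min 1 p) ^ (2 * (zz k ℓ * m)) ≤ p ^ (2 * (zz k ℓ * m)) :=
      pow_le_pow_left₀ S.theta_pos.le (min_le_right _ _) _
    have h3 : (ε / 4 * B) ^ 2 / (32 * n) =
        ε ^ 2 * n * p ^ (2 * (zz k ℓ * m)) / (512 * (qq k ℓ : ℝ) ^ 2) := by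
      rw [hB, show p ^ (2 * (zz k ℓ * m)) = (p ^ (zz k ℓ * m)) ^ 2 by rw [← pow_mul, mul_comm 2]]
      field_simp
      ring
    rw [h3, le_div_iff₀ (by positivity)]
    push_cast
    calc _ = _ := by rw [mul_right_comm, pow_one]
      _ ≤ _ := h1
      _ ≤ _ := by gcongr
  refine (Pr_mono (unif_isProb _) fun σ hσ => ?_).trans (hconc.trans
    (mul_le_mul_of_nonneg_left hexp zero_le_two))
  by_contra hlt
  rw [not_le, abs_lt] at hlt
  apply hσ
  have hyB : 2 * (ε * B) ≤ zz k ℓ * ε * B := by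
    have := mul_le_mul_of_nonneg_right hzε hB0.le
    linarith
  obtain ⟨hl1, hl2⟩ := hlt
  constructor <;> nlinarith

open Classical in
theorem Pr_notGood_le (S : Scale k ℓ n ε p K) (hK : LargeConst k ℓ K) {H : KGraph (Fin n) k}
    (hH : H.IsRegular ℓ ε p) {r : ℕ} (hr : |(r : ℝ) - numPerms n k ℓ ε p| < 1) :
    Pr (permsWeight n r) (fun σ => ¬ GoodPerms H ℓ ε p σ) ≤ 5 * ((n : ℝ) ^ 3)⁻¹ := by
  have hW := permsWeight_isProb n r
  have hn1 : (1 : ℝ) ≤ n := by exact_mod_cast S.n_pos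
  have hn : (0 : ℝ) < n := by linarith
  have hE : (H.edges.card : ℝ) ≤ (n : ℝ) ^ k := by exact_mod_cast card_edges_le H
  set F : Finset (Finset (Fin (qq k ℓ) → Fin n)) := Finset.univ.filter fun P => P.card ≤ 2 with hF
  have hFc : (F.card : ℝ) ≤ ((n : ℝ) ^ (qq k ℓ + 1)) ^ 2 := by
    have h1 := card_finsets_card_le_two (Fin (qq k ℓ) → Fin n)
    rw [Fintype.card_fun, Fintype.card_fin, Fintype.card_fin] at h1
    have h2 : n ^ qq k ℓ + 1 ≤ n ^ (qq k ℓ + 1) := by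
      have h2 : (2 : ℝ) ≤ n := S.le_n (le_trans (by
        have : (1 : ℝ) ≤ qq k ℓ := by exact_mod_cast S.qq_pos
        push_cast
        nlinarith) hK.desc)
      have h2 : 2 ≤ n := by exact_mod_cast h2
      have := Nat.one_le_pow (qq k ℓ) n S.n_pos
      rw [pow_succ]
      nlinarith
    exact_mod_cast h1.trans (Nat.pow_le_pow_left h2 2)
  have b1 := Pr_exists_le hW H.edges fun e (σ : Fin r → Equiv.Perm (Fin n)) =>
    ¬ ((1 - 2 * (zz k ℓ * ε)) * kap n k ε ≤ (indexSet H ℓ σ e).card ∧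
        ((indexSet H ℓ σ e).card : ℝ) ≤ (1 + 2 * (zz k ℓ * ε)) * kap n k ε)
  have b2 := Pr_exists_le hW H.edges.offDiag fun y (σ : Fin r → Equiv.Perm (Fin n)) =>
    ¬ ((Finset.univ.filter fun i => CoOwned H ℓ (σ i) y.1 y.2).card : ℝ) ≤ ε ^ 2 * kap n k ε
  -- The pairs range over all sets of at most two tuples; blocks of a permutation always satisfy the
  -- disjointness filter.
  have b3 := Pr_exists_le hW ((Finset.univ : Finset (Fin r)) ×ˢ
    (F ×ˢ F).filter fun y => DisjointTuples (y.1 ∪ y.2))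
    fun y (σ : Fin r → Equiv.Perm (Fin n)) => ¬ Within (2 * (zz k ℓ * ε))
        ((Finset.univ.filter fun x => block (qq k ℓ) (σ y.1) x ∈
          arcTuples H ℓ y.2.1 y.2.2).card : ℝ)
        (n / qq k ℓ * p ^ (zz k ℓ * (y.2.1.card + y.2.2.card)))
  have c1 : ∑ e ∈ H.edges, Pr (permsWeight n r) (fun σ =>
      ¬ ((1 - 2 * (zz k ℓ * ε)) * kap n k ε ≤ (indexSet H ℓ σ e).card ∧
        ((indexSet H ℓ σ e).card : ℝ) ≤ (1 + 2 * (zz k ℓ * ε)) * kap n k ε)) ≤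
      2 * ((n : ℝ) ^ 3)⁻¹ := by
    refine (Finset.sum_le_card_nsmul _ _ _ fun e he => S.Pr_index_bad hK hH hr he).trans ?_
    rw [nsmul_eq_mul]
    calc _ ≤ (n : ℝ) ^ k * (2 * ((n : ℝ) ^ (3 * (k + 1)))⁻¹) := by gcongr
      _ = 2 * ((n : ℝ) ^ (2 * k + 3))⁻¹ := by
        rw [show 3 * (k + 1) = k + (2 * k + 3) by ring, pow_add]
        field_simp
      _ ≤ _ := by gcongr; omega
  have c2 : ∑ y ∈ H.edges.offDiag, Pr (permsWeight n r) (fun σ =>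
      ¬ ((Finset.univ.filter fun i => CoOwned H ℓ (σ i) y.1 y.2).card : ℝ) ≤
        ε ^ 2 * kap n k ε) ≤ ((n : ℝ) ^ 3)⁻¹ := by
    refine (Finset.sum_le_card_nsmul _ _ ((n : ℝ) ^ (3 * (k + 1)))⁻¹ fun y hy => ?_).trans ?_
    · obtain ⟨h1, h2, h3⟩ := Finset.mem_offDiag.1 hy
      exact S.Pr_coOwned_bad hK hr h1 h2 h3
    rw [nsmul_eq_mul]
    have : (H.edges.offDiag.card : ℝ) ≤ (n : ℝ) ^ k * (n : ℝ) ^ k := by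
      have h1 : H.edges.offDiag.card ≤ n ^ k * n ^ k := by
        rw [Finset.offDiag_card]
        exact (Nat.sub_le _ _).trans (Nat.mul_le_mul (card_edges_le H) (card_edges_le H))
      exact_mod_cast h1
    calc _ ≤ (n : ℝ) ^ k * (n : ℝ) ^ k * ((n : ℝ) ^ (3 * (k + 1)))⁻¹ := by gcongr
      _ = ((n : ℝ) ^ (k + 3))⁻¹ := by
        rw [show 3 * (k + 1) = k + k + (k + 3) by ring, pow_add, pow_add]
        field_simp
      _ ≤ _ := by gcongr; omega
  have c3 : ∑ y ∈ (Finset.univ : Finset (Fin r)) ×ˢ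
      (F ×ˢ F).filter (fun y => DisjointTuples (y.1 ∪ y.2)), Pr (permsWeight n r) (fun σ =>
        ¬ Within (2 * (zz k ℓ * ε))
        ((Finset.univ.filter fun x => block (qq k ℓ) (σ y.1) x ∈
          arcTuples H ℓ y.2.1 y.2.2).card : ℝ)
        (n / qq k ℓ * p ^ (zz k ℓ * (y.2.1.card + y.2.2.card)))) ≤ 2 * ((n : ℝ) ^ 3)⁻¹ := by
    refine (Finset.sum_le_card_nsmul _ _ (2 * ((n : ℝ) ^ (2 * k + 4 * (qq k ℓ + 1) + 10))⁻¹)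
      fun y hy => ?_).trans ?_
    · obtain ⟨-, hy⟩ := Finset.mem_product.1 hy
      obtain ⟨hy, hd⟩ := Finset.mem_filter.1 hy
      obtain ⟨h1, h2⟩ := Finset.mem_product.1 hy
      rw [Pr_perms_single y.1 fun τ => ¬ Within (2 * (zz k ℓ * ε))
        ((Finset.univ.filter fun x => block (qq k ℓ) τ x ∈
          arcTuples H ℓ y.2.1 y.2.2).card : ℝ)
        (n / qq k ℓ * p ^ (zz k ℓ * (y.2.1.card + y.2.2.card)))]
      exact S.Pr_blocks_bad hK hH (Finset.mem_filter.1 h1).2 (Finset.mem_filter.1 h2).2 hd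
    rw [nsmul_eq_mul, Finset.card_product, Finset.card_univ, Fintype.card_fin]
    have h1 : (((F ×ˢ F).filter fun y => DisjointTuples (y.1 ∪ y.2)).card : ℝ) ≤
        ((n : ℝ) ^ (qq k ℓ + 1)) ^ 2 * ((n : ℝ) ^ (qq k ℓ + 1)) ^ 2 := by
      refine le_trans (Nat.cast_le.2 (Finset.card_filter_le _ _)) ?_
      rw [Finset.card_product, Nat.cast_mul]
      gcongr
    have h2 := S.perms_le_pow hK hr
    push_cast
    calc _ ≤ (n : ℝ) ^ k * (((n : ℝ) ^ (qq k ℓ + 1)) ^ 2 * ((n : ℝ) ^ (qq k ℓ + 1)) ^ 2) *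
          (2 * ((n : ℝ) ^ (2 * k + 4 * (qq k ℓ + 1) + 10))⁻¹) := by gcongr
      _ = 2 * ((n : ℝ) ^ (k + 10))⁻¹ := by
        generalize qq k ℓ + 1 = b
        rw [show 2 * k + 4 * b + 10 = k + (b * 2 + b * 2) + (k + 10) by ring,
          pow_add _ (k + (b * 2 + b * 2)), pow_add _ k (b * 2 + b * 2), pow_add _ (b * 2),
          pow_mul]
        field_simp
      _ ≤ _ := by gcongr; omega
  refine (Pr_mono hW (B := fun σ => (_ ∨ _) ∨ _) fun σ hσ => ?_).trans ((Pr_or_le hW _ _).trans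
    (add_le_add ((Pr_or_le hW _ _).trans (add_le_add (b1.trans c1) (b2.trans c2)))
      (b3.trans c3))|>.trans (by linarith))
  by_contra hcon
  push Not at hcon
  obtain ⟨⟨g1, g2⟩, g3⟩ := hcon
  refine hσ ⟨⟨mul_pos ?_ S.kap_pos, fun e he => (g1 e he).1, fun e he => (g1 e he).2⟩,
    fun e he e' he' hne => g2 (e, e') (Finset.mem_offDiag.2 ⟨he, he', hne⟩),
    fun i P Q hP hQ => ?_⟩
  · linarith [S.zz_eps.1]
  · have hinj := block_ne S.qq_pos (σ i)
    have h := g3 (i, P.image (block (qq k ℓ) (σ i)), Q.image (block (qq k ℓ) (σ i)))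
      (Finset.mem_product.2 ⟨Finset.mem_univ _, Finset.mem_filter.2 ⟨Finset.mem_product.2
        ⟨Finset.mem_filter.2 ⟨Finset.mem_univ _, by rwa [Finset.card_image_of_injective _ hinj]⟩,
          Finset.mem_filter.2 ⟨Finset.mem_univ _, by rwa [Finset.card_image_of_injective _ hinj]⟩⟩,
        by rw [← Finset.image_union]; exact disjointTuples_blocks _ _⟩⟩)
    rw [Finset.card_image_of_injective _ hinj, Finset.card_image_of_injective _ hinj] at h
    rw [commonNbrs_eq_blocks S.l_pos S.l_lt]
    exact h

end Scale

/-! ### Regularity of the pruned digraphs. -/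

theorem digraphRegular_of_commonNbrs {m : ℕ} {D : Digraph (Fin m)} {ε p : ℝ}
    (h : ∀ P Q : Finset (Fin m), P.card ≤ 2 → Q.card ≤ 2 →
      Within ε ((commonNbrs D P Q).card : ℝ) (m * p ^ (P.card + Q.card))) :
    DigraphRegular D ε p := by
  classical
  have h' : ∀ (P Q : Finset (Fin m)) (s : Finset (Fin m)) (j : ℕ), P.card ≤ 2 → Q.card ≤ 2 →
      P.card + Q.card = j → (∀ x, x ∈ s ↔ (∀ a ∈ P, D.Adj a x) ∧ ∀ b ∈ Q, D.Adj x b) →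
      Within ε (s.card : ℝ) (Fintype.card (Fin m) * p ^ j) := by
    intro P Q s j hP hQ hj hs
    have : s = commonNbrs D P Q := by
      ext x
      rw [hs, mem_commonNbrs]
    rw [this, ← hj, Fintype.card_fin]
    exact h P Q hP hQ
  refine ⟨fun a => ⟨?_, ?_⟩, fun a b hab => ⟨?_, ?_, ?_⟩, fun a b c d hab hac had hbd hcd => ?_⟩
  · rw [← pow_one p]
    exact h' {a} ∅ _ 1 (by simp) (by simp) (by simp) (by simp)
  · rw [← pow_one p]
    exact h' ∅ {a} _ 1 (by simp) (by simp) (by simp) (by simp)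
  · exact h' {a, b} ∅ _ 2 Finset.card_le_two (by simp) (by simp [Finset.card_pair hab]) (by simp)
  · exact h' ∅ {a, b} _ 2 (by simp) Finset.card_le_two (by simp [Finset.card_pair hab]) (by simp)
  · exact h' {a} {b} _ 2 (by simp) (by simp) (by simp) (by simp)
  -- The two sets may share the vertex `b = c`; only their sizes matter.
  · refine h' {a, c} {b, d} _ 4 Finset.card_le_two Finset.card_le_two
      (by rw [Finset.card_pair hac, Finset.card_pair hbd]) fun x => ?_
    simp only [Finset.mem_filter, Finset.mem_univ, true_and, Finset.mem_insert,
      Finset.mem_singleton, forall_eq_or_imp, forall_eq]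
    tauto

namespace Scale

variable {k ℓ n : ℕ} {ε p K : ℝ}

/-- The worst case is `m = 4 * z`. Because `κ ^ (4z) * ε ^ (8z)` is the power `4z` of `6 * (k + 1) *
log n`, the requirement becomes that `ε ^ (8z + 2) * n * p ^ (4z)` exceeds a multiple of `log n ^
(4z + 1)`. -/
theorem exp_nbrs_le (S : Scale k ℓ n ε p K) (hK : LargeConst k ℓ K) {m : ℕ} {w : ℝ}
    (hm4 : m ≤ zz k ℓ * 4) (hw : ε ≤ w) (hw1 : w ≤ 1 / 1000) :
    Real.exp (-((w * (n / qq k ℓ * (p / kap n k ε) ^ m)) ^ 2 /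
      (4 * ((1 + 10 * w) * (n / qq k ℓ * (p / kap n k ε) ^ m))))) ≤ ((n : ℝ) ^ (k + 12))⁻¹ := by
  have hn : (0 : ℝ) < n := by exact_mod_cast S.n_pos
  have hq : (0 : ℝ) < qq k ℓ := by exact_mod_cast S.qq_pos
  have hp := S.p_pos
  have hε := S.eps_pos
  have hκ := S.kap_pos
  have hκ1 := S.one_le_kap
  have hκe := S.kap_eq
  have hw0 : 0 < w := hε.trans_le hw
  generalize kap n k ε = κ at *
  obtain ⟨B, hB⟩ : ∃ B : ℝ, B = n / qq k ℓ * (p / κ) ^ m := ⟨_, rfl⟩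
  rw [← hB]
  have hB0 : 0 < B := by rw [hB]; positivity
  apply S.exp_le
  have h1 := S.le hK.nbrs (a := 4 * zz k ℓ + 1) (b := 8 * zz k ℓ + 2)
    (c := 4 * zz k ℓ) le_rfl le_rfl (by omega)
  have hθ := S.theta_pos
  have h2 : (min 1 p / κ) ^ (zz k ℓ * 4) ≤ (p / κ) ^ m := by
    calc (min 1 p / κ) ^ (zz k ℓ * 4) ≤ (min 1 p / κ) ^ m :=
          pow_le_pow_of_le_one (by positivity)
            (div_le_one_of_le₀ (S.theta_le_one.trans hκ1) hκ.le) hm4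
      _ ≤ _ := by gcongr; exact min_le_right _ _
  have hκ4 : κ ^ (zz k ℓ * 4) * ε ^ (8 * zz k ℓ) =
      (6 * (k + 1)) ^ (4 * zz k ℓ) * Real.log n ^ (4 * zz k ℓ) := by
    rw [← mul_pow, ← hκe, mul_pow, ← pow_mul]
    ring
  have h3 : (k + 12 : ℕ) * Real.log n * (8 * qq k ℓ) ≤
      ε ^ 2 * (n * (min 1 p / κ) ^ (zz k ℓ * 4)) := by
    rw [div_pow, ← mul_div_assoc, ← mul_div_assoc, le_div_iff₀ (by positivity)]
    refine le_of_mul_le_mul_right ?_ (show 0 < ε ^ (8 * zz k ℓ) by positivity)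
    calc _ = (k + 12 : ℕ) * Real.log n * (8 * qq k ℓ) *
          (κ ^ (zz k ℓ * 4) * ε ^ (8 * zz k ℓ)) := by ring
      _ = (k + 12 : ℝ) * (8 * qq k ℓ) * (6 * (k + 1)) ^ (4 * zz k ℓ) *
          Real.log n ^ (4 * zz k ℓ + 1) := by rw [hκ4]; push_cast; ring
      _ ≤ _ := h1
      _ = _ := by ring
  have h4 : ε ^ 2 ≤ w ^ 2 := by gcongr
  rw [le_div_iff₀ (by positivity)]
  have h5 : (n : ℝ) * (min 1 p / κ) ^ (zz k ℓ * 4) ≤ qq k ℓ * B := by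
    calc (n : ℝ) * (min 1 p / κ) ^ (zz k ℓ * 4) ≤ n * (p / κ) ^ m := by gcongr
      _ = qq k ℓ * B := by rw [hB]; field_simp
  have h6 : (k + 12 : ℕ) * Real.log n * 8 ≤ w ^ 2 * B := by
    refine le_of_mul_le_mul_right ?_ hq
    calc _ = (k + 12 : ℕ) * Real.log n * (8 * qq k ℓ) := by ring
      _ ≤ _ := h3
      _ ≤ w ^ 2 * (qq k ℓ * B) := by gcongr
      _ = _ := by ring
  have h7 : 0 ≤ (k + 12 : ℕ) * Real.log n := by have := S.log_ge_one; positivity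
  calc _ ≤ (k + 12 : ℕ) * Real.log n * (4 * (2 * B)) := by gcongr; linarith
    _ = (k + 12 : ℕ) * Real.log n * 8 * B := by ring
    _ ≤ w ^ 2 * B * B := by gcongr
    _ = _ := by ring

/-- The constant `12`, in units of `w = z ^ 2 * ε`: the neighbourhood before pruning has error `2 *
z * ε ≤ w`, the at most `4 * z` label probabilities have error `2 * z * ε` each, hence `8 * w`, and
the random deviation is `w`. The rest is room for products of errors. -/
theorem Pr_nbrs_bad (S : Scale k ℓ n ε p K) (hK : LargeConst k ℓ K) {H : KGraph (Fin n) k}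
    {r : ℕ} {σ : Fin r → Equiv.Perm (Fin n)} (hσ : GoodPerms H ℓ ε p σ) (i : Fin r)
    {P Q : Finset (Fin (n / qq k ℓ))} (hP : P.card ≤ 2) (hQ : Q.card ≤ 2) :
    Pr (labelsWeight H ℓ σ) (fun lab =>
      ¬ Within (12 * (zz k ℓ : ℝ) ^ 2 * ε)
        ((commonNbrs (prunedDigraph H ℓ (σ, lab) i) P Q).card : ℝ)
        ((n / qq k ℓ : ℕ) * ((p / kap n k ε) ^ zz k ℓ) ^ (P.card + Q.card))) ≤
      2 * ((n : ℝ) ^ (k + 12))⁻¹ := by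
  have hn : (0 : ℝ) < n := by exact_mod_cast S.n_pos
  have hq : (0 : ℝ) < qq k ℓ := by exact_mod_cast S.qq_pos
  have hp := S.p_pos
  have hε := S.eps_pos
  have hz := S.two_le_zz
  have hκ := S.kap_pos
  have hκ1 := S.one_le_kap
  have hw1 := S.zz_eps.2.2
  obtain ⟨c1, c2⟩ := hσ.nbrs i P Q hP hQ
  rw [S.cast_div, ← pow_mul]
  have hm4 : zz k ℓ * (P.card + Q.card) ≤ zz k ℓ * 4 := Nat.mul_le_mul_left _ (by omega)
  set m := zz k ℓ * (P.card + Q.card) with hm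
  set κ := kap n k ε with hκdef
  set w : ℝ := (zz k ℓ : ℝ) ^ 2 * ε with hw
  set y : ℝ := zz k ℓ * ε with hy
  have hw0 : 0 < w := by positivity
  have hy0 : 0 < y := by positivity
  have hyw : 2 * y ≤ w := by
    have := mul_le_mul_of_nonneg_right hz hy0.le
    calc 2 * y ≤ zz k ℓ * y := this
      _ = w := by rw [hy, hw]; ring
  have hmy : (m : ℝ) * (2 * y) ≤ 8 * w := by
    have : (m : ℝ) ≤ zz k ℓ * 4 := by exact_mod_cast hm4
    calc (m : ℝ) * (2 * y) ≤ zz k ℓ * 4 * (2 * y) := by gcongr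
      _ = 8 * w := by rw [hy, hw]; ring
  have hlo : 1 - 8 * w ≤ (1 - 2 * y) ^ m := by
    have := one_sub_pow_ge (e := 2 * y) (m := m) (by linarith)
    linarith
  have hhi : (1 + 2 * y) ^ m ≤ 1 + 9 * w := by
    have := one_add_pow_le (e := 2 * y) (m := m) (by linarith) (by linarith)
    linarith
  set A : ℝ := n / qq k ℓ * p ^ m with hA
  have hA0 : 0 < A := by positivity
  set B : ℝ := n / qq k ℓ * (p / κ) ^ m with hB
  have hB0 : 0 < B := by positivity
  have hAB : A * κ⁻¹ ^ m = B := by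
    rw [hA, hB, div_eq_mul_inv p, mul_pow]
    ring
  have hy1 : 0 < 1 - 2 * y := by linarith
  have hM2 : ((commonNbrs (permDigraph H ℓ (σ i)) P Q).card : ℝ) * ((1 - 2 * y) * κ)⁻¹ ^ m ≤
      (1 + 10 * w) * B := by
    rw [mul_inv, mul_pow, ← hAB]
    have h1 : (1 - 2 * y)⁻¹ ^ m ≤ (1 - 8 * w)⁻¹ := by
      rw [inv_pow]
      exact inv_anti₀ (by linarith) hlo
    have h2 : (1 + w) * (1 - 8 * w)⁻¹ ≤ 1 + 10 * w := by
      rw [← div_eq_mul_inv, div_le_iff₀ (by linarith)]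
      nlinarith
    calc _ ≤ ((1 + w) * A) * ((1 - 8 * w)⁻¹ * κ⁻¹ ^ m) := by
          gcongr
          exact c2.trans (mul_le_mul_of_nonneg_right (by linarith) hA0.le)
      _ = ((1 + w) * (1 - 8 * w)⁻¹) * (A * κ⁻¹ ^ m) := by ring
      _ ≤ _ := by gcongr
  have hM1 : (1 - 10 * w) * B ≤
      ((commonNbrs (permDigraph H ℓ (σ i)) P Q).card : ℝ) * ((1 + 2 * y) * κ)⁻¹ ^ m := by
    rw [mul_inv, mul_pow, ← hAB]
    have h1 : (1 + 9 * w)⁻¹ ≤ (1 + 2 * y)⁻¹ ^ m := by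
      rw [inv_pow]
      exact inv_anti₀ (by positivity) hhi
    have h2 : 1 - 10 * w ≤ (1 - w) * (1 + 9 * w)⁻¹ := by
      rw [← div_eq_mul_inv, le_div_iff₀ (by linarith)]
      nlinarith
    have h3 : 0 ≤ 1 - w := by linarith
    calc (1 - 10 * w) * (A * κ⁻¹ ^ m) ≤ ((1 - w) * (1 + 9 * w)⁻¹) * (A * κ⁻¹ ^ m) := by gcongr
      _ = ((1 - w) * A) * ((1 + 9 * w)⁻¹ * κ⁻¹ ^ m) := by ring
      _ ≤ _ := by
          gcongr
          exact le_trans (mul_le_mul_of_nonneg_right (by linarith) hA0.le) c1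
  have ht : w * B ≤ 2 * ((1 - 10 * w) * B) := by
    have := mul_le_mul_of_nonneg_right (show w ≤ 2 * (1 - 10 * w) by linarith) hB0.le
    linarith
  have hconc := commonNbrs_concentration S.l_pos S.l_lt hσ.index i P Q
    (M₁ := (1 - 10 * w) * B) (M₂ := (1 + 10 * w) * B) (t := w * B)
    (mul_pos (by linarith) hB0) (by positivity)
    ht (mul_le_mul_of_nonneg_right (show 1 - 10 * w ≤ 1 + 10 * w by linarith) hB0.le) hM1 hM2
  have hεw : ε ≤ w := by linarith [mul_le_mul_of_nonneg_right hz hε.le]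
  have hexp := S.exp_nbrs_le hK (m := m) (w := w) (hm4.trans le_rfl) hεw (by linarith)
  rw [← hκdef, ← hB] at hexp
  refine (Pr_mono labelsWeight_isProb fun lab hlab hgood => hlab ?_).trans (hconc.trans
    (mul_le_mul_of_nonneg_left hexp zero_le_two))
  rw [mul_assoc 12, ← hw]
  obtain ⟨g1, g2⟩ := hgood
  have := mul_pos hw0 hB0
  constructor <;> linarith

end Scale

/-! ### Regularity of the leftover hypergraph. -/

theorem one_sub_pow_le {x : ℝ} {s : ℕ} (hx : 0 ≤ x) (hx1 : x ≤ 1) :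
    (1 - x) ^ s ≤ 1 - s * x + (s * x) ^ 2 := by
  have h1 : 1 + s * x ≤ (1 + x) ^ s := one_add_mul_le_pow (by linarith) s
  have h2 : (1 + x) ^ s * (1 - x) ^ s ≤ 1 := by
    rw [← mul_pow]
    exact pow_le_one₀ (by nlinarith) (by nlinarith)
  have h3 : (0 : ℝ) ≤ (1 - x) ^ s := pow_nonneg (by linarith) s
  have h4 : 0 ≤ s * x := by positivity
  have h5 : (1 + s * x) * (1 - x) ^ s ≤ 1 := (mul_le_mul_of_nonneg_right h1 h3).trans h2
  have h6 : 1 ≤ (1 + s * x) * (1 - s * x + (s * x) ^ 2) := by nlinarith [pow_nonneg h4 3]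
  exact le_of_mul_le_mul_left (h5.trans h6) (by positivity)

/-- From estimates for the mean of `X` and for its deviation from the mean to an estimate
for `X` relative to `B (1 - x) ^ s`. -/
theorem within_of_mean {ε x G S B c X E v : ℝ} (hε : 0 < ε) (hε1 : ε ≤ 1 / 4000) (hx : 0 < x)
    (hG : 8 * (ε * x) ≤ G) (hG1 : G ≤ 1 / 1000) (hS1 : S ≤ 1 / 100) (hB : 0 < B)
    (hc : Within ε c B) (hv1 : 1 - S ≤ v) (hv2 : v ≤ 1 - S + ε * x / 100)
    (hE1 : c * (1 - S - 412 / 100 * G) ≤ E)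
    (hE2 : E ≤ c * (1 - S + 412 / 100 * G + ε * x / 50)) (hX : |X - E| ≤ ε * x * B) :
    Within (ε + 7 * G) X (B * v) := by
  obtain ⟨hc1, hc2⟩ := hc
  -- In the application `x = κ ^ (-(z - 1))`, `S = s * x`, `G = z ^ 3 * ε * x` and `v = (1 - x) ^
  -- s`. The error `ε` of `c` passes through unchanged; the mean adds `4.12 * G` and the deviation
  -- at most `G / 8`, which after division by `v` is below `7 * G`.
  have hg : 0 < ε * x := mul_pos hε hx
  set g := ε * x with hgdef
  rw [abs_le] at hX
  have hG0 : 0 < G := by linarith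
  constructor
  · have h1 : (1 - ε) * B * (1 - S - 412 / 100 * G) - g * B ≤ X := by
      have := mul_le_mul_of_nonneg_right hc1 (show 0 ≤ 1 - S - 412 / 100 * G by linarith)
      linarith [hX.1]
    have h2 : (1 - (ε + 7 * G)) * (B * v) ≤ (1 - (ε + 7 * G)) * (B * (1 - S + g / 100)) := by
      have : 0 ≤ 1 - (ε + 7 * G) := by linarith
      gcongr
    have h3 : (1 - (ε + 7 * G)) * (1 - S + g / 100) ≤ (1 - ε) * (1 - S - 412 / 100 * G) - g := by
      have a1 : 0 ≤ G * g := by positivity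
      have a2 : G * S ≤ G * (1 / 100) := by gcongr
      have a3 : 0 ≤ ε * G := by positivity
      have a4 : 0 ≤ ε * g := by positivity
      linarith
    have h4 := mul_le_mul_of_nonneg_right h3 hB.le
    linarith
  · have h1 : X ≤ (1 + ε) * B * (1 - S + 412 / 100 * G + g / 50) + g * B := by
      have := mul_le_mul_of_nonneg_right hc2 (show 0 ≤ 1 - S + 412 / 100 * G + g / 50 by linarith)
      linarith [hX.2]
    have h2 : (1 + (ε + 7 * G)) * (B * (1 - S)) ≤ (1 + (ε + 7 * G)) * (B * v) := by gcongr
    have h3 : (1 + ε) * (1 - S + 412 / 100 * G + g / 50) + g ≤ (1 + (ε + 7 * G)) * (1 - S) := by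
      have a2 : G * S ≤ G * (1 / 100) := by gcongr
      have a3 : ε * G ≤ 1 / 4000 * G := by gcongr
      have a4 : ε * g ≤ 1 / 4000 * g := by gcongr
      linarith
    have h4 := mul_le_mul_of_nonneg_right h3 hB.le
    linarith

namespace Scale

variable {k ℓ n : ℕ} {ε p K : ℝ}

/-- A deviation `ε * B / κ ^ (z - 1)` against a sum of squares of order `κ * B` leaves an exponent
of order `ε ^ 2 * B / κ ^ (2z - 1)`, where `B` is at least of order `n * (min 1 p) ^ (2z + 2)`. -/
theorem exp_leftover_le (S : Scale k ℓ n ε p K) (hK : LargeConst k ℓ K) {d s : ℕ} (hd1 : 1 ≤ d)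
    (hd : d ≤ ℓ) (hs : s ≤ 2 * zz k ℓ + 2) :
    Real.exp (-((ε * (1 / kap n k ε ^ (zz k ℓ - 1)) *
        ((n : ℝ) ^ d / d.factorial * p ^ s)) ^ 2 /
      (2 * (432 * (zz k ℓ : ℝ) ^ 6 * kap n k ε * ((n : ℝ) ^ d / d.factorial * p ^ s))))) ≤
      ((n : ℝ) ^ (k * (2 * zz k ℓ + 2) + k + 2 * zz k ℓ + 10))⁻¹ := by
  have hn1 : (1 : ℝ) ≤ n := by exact_mod_cast S.n_pos
  have hn : (0 : ℝ) < n := by linarith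
  have hp := S.p_pos
  have hε := S.eps_pos
  have hκ := S.kap_pos
  have hκe := S.kap_eq
  have hL := S.log_ge_one
  have hθ := S.theta_pos
  have hz := S.two_le_zz
  have hz2 := (params_facts S.l_pos S.l_lt).1
  generalize kap n k ε = κ at *
  obtain ⟨B, hB⟩ : ∃ B : ℝ, B = (n : ℝ) ^ d / d.factorial * p ^ s := ⟨_, rfl⟩
  rw [← hB]
  have hB0 : 0 < B := by rw [hB]; positivity
  have h1 : (n : ℝ) * (min 1 p) ^ (2 * zz k ℓ + 2) ≤ ℓ.factorial * B := by
    have hf : (d.factorial : ℝ) ≤ ℓ.factorial := by exact_mod_cast Nat.factorial_le hd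
    have hth : (min 1 p) ^ (2 * zz k ℓ + 2) ≤ p ^ s :=
      (pow_le_pow_of_le_one hθ.le S.theta_le_one hs).trans
        (pow_le_pow_left₀ hθ.le (min_le_right _ _) s)
    calc (n : ℝ) * (min 1 p) ^ (2 * zz k ℓ + 2) ≤ n ^ d * p ^ s := by
          gcongr
          exact le_self_pow₀ hn1 (by omega)
      _ = d.factorial * B := by rw [hB]; field_simp
      _ ≤ _ := by gcongr
  have h2 := S.le hK.leftover (a := 2 * zz k ℓ) (b := 4 * zz k ℓ)
    (c := 2 * zz k ℓ + 2) (by omega) (by omega) (by omega)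
  apply S.exp_le
  set M : ℝ := k * (2 * zz k ℓ + 2) + k + 2 * zz k ℓ + 10 with hM
  have hMc : ((k * (2 * zz k ℓ + 2) + k + 2 * zz k ℓ + 10 : ℕ) : ℝ) = M := by push_cast; rfl
  rw [hMc]
  have hM0 : 0 < M := by positivity
  have e1 : κ ^ (2 * zz k ℓ - 1) = (κ ^ (zz k ℓ - 1)) ^ 2 * κ := by
    rw [← pow_mul, ← pow_succ]
    congr 1
    omega
  have e2 : κ ^ (2 * zz k ℓ - 1) * ε ^ (4 * zz k ℓ - 2) =
      (6 * (k + 1)) ^ (2 * zz k ℓ - 1) * Real.log n ^ (2 * zz k ℓ - 1) := by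
    rw [← mul_pow, ← hκe, mul_pow, ← pow_mul, mul_comm]
    congr 2
    omega
  have e3 : Real.log n ^ (2 * zz k ℓ) = Real.log n ^ (2 * zz k ℓ - 1) * Real.log n := by
    rw [← pow_succ]; congr 1; omega
  have e4 : ε ^ (4 * zz k ℓ) = ε ^ (4 * zz k ℓ - 2) * ε ^ 2 := by
    rw [← pow_add]; congr 1; omega
  have h3 : M * Real.log n * (1000 * (zz k ℓ : ℝ) ^ 6) * κ ^ (2 * zz k ℓ - 1) ≤ ε ^ 2 * B := by
    refine le_of_mul_le_mul_left ?_ (show 0 < ε ^ (4 * zz k ℓ - 2) * ℓ.factorial by positivity)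
    calc _ = M * (1000 * (zz k ℓ : ℝ) ^ 6 * ℓ.factorial) * Real.log n *
          (κ ^ (2 * zz k ℓ - 1) * ε ^ (4 * zz k ℓ - 2)) := by ring
      _ = M * (1000 * (zz k ℓ : ℝ) ^ 6 * ℓ.factorial) * (6 * (k + 1)) ^ (2 * zz k ℓ - 1) *
          Real.log n ^ (2 * zz k ℓ) := by rw [e2, e3]; ring
      _ ≤ ε ^ (4 * zz k ℓ) * n * (min 1 p) ^ (2 * zz k ℓ + 2) := h2
      _ = ε ^ (4 * zz k ℓ - 2) * ε ^ 2 * (n * (min 1 p) ^ (2 * zz k ℓ + 2)) := by rw [e4]; ring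
      _ ≤ ε ^ (4 * zz k ℓ - 2) * ε ^ 2 * (ℓ.factorial * B) := by gcongr
      _ = _ := by ring
  rw [e1] at h3
  set u := κ ^ (zz k ℓ - 1) with hu
  have hu0 : 0 < u := by positivity
  rw [le_div_iff₀ (by positivity)]
  calc M * Real.log n * (2 * (432 * (zz k ℓ : ℝ) ^ 6 * κ * B))
      = (864 / 1000) * (M * Real.log n * (1000 * (zz k ℓ : ℝ) ^ 6) * (u ^ 2 * κ)) * B / u ^ 2 := by
        field_simp
        ring
    _ ≤ 1 * (M * Real.log n * (1000 * (zz k ℓ : ℝ) ^ 6) * (u ^ 2 * κ)) * B / u ^ 2 := by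
        gcongr
        norm_num
    _ ≤ 1 * (ε ^ 2 * B) * B / u ^ 2 := by gcongr
    _ = _ := by field_simp

/-- Here `x` is the ideal probability that an edge is removed and `u` the relative error of a
product of `z - 1` index sizes. The third estimate bounds the second-order terms of Bonferroni: the
square is small because `x ≤ ε ^ 2`, the co-owned pairs because `ε ^ 2 * κ * κ ^ (-z) = ε ^ 2 * x`.
-/
theorem index_pow_bounds (S : Scale k ℓ n ε p K) {x u : ℝ}
    (hx : x = 1 / kap n k ε ^ (zz k ℓ - 1)) (hu : u = 2 * (zz k ℓ - 1) * (zz k ℓ * ε)) :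
    ((1 - 2 * (zz k ℓ * ε)) * kap n k ε)⁻¹ ^ (zz k ℓ - 1) ≤ (1 + 103 / 100 * u) * x ∧
    (1 - 103 / 100 * u) * x ≤ ((1 + 2 * (zz k ℓ * ε)) * kap n k ε)⁻¹ ^ (zz k ℓ - 1) ∧
    (((1 - 2 * (zz k ℓ * ε)) * kap n k ε)⁻¹ ^ (zz k ℓ - 1)) ^ 2 + ε ^ 2 * kap n k ε *
      ((1 - 2 * (zz k ℓ * ε)) * kap n k ε)⁻¹ ^ zz k ℓ ≤ 21 / 10 * (ε ^ 2 * x) ∧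
    0 < x ∧ x ≤ ε ^ 2 ∧ 0 ≤ u := by
  have hε := S.eps_pos
  have hκ := S.kap_pos
  have hκ1 := S.one_le_kap
  have hκ6 := S.eps_sq_kap
  have hz := S.two_le_zz
  have hz2 := (params_facts S.l_pos S.l_lt).1
  obtain ⟨-, hε1, hw⟩ := S.zz_eps
  generalize kap n k ε = κ at *
  set z : ℝ := (zz k ℓ : ℝ) with hzdef
  have hx0 : 0 < x := by rw [hx]; positivity
  have hxκ : κ⁻¹ ^ (zz k ℓ - 1) = x := by rw [hx, inv_pow, one_div]
  have hxε : x ≤ ε ^ 2 := by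
    rw [← hxκ]
    have h1 : κ⁻¹ ≤ ε ^ 2 := by
      rw [inv_le_iff_one_le_mul₀ hκ]
      linarith
    refine le_trans ?_ h1
    calc κ⁻¹ ^ (zz k ℓ - 1) ≤ κ⁻¹ ^ 1 :=
          pow_le_pow_of_le_one (by positivity) (inv_le_one_of_one_le₀ hκ1) (by omega)
      _ = κ⁻¹ := pow_one _
  set y : ℝ := z * ε with hy
  have hy0 : 0 < y := by positivity
  have hzy : z * y ≤ 1 / 1000 := by rw [hy]; linarith
  have hy1 : y ≤ 1 / 2000 := by nlinarith
  have hu0 : 0 ≤ u := by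
    have : 0 ≤ z - 1 := by linarith
    rw [hu]
    positivity
  have hu1 : u ≤ 1 / 500 := by rw [hu]; linarith
  have hzc : ((zz k ℓ - 1 : ℕ) : ℝ) * (2 * y) = u := by
    rw [Nat.cast_sub (by omega), hu]
    push_cast
    ring
  have hlo : 1 - u ≤ (1 - 2 * y) ^ (zz k ℓ - 1) := by
    have := one_sub_pow_ge (e := 2 * y) (m := zz k ℓ - 1) (by linarith)
    linarith
  have hhi : (1 + 2 * y) ^ (zz k ℓ - 1) ≤ 1 + 103 / 100 * u := by
    have := one_add_pow_le (e := 2 * y) (m := zz k ℓ - 1) (by linarith) (by linarith)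
    linarith
  have ha : ((1 - 2 * y) * κ)⁻¹ ^ (zz k ℓ - 1) ≤ (1 + 103 / 100 * u) * x := by
    rw [mul_inv, mul_pow, hxκ]
    gcongr
    rw [inv_pow]
    refine (inv_anti₀ (by linarith) hlo).trans ?_
    rw [inv_le_iff_one_le_mul₀ (by linarith)]
    nlinarith
  have hb : (1 - 103 / 100 * u) * x ≤ ((1 + 2 * y) * κ)⁻¹ ^ (zz k ℓ - 1) := by
    rw [mul_inv, mul_pow, hxκ]
    gcongr
    rw [inv_pow]
    refine le_trans ?_ (inv_anti₀ (by positivity) hhi)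
    rw [← one_div, le_div_iff₀ (by linarith)]
    nlinarith
  set a := ((1 - 2 * y) * κ)⁻¹ ^ (zz k ℓ - 1) with hadef
  have hlopos : 0 < (1 - 2 * y) * κ := mul_pos (by linarith) hκ
  have ha0 : 0 < a := by positivity
  have ha1 : a ≤ 101 / 100 * x :=
    ha.trans (mul_le_mul_of_nonneg_right (by linarith) hx0.le)
  have haz : ε ^ 2 * κ * ((1 - 2 * y) * κ)⁻¹ ^ zz k ℓ ≤ 102 / 100 * (ε ^ 2 * x) := by
    have e1 : ((1 - 2 * y) * κ)⁻¹ ^ zz k ℓ = a * ((1 - 2 * y) * κ)⁻¹ := by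
      rw [hadef, ← pow_succ]
      congr 1
      omega
    have e2 : (1 - 2 * y)⁻¹ ≤ 102 / 101 := by
      rw [inv_le_iff_one_le_mul₀ (by linarith)]
      linarith
    have e3 : 0 ≤ (1 - 2 * y)⁻¹ := inv_nonneg.2 (by linarith)
    calc _ = ε ^ 2 * a * (1 - 2 * y)⁻¹ := by
          rw [e1, mul_inv]
          field_simp
      _ ≤ ε ^ 2 * (101 / 100 * x) * (102 / 101) := by gcongr
      _ = _ := by ring
  have hR : a ^ 2 + ε ^ 2 * κ * ((1 - 2 * y) * κ)⁻¹ ^ zz k ℓ ≤ 21 / 10 * (ε ^ 2 * x) := by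
    have h1 : a ^ 2 ≤ (101 / 100 * x) ^ 2 := pow_le_pow_left₀ ha0.le ha1 2
    have h2 : x * x ≤ ε ^ 2 * x := mul_le_mul_of_nonneg_right hxε hx0.le
    have h3 : (101 / 100 * x) ^ 2 = (101 / 100) ^ 2 * (x * x) := by ring
    have h4 : 0 ≤ ε ^ 2 * x := by positivity
    linarith
  exact ⟨ha, hb, hR, hx0, hxε, hu0⟩

open Classical in
-- The constant: `2 * z + 2` sets, each with error `1.03 * u` for `u = 2 * (z - 1) * z * ε`, give
-- `4.12 * (z ^ 3 - z) * ε`.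
theorem leftover_mean_bounds (S : Scale k ℓ n ε p K) {H : KGraph (Fin n) k} {r : ℕ}
    {σ : Fin r → Equiv.Perm (Fin n)} (hσ : GoodPerms H ℓ ε p σ) {d : ℕ} (hd : d ≤ k)
    {A : Finset (Finset (Fin n))} (hA : ∀ a ∈ A, a.card = k - d) (hs : A.card ≤ 2 * zz k ℓ + 2)
    {x : ℝ} (hx : x = 1 / kap n k ε ^ (zz k ℓ - 1)) :
    (completions H d A).card * (1 - A.card * x - 412 / 100 * ((zz k ℓ : ℝ) ^ 3 * (ε * x))) ≤
      Ex (labelsWeight H ℓ σ) (fun lab => ((completions (leftover H ℓ (σ, lab)) d A).card : ℝ)) ∧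
    Ex (labelsWeight H ℓ σ) (fun lab => ((completions (leftover H ℓ (σ, lab)) d A).card : ℝ)) ≤
      (completions H d A).card * (1 - A.card * x + 412 / 100 * ((zz k ℓ : ℝ) ^ 3 * (ε * x)) +
        ε * x / 50) := by
  have hε := S.eps_pos
  have hκ := S.kap_pos
  have hκ1 := S.one_le_kap
  have hκ6 := S.eps_sq_kap
  have hz := S.two_le_zz
  have hz2 := (params_facts S.l_pos S.l_lt).1
  obtain ⟨-, hε1, hw⟩ := S.zz_eps
  obtain ⟨m1, m2⟩ := leftover_mean S.l_pos S.l_lt hσ.index hσ.pairs (by positivity) hd hA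
  obtain ⟨ha, hb, hR, hx0, hxε, hu0⟩ := S.index_pow_bounds hx rfl
  generalize ((1 - 2 * (zz k ℓ * ε)) * kap n k ε)⁻¹ ^ (zz k ℓ - 1) = a at *
  generalize ((1 + 2 * (zz k ℓ * ε)) * kap n k ε)⁻¹ ^ (zz k ℓ - 1) = b at *
  generalize ε ^ 2 * kap n k ε * ((1 - 2 * (zz k ℓ * ε)) * kap n k ε)⁻¹ ^ zz k ℓ = b' at *
  set z : ℝ := (zz k ℓ : ℝ) with hzdef
  set u : ℝ := 2 * (z - 1) * (z * ε) with hu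
  have hs1 : (A.card : ℝ) ≤ 2 * z + 2 := by rw [hzdef]; exact_mod_cast hs
  set s : ℝ := (A.card : ℝ) with hsdef
  have hs0 : 0 ≤ s := by positivity
  have hsR : s ^ 2 * (a ^ 2 + b') ≤ ε * x / 50 := by
    have hs3 : s ≤ 3 * z := by linarith
    calc _ ≤ s ^ 2 * (21 / 10 * (ε ^ 2 * x)) := by gcongr
      _ ≤ (3 * z) ^ 2 * (21 / 10 * (ε ^ 2 * x)) := by gcongr
      _ = 189 / 10 * (z ^ 2 * ε) * (ε * x) := by ring
      _ ≤ 189 / 10 * (1 / 1000) * (ε * x) := by gcongr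
      _ ≤ _ := by
        have : 0 < ε * x := by positivity
        linarith
  have hsu : s * (103 / 100 * u * x) ≤ 412 / 100 * (z ^ 3 * (ε * x)) := by
    have hz1 : 0 ≤ z - 1 := by linarith
    calc _ ≤ (2 * z + 2) * (103 / 100 * u * x) := by gcongr
      _ = 412 / 100 * ((z ^ 3 - z) * (ε * x)) := by rw [hu]; ring
      _ ≤ _ := by gcongr; linarith
  have hc0 : (0 : ℝ) ≤ (completions H d A).card := by positivity
  constructor
  · refine le_trans (mul_le_mul_of_nonneg_left ?_ hc0) m1
    have : s * a ≤ s * ((1 + 103 / 100 * u) * x) := by gcongr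
    linarith
  · refine m2.trans (mul_le_mul_of_nonneg_left ?_ hc0)
    have : s * ((1 - 103 / 100 * u) * x) ≤ s * b := by gcongr
    linarith

end Scale

theorem isRegular_iff_completions {n k ℓ : ℕ} {H : KGraph (Fin n) k} {ε p : ℝ} :
    H.IsRegular ℓ ε p ↔ ∀ (d : ℕ) (A : Finset (Finset (Fin n))), 1 ≤ d → d ≤ ℓ → 1 ≤ A.card →
      A.card ≤ 2 * zz k ℓ + 2 → (∀ a ∈ A, a.card = k - d) →
      (A.biUnion id).card ≤ k + 2 * qq k ℓ →
      Within ε ((completions H d A).card : ℝ) ((n : ℝ) ^ d / d.factorial * p ^ A.card) := by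
  unfold KGraph.IsRegular
  constructor
  · intro h d A hd1 hd hs1 hs hA hU
    have := h d A.card hd1 hd hs1 hs A rfl hA (by convert hU)
    rw [Fintype.card_fin] at this
    convert this using 3
    ext D
    simp only [mem_completions, Finset.mem_filter, Finset.mem_univ, true_and]
    convert Iff.rfl
  · rintro h d s hd1 hd hs1 hs A rfl hA hU
    have := h d A hd1 hd hs1 hs hA (by convert hU)
    rw [Fintype.card_fin]
    convert this using 3
    ext D
    simp only [mem_completions, Finset.mem_filter, Finset.mem_univ, true_and]
    convert Iff.rfl

namespace Scale

variable {k ℓ n : ℕ} {ε p K : ℝ}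

theorem Pr_leftover_bad (S : Scale k ℓ n ε p K) (hK : LargeConst k ℓ K) {H : KGraph (Fin n) k}
    (hH : H.IsRegular ℓ ε p) {r : ℕ} {σ : Fin r → Equiv.Perm (Fin n)} (hσ : GoodPerms H ℓ ε p σ)
    {d : ℕ} (hd1 : 1 ≤ d) (hd : d ≤ ℓ) {A : Finset (Finset (Fin n))} (hA0 : 1 ≤ A.card)
    (hA : ∀ a ∈ A, a.card = k - d) (hs : A.card ≤ 2 * zz k ℓ + 2)
    (hU : (A.biUnion id).card ≤ k + 2 * qq k ℓ) :
    Pr (labelsWeight H ℓ σ) (fun lab =>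
      ¬ Within (ε * (1 + 7 * (zz k ℓ : ℝ) ^ 3 / kap n k ε ^ (zz k ℓ - 1)))
        ((completions (leftover H ℓ (σ, lab)) d A).card : ℝ)
        ((n : ℝ) ^ d / d.factorial * (p * (1 - 1 / kap n k ε ^ (zz k ℓ - 1))) ^ A.card)) ≤
      2 * ((n : ℝ) ^ (k * (2 * zz k ℓ + 2) + k + 2 * zz k ℓ + 10))⁻¹ := by
  have hn : (0 : ℝ) < n := by exact_mod_cast S.n_pos
  have hp := S.p_pos
  have hε := S.eps_pos
  have hz := S.two_le_zz
  have hκ := S.kap_pos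
  obtain ⟨hz1, hε1, hw⟩ := S.zz_eps
  have hdk : d ≤ k := by have := S.l_lt; omega
  obtain ⟨x, hx⟩ : ∃ x, x = 1 / kap n k ε ^ (zz k ℓ - 1) := ⟨_, rfl⟩
  obtain ⟨-, -, -, hx0, hxε, -⟩ := S.index_pow_bounds hx rfl
  obtain ⟨hE1, hE2⟩ := S.leftover_mean_bounds hσ hdk hA hs hx
  have hexp := S.exp_leftover_le hK hd1 hd hs
  have hc : Within ε ((completions H d A).card : ℝ) ((n : ℝ) ^ d / d.factorial * p ^ A.card) :=
    isRegular_iff_completions.1 hH d A hd1 hd hA0 hs hA hU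
  have hε' : ε * (1 + 7 * (zz k ℓ : ℝ) ^ 3 / kap n k ε ^ (zz k ℓ - 1)) =
      ε + 7 * ((zz k ℓ : ℝ) ^ 3 * (ε * x)) := by rw [hx]; ring
  have hs1 : (A.card : ℝ) ≤ 3 * zz k ℓ := by
    have : (A.card : ℝ) ≤ 2 * zz k ℓ + 2 := by exact_mod_cast hs
    linarith
  rw [hε', ← hx, mul_pow, ← mul_assoc (_ / _)]
  rw [← hx] at hexp
  set B : ℝ := (n : ℝ) ^ d / d.factorial * p ^ A.card with hB
  have hB0 : 0 < B := by positivity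
  -- `432 = 2 * 3 * 2 * 6 ^ 2`: at most `2 * B` completions, `|A| ≤ 3 * z`, index sets of size at
  -- most `2 * κ`, and differences of at most `6 * z ^ 2`.
  have hconc := leftover_concentration S.l_pos S.l_lt hσ.index hdk hA
    (B := 432 * (zz k ℓ : ℝ) ^ 6 * kap n k ε * B) (t := ε * x * B) (by positivity) (by positivity)
    (by
      have h1 : ((completions H d A).card : ℝ) ≤ 2 * B :=
        hc.2.trans (mul_le_mul_of_nonneg_right (by linarith) hB0.le)
      have h2 : (1 + 2 * (zz k ℓ * ε)) * kap n k ε ≤ 2 * kap n k ε :=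
        mul_le_mul_of_nonneg_right (by linarith) hκ.le
      calc _ ≤ 2 * B * (3 * zz k ℓ) * (2 * kap n k ε) * zz k ℓ * (2 * zz k ℓ * (3 * zz k ℓ)) ^ 2 := by
            gcongr
        _ = _ := by ring)
  refine (Pr_mono labelsWeight_isProb fun lab hlab => ?_).trans (hconc.trans
    (mul_le_mul_of_nonneg_left hexp zero_le_two))
  by_contra hlt
  rw [not_le] at hlt
  apply hlab
  have hg : 0 < ε * x := by positivity
  have hsx0 : 0 ≤ A.card * x := by positivity
  have hsx : A.card * x ≤ 3 * zz k ℓ * ε * ε := by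
    calc A.card * x ≤ 3 * zz k ℓ * ε ^ 2 := by gcongr
      _ = _ := by ring
  have hx1 : x ≤ 1 := hxε.trans (by nlinarith)
  refine within_of_mean hε hε1 hx0 ?_ ?_ ?_ hB0 hc ?_ ?_ hE1 hE2 hlt.le
  · have : (8 : ℝ) ≤ (zz k ℓ : ℝ) ^ 3 := by
      calc (8 : ℝ) = 2 ^ 3 := by norm_num
        _ ≤ _ := by gcongr
    exact mul_le_mul_of_nonneg_right this hg.le
  · calc (zz k ℓ : ℝ) ^ 3 * (ε * x) ≤ (zz k ℓ : ℝ) ^ 3 * (ε * ε ^ 2) := by gcongr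
      _ = (zz k ℓ : ℝ) ^ 2 * ε * (zz k ℓ * ε * ε) := by ring
      _ ≤ 1 / 1000 * (1 * 1) := by
        gcongr
        · linarith
        · linarith
      _ = _ := by norm_num
  · refine hsx.trans ?_
    calc 3 * zz k ℓ * ε * ε = 3 * (zz k ℓ * ε) * ε := by ring
      _ ≤ 3 * 1 * (1 / 4000) := by
        gcongr
        linarith
      _ ≤ _ := by norm_num
  · exact one_sub_pow_ge hx1
  · refine (one_sub_pow_le hx0.le hx1).trans ?_
    have : (A.card * x) ^ 2 ≤ ε * x / 100 := by
      calc (A.card * x) ^ 2 = (A.card : ℝ) ^ 2 * (x * x) := by ring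
        _ ≤ (3 * zz k ℓ) ^ 2 * (ε ^ 2 * x) := by gcongr
        _ = 9 * ((zz k ℓ : ℝ) ^ 2 * ε) * (ε * x) := by ring
        _ ≤ 9 * (1 / 1000) * (ε * x) := by gcongr
        _ ≤ _ := by linarith
    linarith

/-- The two conclusions about an outcome of the procedure. -/
def _root_.HamPacking.GoodOutcome {n k r : ℕ} (H : KGraph (Fin n) k) (ℓ : ℕ) (ε p : ℝ)
    (ω : Outcome n r) : Prop :=
  (∀ i : Fin r, DigraphRegular (prunedDigraph H ℓ ω i) (12 * (zz k ℓ : ℝ) ^ 2 * ε)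
    ((p / kap n k ε) ^ zz k ℓ)) ∧
  (leftover H ℓ ω).IsRegular ℓ (ε * (1 + 7 * (zz k ℓ : ℝ) ^ 3 / kap n k ε ^ (zz k ℓ - 1)))
    (p * (1 - 1 / kap n k ε ^ (zz k ℓ - 1)))

open Classical in
theorem Pr_pruned_bad (S : Scale k ℓ n ε p K) (hK : LargeConst k ℓ K) {H : KGraph (Fin n) k}
    {r : ℕ} (hr : |(r : ℝ) - numPerms n k ℓ ε p| < 1) {σ : Fin r → Equiv.Perm (Fin n)}
    (hσ : GoodPerms H ℓ ε p σ) :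
    Pr (labelsWeight H ℓ σ) (fun lab => ¬ ∀ i : Fin r,
      DigraphRegular (prunedDigraph H ℓ (σ, lab) i) (12 * (zz k ℓ : ℝ) ^ 2 * ε)
        ((p / kap n k ε) ^ zz k ℓ)) ≤ 2 * ((n : ℝ) ^ 3)⁻¹ := by
  have hn1 : (1 : ℝ) ≤ n := by exact_mod_cast S.n_pos
  have hn : (0 : ℝ) < n := by linarith
  set F : Finset (Finset (Fin (n / qq k ℓ))) := Finset.univ.filter fun P => P.card ≤ 2 with hF
  have hFc : (F.card : ℝ) ≤ ((n : ℝ) ^ 2) ^ 2 := by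
    have h1 := card_finsets_card_le_two (Fin (n / qq k ℓ))
    rw [Fintype.card_fin] at h1
    have h2 : 2 ≤ n := by
      have h2 : (2 : ℝ) ≤ n := S.le_n (le_trans (by
        have : (1 : ℝ) ≤ qq k ℓ := by exact_mod_cast S.qq_pos
        push_cast
        nlinarith) hK.desc)
      exact_mod_cast h2
    have h3 : n / qq k ℓ + 1 ≤ n ^ 2 := by
      have := Nat.div_le_self n (qq k ℓ)
      nlinarith
    exact_mod_cast h1.trans (Nat.pow_le_pow_left h3 2)
  have b := Pr_exists_le (labelsWeight_isProb (H := H) (ℓ := ℓ) (σ := σ))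
    ((Finset.univ : Finset (Fin r)) ×ˢ (F ×ˢ F)) fun y lab =>
      ¬ Within (12 * (zz k ℓ : ℝ) ^ 2 * ε)
        ((commonNbrs (prunedDigraph H ℓ (σ, lab) y.1) y.2.1 y.2.2).card : ℝ)
        ((n / qq k ℓ : ℕ) * ((p / kap n k ε) ^ zz k ℓ) ^ (y.2.1.card + y.2.2.card))
  have c : ∑ y ∈ (Finset.univ : Finset (Fin r)) ×ˢ (F ×ˢ F), Pr (labelsWeight H ℓ σ) (fun lab =>
      ¬ Within (12 * (zz k ℓ : ℝ) ^ 2 * ε)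
        ((commonNbrs (prunedDigraph H ℓ (σ, lab) y.1) y.2.1 y.2.2).card : ℝ)
        ((n / qq k ℓ : ℕ) * ((p / kap n k ε) ^ zz k ℓ) ^ (y.2.1.card + y.2.2.card))) ≤
      2 * ((n : ℝ) ^ 3)⁻¹ := by
    refine (Finset.sum_le_card_nsmul _ _ (2 * ((n : ℝ) ^ (k + 12))⁻¹) fun y hy => ?_).trans ?_
    · obtain ⟨h1, h2⟩ := Finset.mem_product.1 (Finset.mem_product.1 hy).2
      exact S.Pr_nbrs_bad hK hσ y.1 (Finset.mem_filter.1 h1).2 (Finset.mem_filter.1 h2).2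
    rw [nsmul_eq_mul, Finset.card_product, Finset.card_univ, Fintype.card_fin, Finset.card_product]
    have h2 := S.perms_le_pow hK hr
    push_cast
    calc _ ≤ (n : ℝ) ^ k * (((n : ℝ) ^ 2) ^ 2 * ((n : ℝ) ^ 2) ^ 2) *
          (2 * ((n : ℝ) ^ (k + 12))⁻¹) := by gcongr
      _ = 2 * ((n : ℝ) ^ 4)⁻¹ := by
        rw [pow_add]
        field_simp
      _ ≤ _ := by gcongr; omega
  refine (Pr_mono labelsWeight_isProb fun lab hlab => ?_).trans (b.trans c)
  by_contra hcon
  push Not at hcon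
  refine hlab fun i => digraphRegular_of_commonNbrs fun P Q hP hQ => ?_
  exact hcon (i, P, Q) (Finset.mem_product.2 ⟨Finset.mem_univ _, Finset.mem_product.2
    ⟨Finset.mem_filter.2 ⟨Finset.mem_univ _, hP⟩, Finset.mem_filter.2 ⟨Finset.mem_univ _, hQ⟩⟩⟩)

open Classical in
theorem Pr_leftover_irregular (S : Scale k ℓ n ε p K) (hK : LargeConst k ℓ K)
    {H : KGraph (Fin n) k} (hH : H.IsRegular ℓ ε p) {r : ℕ} {σ : Fin r → Equiv.Perm (Fin n)}
    (hσ : GoodPerms H ℓ ε p σ) :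
    Pr (labelsWeight H ℓ σ) (fun lab => ¬ (leftover H ℓ (σ, lab)).IsRegular ℓ
      (ε * (1 + 7 * (zz k ℓ : ℝ) ^ 3 / kap n k ε ^ (zz k ℓ - 1)))
      (p * (1 - 1 / kap n k ε ^ (zz k ℓ - 1)))) ≤ 2 * ((n : ℝ) ^ 3)⁻¹ := by
  have hn1 : (1 : ℝ) ≤ n := by exact_mod_cast S.n_pos
  have hn : (0 : ℝ) < n := by linarith
  set T : Finset (Σ _ : ℕ × ℕ, Finset (Finset (Fin n))) :=
    (Finset.range (ℓ + 1) ×ˢ Finset.range (2 * zz k ℓ + 3)).sigma fun y =>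
      Finset.powersetCard y.2 (Finset.powersetCard (k - y.1) Finset.univ) with hT
  have hTc : (T.card : ℝ) ≤ (n : ℝ) ^ (k * (2 * zz k ℓ + 2) + k + 2 * zz k ℓ + 3) := by
    have h1 : T.card ≤ (ℓ + 1) * (2 * zz k ℓ + 3) * n ^ (k * (2 * zz k ℓ + 2)) := by
      rw [hT, Finset.card_sigma]
      refine (Finset.sum_le_card_nsmul _ _ (n ^ (k * (2 * zz k ℓ + 2))) fun y hy => ?_).trans ?_
      · have hy := Finset.mem_range.1 (Finset.mem_product.1 hy).2
        rw [Finset.card_powersetCard, Finset.card_powersetCard, Finset.card_univ, Fintype.card_fin]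
        calc (n.choose (k - y.1)).choose y.2 ≤ (n ^ (k - y.1)) ^ y.2 :=
              (Nat.choose_le_pow _ _).trans (Nat.pow_le_pow_left (Nat.choose_le_pow _ _) _)
          _ ≤ (n ^ k) ^ (2 * zz k ℓ + 2) := by
            refine (Nat.pow_le_pow_left (Nat.pow_le_pow_right S.n_pos (Nat.sub_le _ _)) _).trans ?_
            exact Nat.pow_le_pow_right (Nat.pow_pos S.n_pos) (by omega)
          _ = _ := by rw [← pow_mul]
      · rw [Finset.card_product, Finset.card_range, Finset.card_range, smul_eq_mul]
    have h2 : 2 ≤ n := by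
      have h2 : (2 : ℝ) ≤ n := S.le_n (le_trans (by
        have : (1 : ℝ) ≤ qq k ℓ := by exact_mod_cast S.qq_pos
        push_cast
        nlinarith) hK.desc)
      exact_mod_cast h2
    have h3 : ∀ m : ℕ, m ≤ n ^ m := fun m => (Nat.lt_pow_self h2).le
    have h4 : T.card ≤ n ^ (k * (2 * zz k ℓ + 2) + k + 2 * zz k ℓ + 3) := by
      refine h1.trans ?_
      calc (ℓ + 1) * (2 * zz k ℓ + 3) * n ^ (k * (2 * zz k ℓ + 2))
          ≤ n ^ k * n ^ (2 * zz k ℓ + 3) * n ^ (k * (2 * zz k ℓ + 2)) := by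
            gcongr
            · exact le_trans (by have := S.l_lt; have := S.l_pos; omega) (h3 k)
            · exact h3 _
        _ = _ := by rw [← pow_add, ← pow_add]; congr 1; ring
    exact_mod_cast h4
  have b := Pr_exists_le (labelsWeight_isProb (H := H) (ℓ := ℓ) (σ := σ))
    (T.filter fun y => 1 ≤ y.1.1 ∧ 1 ≤ y.1.2 ∧ (y.2.biUnion id).card ≤ k + 2 * qq k ℓ) fun y lab =>
      ¬ Within (ε * (1 + 7 * (zz k ℓ : ℝ) ^ 3 / kap n k ε ^ (zz k ℓ - 1)))
        ((completions (leftover H ℓ (σ, lab)) y.1.1 y.2).card : ℝ)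
        ((n : ℝ) ^ y.1.1 / y.1.1.factorial *
          (p * (1 - 1 / kap n k ε ^ (zz k ℓ - 1))) ^ y.2.card)
  refine (Pr_mono labelsWeight_isProb fun lab hlab => ?_).trans (b.trans
    ((Finset.sum_le_card_nsmul _ _
      (2 * ((n : ℝ) ^ (k * (2 * zz k ℓ + 2) + k + 2 * zz k ℓ + 10))⁻¹) fun y hy => ?_).trans ?_))
  · by_contra hcon
    push Not at hcon
    refine hlab (isRegular_iff_completions.2 fun d A hd1 hd hs1 hs hA hU => ?_)
    refine hcon ⟨(d, A.card), A⟩ (Finset.mem_filter.2 ⟨Finset.mem_sigma.2 ⟨Finset.mem_product.2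
      ⟨Finset.mem_range.2 (Nat.lt_succ_of_le hd), Finset.mem_range.2 (Nat.lt_succ_of_le hs)⟩,
        Finset.mem_powersetCard.2
        ⟨fun a ha => Finset.mem_powersetCard.2 ⟨Finset.subset_univ _, hA a ha⟩, rfl⟩⟩,
      hd1, hs1, ?_⟩)
    convert hU
  · obtain ⟨hy, h1, h2, h3⟩ := Finset.mem_filter.1 hy
    obtain ⟨hy1, hy2⟩ := Finset.mem_sigma.1 hy
    obtain ⟨h4, h5⟩ := Finset.mem_product.1 hy1
    obtain ⟨h6, h7⟩ := Finset.mem_powersetCard.1 hy2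
    have h4 := Finset.mem_range.1 h4
    have h5 := Finset.mem_range.1 h5
    exact S.Pr_leftover_bad hK hH hσ h1 (by omega) (by omega)
      (fun a ha => (Finset.mem_powersetCard.1 (h6 ha)).2) (by omega) h3
  · rw [nsmul_eq_mul]
    have h1 : ((T.filter fun y => 1 ≤ y.1.1 ∧ 1 ≤ y.1.2 ∧
        (y.2.biUnion id).card ≤ k + 2 * qq k ℓ).card : ℝ) ≤ _ :=
      (Nat.cast_le.2 (Finset.card_filter_le _ _)).trans hTc
    generalize k * (2 * zz k ℓ + 2) + k + 2 * zz k ℓ = m at *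
    calc _ ≤ (n : ℝ) ^ (m + 3) * (2 * ((n : ℝ) ^ (m + 10))⁻¹) := by gcongr
      _ = 2 * ((n : ℝ) ^ 7)⁻¹ := by
        rw [show m + 10 = m + 3 + 7 by ring, pow_add _ (m + 3)]
        field_simp
      _ ≤ _ := by gcongr; omega

theorem Pr_outcome_bad (S : Scale k ℓ n ε p K) (hK : LargeConst k ℓ K)
    {H : KGraph (Fin n) k} (hH : H.IsRegular ℓ ε p) {r : ℕ}
    (hr : |(r : ℝ) - numPerms n k ℓ ε p| < 1) {σ : Fin r → Equiv.Perm (Fin n)}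
    (hσ : GoodPerms H ℓ ε p σ) :
    Pr (labelsWeight H ℓ σ) (fun lab => ¬ GoodOutcome H ℓ ε p (σ, lab)) ≤
      4 * ((n : ℝ) ^ 3)⁻¹ := by
  refine (Pr_mono labelsWeight_isProb (B := fun lab => _ ∨ _)
    fun lab hlab => not_and_or.1 hlab).trans ((Pr_or_le labelsWeight_isProb _ _).trans
      ((add_le_add (S.Pr_pruned_bad hK hr hσ) (S.Pr_leftover_irregular hK hH hσ)).trans ?_))
  linarith

end Scale

/-! ### From `PMF` to finite sums, choice of the constants, and conclusion. -/

theorem indicator_ne_top {Ω : Type*} (μ : PMF Ω) (s : Set Ω) (ω : Ω) : s.indicator μ ω ≠ ⊤ :=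
  ne_top_of_le_ne_top (μ.apply_ne_top ω) (Set.indicator_le_self _ _ _)

theorem toReal_toOuterMeasure {Ω : Type*} [Fintype Ω] (μ : PMF Ω) (s : Set Ω) :
    (μ.toOuterMeasure s).toReal = Pr (fun ω => (μ ω).toReal) (fun ω => ω ∈ s) := by
  classical
  rw [PMF.toOuterMeasure_apply_fintype, ENNReal.toReal_sum fun ω _ => ?_]
  · refine Finset.sum_congr rfl fun ω _ => ?_
    by_cases h : ω ∈ s <;> simp [h]
  · exact indicator_ne_top μ s ω

theorem indepPMF_toReal {ι α : Type} [Fintype ι] [DecidableEq ι] [Fintype α] [DecidableEq α]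
    (μ : ι → PMF α) (f : ι → α) :
    (indepPMF μ f).toReal = prodWeight (fun i a => (μ i a).toReal) f := by
  simp [indepPMF, prodWeight, ENNReal.toReal_prod]

/-- Splits off the permutations, on which the law of the labels depends; given them, that law is a
product. -/
theorem procedure_toReal {n k : ℕ} (H : KGraph (Fin n) k) (ℓ r : ℕ) (s : Set (Outcome n r)) :
    ((procedure H ℓ r).toOuterMeasure s).toReal =
      Ex (permsWeight n r) fun σ => Pr (labelsWeight H ℓ σ) fun lab => (σ, lab) ∈ s := by
  classical
  unfold procedure
  rw [PMF.toOuterMeasure_bind_apply, tsum_fintype, ENNReal.toReal_sum fun σ _ => ?_]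
  · refine Finset.sum_congr rfl fun σ _ => ?_
    rw [ENNReal.toReal_mul, PMF.toOuterMeasure_map_apply, toReal_toOuterMeasure, indepPMF_toReal]
    congr 1
    · simp [permsWeight, prodWeight, unif, PMF.uniformOfFintype_apply]
    · unfold labelsWeight
      refine Finset.sum_congr rfl fun lab _ => ?_
      beta_reduce
      rw [indepPMF_toReal]
      rfl
  · refine ENNReal.mul_ne_top (PMF.apply_ne_top _ _) ?_
    rw [PMF.toOuterMeasure_apply_fintype]
    exact ENNReal.sum_ne_top.2 fun ω _ => indicator_ne_top _ _ ω

theorem Ex_Pr_ge {Ω Ω' : Type*} [Fintype Ω] [Fintype Ω'] {μ : Ω → ℝ} {ν : Ω → Ω' → ℝ}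
    (hμ : IsProb μ) (hν : ∀ ω, IsProb (ν ω)) {G : Ω → Prop} {A : Ω → Ω' → Prop} {a b : ℝ}
    (hG : Pr μ (fun ω => ¬ G ω) ≤ a) (hb : 0 ≤ b)
    (hA : ∀ ω, G ω → Pr (ν ω) (fun ω' => ¬ A ω ω') ≤ b) :
    1 - (a + b) ≤ Ex μ fun ω => Pr (ν ω) (A ω) := by
  classical
  have h : ∀ ω, μ ω - (if ¬ G ω then μ ω else 0) - μ ω * b ≤ μ ω * Pr (ν ω) (A ω) := by
    intro ω
    have h0 := hμ.nonneg ω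
    have h1 := Pr_nonneg (hν ω) (A ω)
    by_cases hg : G ω
    · have h2 := hA ω hg
      rw [Pr_not (hν ω)] at h2
      have := mul_le_mul_of_nonneg_left (show 1 - b ≤ Pr (ν ω) (A ω) by linarith) h0
      simp only [hg, not_true_eq_false, if_false]
      linarith
    · simp only [hg, not_false_eq_true, if_true]
      have := mul_nonneg h0 h1
      have := mul_nonneg h0 hb
      linarith
  have h2 := Finset.sum_le_sum fun ω (_ : ω ∈ Finset.univ) => h ω
  rw [Finset.sum_sub_distrib, Finset.sum_sub_distrib, ← Finset.sum_mul, hμ.sum_one] at h2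
  have h3 : ∑ ω, (if ¬ G ω then μ ω else 0) = Pr μ (fun ω => ¬ G ω) := by
    unfold Pr
    exact Finset.sum_congr rfl fun ω _ => by congr
  rw [h3] at h2
  unfold Ex
  linarith

theorem Scale.Pr_procedure_ge {k ℓ n : ℕ} {ε p K : ℝ} (S : Scale k ℓ n ε p K)
    (hK : LargeConst k ℓ K) {H : KGraph (Fin n) k} (hH : H.IsRegular ℓ ε p) {r : ℕ}
    (hr : |(r : ℝ) - numPerms n k ℓ ε p| < 1) :
    1 - 9 * ((n : ℝ) ^ 3)⁻¹ ≤
      ((procedure H ℓ r).toOuterMeasure {ω | GoodOutcome H ℓ ε p ω}).toReal := by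
  rw [procedure_toReal]
  have := Ex_Pr_ge (permsWeight_isProb n r)
    (fun σ => labelsWeight_isProb (H := H) (ℓ := ℓ) (σ := σ)) (S.Pr_notGood_le hK hH hr)
    (A := fun σ lab => GoodOutcome H ℓ ε p (σ, lab)) (by positivity)
    fun σ hσ => S.Pr_outcome_bad hK hH hr hσ
  refine le_trans (le_of_eq ?_) this
  ring

theorem exists_largeConst (k ℓ : ℕ) : ∃ K : ℝ, 1 ≤ K ∧ LargeConst k ℓ K := by
  have h : ∃ C : Fin 8 → ℝ, ∀ K, (∀ i, C i ≤ K) → LargeConst k ℓ K :=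
    -- The eight entries are found by unification with the left-hand sides of the fields of
    -- `LargeConst`.
    ⟨![_, _, _, _, _, _, _, _], fun K hK =>
      ⟨hK 0, hK 1, hK 2, hK 3, hK 4, hK 5, hK 6, hK 7⟩⟩
  obtain ⟨C, hC⟩ := h
  refine ⟨1 + ∑ i, |C i|, ?_, hC _ fun i => ?_⟩
  · have : 0 ≤ ∑ i, |C i| := Finset.sum_nonneg fun i _ => abs_nonneg _
    linarith
  · have := Finset.single_le_sum (f := fun i => |C i|) (fun i _ => abs_nonneg _)
      (Finset.mem_univ i)
    have := le_abs_self (C i)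
    linarith

/-- Regularity with `d = s = 1` counts at most `n` vertices, so `(1 - ε) * n * p ≤ n`. -/
theorem KGraph.IsRegular.density_le_two {n k ℓ : ℕ} {H : KGraph (Fin n) k} {ε p : ℝ}
    (h : H.IsRegular ℓ ε p) (hℓ : 1 ≤ ℓ) (hkn : k ≤ n) (hk : 1 ≤ k) (hε : ε ≤ 1 / 2) (hp : 0 < p) :
    p ≤ 2 := by
  have hn : (0 : ℝ) < n := by exact_mod_cast hk.trans hkn
  obtain ⟨a, -, ha⟩ := Finset.exists_subset_card_eq (s := (Finset.univ : Finset (Fin n)))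
    (n := k - 1) (by simp; omega)
  have h1 := (isRegular_iff_completions.1 h 1 {a} le_rfl hℓ (by simp) (by simp)
    (by simpa using ha) (by simp; omega)).1
  have h2 : (completions H 1 {a}).card ≤ n := by
    have : completions H 1 {a} ⊆ Finset.powersetCard 1 Finset.univ := fun D hD =>
      Finset.mem_powersetCard.2 ⟨Finset.subset_univ _, (mem_completions.1 hD).1⟩
    simpa using Finset.card_le_card this
  have h2 : ((completions H 1 {a}).card : ℝ) ≤ n := by exact_mod_cast h2
  simp only [pow_one, Nat.factorial_one, Nat.cast_one, div_one, Finset.card_singleton] at h1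
  have h3 : (1 / 2) * (n * p) ≤ n * 1 := by
    have : (1 / 2) * (n * p) ≤ (1 - ε) * (n * p) := by gcongr; linarith
    linarith
  have h4 : n * (1 / 2 * p) ≤ n * 1 := by linarith
  have := le_of_mul_le_mul_left h4 hn
  linarith

/-- A convergent ratio yields the hypotheses of the analysis for all large `n`. -/
theorem Scale.of_ratio {k ℓ n : ℕ} {ε p K : ℝ} (hℓ : 1 ≤ ℓ) (hk : 2 * ℓ < k)
    (hdvd : qq k ℓ ∣ n) (hε : 0 < ε) (hε1 : ε ≤ 1 / (1000 * (zz k ℓ : ℝ) ^ 2)) (hp : 0 < p)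
    (hp2 : p ≤ 2) (hK : 1 ≤ K) (hlog : K ≤ Real.log n)
    (hratio : K * 2 ^ (8 * zz k ℓ) ≤
      (ε ^ (8 * zz k ℓ + 2) * n * p ^ (8 * zz k ℓ)) / Real.log n ^ (4 * zz k ℓ + 1)) :
    Scale k ℓ n ε p K where
  l_pos := hℓ
  l_lt := hk
  dvd := hdvd
  eps_pos := hε
  eps_small := by
    have hz : (0 : ℝ) < zz k ℓ := by
      have := (params_facts hℓ hk).1
      positivity
    rw [le_div_iff₀ (by positivity)] at hε1
    linarith
  p_pos := hp
  p_le := hp2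
  one_le := hK
  log_ge := hlog
  growth := by
    have hL : 0 < Real.log n := by linarith
    rw [le_div_iff₀ (by positivity)] at hratio
    -- Replacing `p` by `min 1 p` costs at most `2 ^ (8z)`, the factor provided in `hratio`.
    have h1 : p / 2 ≤ min 1 p := le_min (by linarith) (by linarith)
    have h2 : p ^ (8 * zz k ℓ) ≤ (min 1 p) ^ (8 * zz k ℓ) * 2 ^ (8 * zz k ℓ) := by
      rw [← mul_pow]
      exact pow_le_pow_left₀ hp.le (by linarith) _
    refine le_of_mul_le_mul_right ?_ (show (0 : ℝ) < 2 ^ (8 * zz k ℓ) by positivity)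
    calc _ = K * 2 ^ (8 * zz k ℓ) * Real.log n ^ (4 * zz k ℓ + 1) := by ring
      _ ≤ _ := hratio
      _ ≤ ε ^ (8 * zz k ℓ + 2) * n * ((min 1 p) ^ (8 * zz k ℓ) * 2 ^ (8 * zz k ℓ)) := by gcongr
      _ = _ := by ring

theorem isLittleO_inv_cube (N : ℕ) :
    (fun n : ℕ => if n < N then (1 : ℝ) else 9 * ((n : ℝ) ^ 3)⁻¹) =o[atTop]
      fun n : ℕ => (n : ℝ)⁻¹ := by
  have h1 : Tendsto (fun n : ℕ => 9 * ((n : ℝ) ^ 2)⁻¹) atTop (𝓝 0) := by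
    have : Tendsto (fun n : ℕ => ((n : ℝ) ^ 2)⁻¹) atTop (𝓝 0) :=
      ((tendsto_pow_atTop two_ne_zero).comp tendsto_natCast_atTop_atTop).inv_tendsto_atTop
    simpa using this.const_mul 9
  have h2 := ((isLittleO_one_iff ℝ).2 h1).mul_isBigO
    (isBigO_refl (fun n : ℕ => (n : ℝ)⁻¹) atTop)
  refine h2.congr' ?_ (by simp)
  filter_upwards [eventually_ge_atTop N] with n hn
  rw [if_neg (by omega), pow_succ _ 2, mul_inv, mul_assoc]

end HamPacking

theorem lemma2p1 (k ℓ : ℕ) (hℓ : 1 ≤ ℓ) (hk : 2 * ℓ < k) :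
    ∃ ε₀ : ℝ, 0 < ε₀ ∧ ∀ ε p : ℕ → ℝ,
      (∀ n, 0 < ε n ∧ ε n ≤ ε₀) → (∀ n, 0 < p n) →
      Tendsto
        (fun n : ℕ =>
          (ε n ^ (8 * HamPacking.zz k ℓ + 2) * n * p n ^ (8 * HamPacking.zz k ℓ)) /
            Real.log n ^ (4 * HamPacking.zz k ℓ + 1)) atTop atTop →
      ∃ δ : ℕ → ℝ, δ =o[atTop] (fun n : ℕ => (n : ℝ)⁻¹) ∧
        ∀ n : ℕ, HamPacking.qq k ℓ ∣ n →
        ∀ H : HamPacking.KGraph (Fin n) k, H.IsRegular ℓ (ε n) (p n) →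
        ∀ r : ℕ, |(r : ℝ) - HamPacking.numPerms n k ℓ (ε n) (p n)| < 1 →
          1 - δ n ≤ ((HamPacking.procedure H ℓ r).toOuterMeasure
            {ω | (∀ i : Fin r, HamPacking.DigraphRegular (HamPacking.prunedDigraph H ℓ ω i)
                  (12 * (HamPacking.zz k ℓ : ℝ) ^ 2 * ε n)
                  ((p n / HamPacking.kap n k (ε n)) ^ HamPacking.zz k ℓ)) ∧
                (HamPacking.leftover H ℓ ω).IsRegular ℓ
                  (ε n * (1 + 7 * (HamPacking.zz k ℓ : ℝ) ^ 3 /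
                    HamPacking.kap n k (ε n) ^ (HamPacking.zz k ℓ - 1)))
                  (p n * (1 - 1 / HamPacking.kap n k (ε n) ^ (HamPacking.zz k ℓ - 1)))}).toReal := by
  have hz2 := (HamPacking.params_facts hℓ hk).1
  have hz : (2 : ℝ) ≤ HamPacking.zz k ℓ := by exact_mod_cast hz2
  obtain ⟨K, hK1, hK⟩ := HamPacking.exists_largeConst k ℓ
  refine ⟨1 / (1000 * (HamPacking.zz k ℓ : ℝ) ^ 2), by positivity, fun ε p hε hp hlim => ?_⟩
  have hlog : Tendsto (fun n : ℕ => Real.log n) atTop atTop :=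
    Real.tendsto_log_atTop.comp tendsto_natCast_atTop_atTop
  obtain ⟨N, hN⟩ := eventually_atTop.1 ((hlim.eventually_ge_atTop (K * 2 ^ (8 * HamPacking.zz k ℓ))).and
    ((hlog.eventually_ge_atTop K).and (eventually_ge_atTop k)))
  -- Below the threshold `N` the error term is `1` and nothing is claimed; `N` depends only on the
  -- sequences `ε` and `p`, on `k` and on `ℓ`, not on `H` or `r`.
  refine ⟨_, HamPacking.isLittleO_inv_cube N, fun n hdvd H hH r hr => ?_⟩
  split_ifs with hn
  · simp
  · obtain ⟨h1, h2, h3⟩ := hN n (not_lt.1 hn)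
    have hεn : ε n ≤ 1 / 2 := by
      refine (hε n).2.trans (one_div_le_one_div_of_le (by norm_num) ?_)
      nlinarith
    have hp2 := hH.density_le_two hℓ h3 (by omega) hεn (hp n)
    exact (HamPacking.Scale.of_ratio hℓ hk hdvd (hε n).1 (hε n).2 (hp n) hp2 hK1 h2 h1).Pr_procedure_ge
      hK hH hr
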